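/- Let $k$ be a field and let $S$ be a finite dimensional $k$-algebra. Let $L(\lambda)$, $\lambda\in\Lambda$, be a complete set of pairwise non-isomorphic simple left $S$-modules, and assume that $S$ is split, i.e. $\mathrm{End}_S(L(\lambda))=k$ for all $\lambda\in\Lambda$. Assume that $S$ is quasi-hereditary with respect to a partial order $\le$ on $\Lambda$, i.e. the category of finite dimensional left $S$-modules is a highest weight category with respect to this labelling and order, with standard modules $\Delta(\lambda)$, costandard modules $\nabla(\lambda)$ and indecomposable tilting modules $M(\lambda)$, $\lambda\in\Lambda$. Here: - $\Delta(\lambda)$ is the largest quotient $P(\lambda)/K$ of the projective cover $P(\lambda)$ of $L(\lambda)$, with $K\subseteq\mathrm{rad}\,P(\lambda)$, such that all composition factors of $\mathrm{rad}\,P(\lambda)/K$ are of the form $L(\mu)$ with $\mu<\lambda$; dually, $\nabla(\lambda)$ is the largest submodule of the injective hull $I(\lambda)$ of $L(\lambda)$ that contains $L(\lambda)$ and is such that all composition factors of $\nabla(\lambda)/L(\lambda)$ are of the form $L(\mu)$ with $\mu<\lambda$. The highest weight condition says that, for all $\lambda$, $I(\lambda)/\nabla(\lambda)$ has a finite filtration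 whose non-zero sections are of the form $\nabla(\mu)$ with $\mu>\lambda$. - A standard (respectively costandard) filtration of a finite dimensional module $X$ is a finite filtration $0=X_0\subseteq X_1\subseteq\cdots\subseteq X_n=X$ by submodules in which each $X_i/X_{i-1}$ is either $0$ or isomorphic to a standard (respectively costandard) module. A tilting module is a finite dimensional module which has both a standard and a costandard filtration. $M(\lambda)$ is the indecomposable tilting module which has $L(\lambda)$ as a composition factor and all of whose composition factors are of the form $L(\mu)$ with $\mu\le\lambda$. A tilting module $M$ is full if, for every $\lambda\in\Lambda$, $M$ has a direct summand isomorphic to $M(\lambda)$. - $S$-bimodules are identified with left $S\otimes_k S^{\mathrm{op}}$-modules. The simple $S\otimes_k S^{\mathrm{op}}$-modules are labelled by $\Lambda\times\Lambda$, via $L(\lambda,\mu)=L(\lambda)\otimes_k L(\mu)^*$, and $\Lambda\times\Lambda$ has the partial order in which $(\lambda,\mu)\le(\lambda',\mu')$ if and only if $\lambda\le\lambda'$ and $\mu\le\mu'$. A standard filtration of a finite dimensional $S$-bimodule is a standard filtration of it as a left $S\otimes_k S^{\mathrm{op}}$-module, with respect to this labelling and order. Let $M$ be a full tilting module for $S$.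 Then the representation $\rho:S\to\mathrm{End}_k(M)$ is injective, and its cokernel $\mathrm{End}_k(M)/\rho(S)$ has a standard filtration as an $S$-bimodule, where $\mathrm{End}_k(M)$ is an $S$-bimodule via $(s f t)(m)=s\,f(t m)$ for $s,t\in S$, $f\in\mathrm{End}_k(M)$, $m\in M$. -/

import Mathlib

open scoped TensorProduct

universe u

section Modules

/-! ### Composition factors, filtrations, projective covers and injective hulls -/

/-- The simple module `Y` is a composition factor of the (finite length) module `X`: it is
isomorphic to a subquotient `N' / N` of `X`. -/
def IsCompositionFactor (A : Type*) [Ring A] (Y X : Type*) [AddCommGroup Y] [Module A Y]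
    [AddCommGroup X] [Module A X] : Prop :=
  ∃ N N' : Submodule A X, N ≤ N' ∧ Nonempty ((↥N' ⧸ N.submoduleOf N') ≃ₗ[A] Y)

/-- `X` belongs to `π`: all composition factors of `X` are among the `L μ` with `μ ∈ π`. Here
`L` is a complete set of pairwise non-isomorphic simple `A`-modules. -/
def BelongsTo (A : Type*) [Ring A] {Λ : Type*} (L : Λ → Type*) [∀ i, AddCommGroup (L i)]
    [∀ i, Module A (L i)] (π : Set Λ) (X : Type*) [AddCommGroup X] [Module A X] : Prop :=
  ∀ μ : Λ, IsCompositionFactor A (L μ) X → μ ∈ π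

/-- `X` has a finite filtration `0 = F 0 ≤ F 1 ≤ ⋯ ≤ F n = X` each of whose sections
`F (i + 1) / F i` satisfies `Q`. -/
def HasFiltration (A : Type*) [Ring A] {X : Type*} [AddCommGroup X] [Module A X]
    (Q : Submodule A X → Submodule A X → Prop) : Prop :=
  ∃ (n : ℕ) (F : ℕ → Submodule A X), Monotone F ∧ F 0 = ⊥ ∧ F n = ⊤ ∧
    ∀ i < n, Q (F i) (F (i + 1))

/-- `f : P → X` is a projective cover: `P` is projective, `f` is surjective and its kernel is
superfluous. -/
structure IsProjectiveCover {A : Type*} [Ring A] {P X : Type*} [AddCommGroup P] [Module A P]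
    [AddCommGroup X] [Module A X] (f : P →ₗ[A] X) : Prop where
  projective : Module.Projective A P
  surjective : Function.Surjective f
  superfluous : ∀ N : Submodule A P, N ⊔ LinearMap.ker f = ⊤ → N = ⊤

/-- `f : X → I` is an injective hull: `I` is injective, `f` is injective and its image is
essential. -/
structure IsInjectiveHull {A : Type u} [Ring A] {X : Type*} {I : Type u} [AddCommGroup X]
    [Module A X] [AddCommGroup I] [Module A I] (f : X →ₗ[A] I) : Prop where
  injective_module : Module.Injective A I
  injective : Function.Injective f
  essential : ∀ N : Submodule A I, N ⊓ LinearMap.range f = ⊥ → N = ⊥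

/-- A module is indecomposable if it is nonzero and is not the direct sum of two nonzero
submodules. -/
def IsIndecomposableModule (A : Type*) [Ring A] (X : Type*) [AddCommGroup X] [Module A X] : Prop :=
  Nontrivial X ∧ ∀ N N' : Submodule A X, IsCompl N N' → N = ⊥ ∨ N' = ⊥

end Modules

section HighestWeight

/-! ### Standard, costandard and tilting modules, quasi-hereditary algebras

Throughout `L i`, for `i : Λ`, is a complete set of pairwise non-isomorphic simple modules for
the finite dimensional algebra `A`, and `Λ` is partially ordered. -/

variable (A : Type u) [Ring A] {Λ : Type*} [PartialOrder Λ] (L : Λ → Type*)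
  [∀ i, AddCommGroup (L i)] [∀ i, Module A (L i)]

/-- `D` is (isomorphic to) the standard module `Δ(i)`: the quotient `P(i) / K(i)`, where
`f : P(i) → L(i)` is the projective cover and `K(i)` is the smallest submodule of the radical
`ker f` of `P(i)` such that all composition factors of `ker f / K(i)` are of the form `L(j)`
with `j < i`. -/
def IsStandard (i : Λ) (D : Type*) [AddCommGroup D] [Module A D] : Prop :=
  ∃ (P : Type u) (_ : AddCommGroup P) (_ : Module A P) (f : P →ₗ[A] L i) (g : P →ₗ[A] D),
    IsProjectiveCover f ∧ Function.Surjective g ∧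
    IsLeast {K : Submodule A P | K ≤ LinearMap.ker f ∧
      BelongsTo A L (Set.Iio i) (↥(LinearMap.ker f) ⧸ K.submoduleOf (LinearMap.ker f))}
      (LinearMap.ker g)

/-- For an injective hull `f : L(i) → I(i)`, the submodule `N` of `I(i)` is the largest one
containing `L(i)` such that all composition factors of `N / L(i)` are of the form `L(j)` with
`j < i`; that is, `N` is the copy of the costandard module `∇(i)` in `I(i)`. -/
def IsCostandardSubmodule (i : Λ) {I : Type u} [AddCommGroup I] [Module A I] (f : L i →ₗ[A] I)
    (N : Submodule A I) : Prop :=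
  IsGreatest {N : Submodule A I | LinearMap.range f ≤ N ∧
    BelongsTo A L (Set.Iio i) (↥N ⧸ (LinearMap.range f).submoduleOf N)} N

/-- `D` is (isomorphic to) the costandard module `∇(i)`. -/
def IsCostandard (i : Λ) (D : Type*) [AddCommGroup D] [Module A D] : Prop :=
  ∃ (I : Type u) (_ : AddCommGroup I) (_ : Module A I) (f : L i →ₗ[A] I) (g : D →ₗ[A] I),
    IsInjectiveHull f ∧ Function.Injective g ∧
    IsCostandardSubmodule A L i f (LinearMap.range g)

/-- `X` has a standard filtration: each section is zero or a standard module. -/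
def HasStandardFiltration (X : Type*) [AddCommGroup X] [Module A X] : Prop :=
  HasFiltration A fun N N' : Submodule A X =>
    Subsingleton (↥N' ⧸ N.submoduleOf N') ∨ ∃ i, IsStandard A L i (↥N' ⧸ N.submoduleOf N')

/-- `X` has a costandard filtration: each section is zero or a costandard module. -/
def HasCostandardFiltration (X : Type*) [AddCommGroup X] [Module A X] : Prop :=
  HasFiltration A fun N N' : Submodule A X =>
    Subsingleton (↥N' ⧸ N.submoduleOf N') ∨ ∃ i, IsCostandard A L i (↥N' ⧸ N.submoduleOf N')

/-- The finite dimensional algebra `A` is quasi-hereditary with respect to the labelling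
`L i`, `i : Λ`, of its simple modules and the partial order on `Λ`: the category of finite
dimensional left `A`-modules is a highest weight category, i.e. for each `i` the injective hull
`I(i)` of `L(i)` is such that `I(i) / ∇(i)` has a filtration with sections `∇(j)`, `j > i`. -/
structure IsQuasiHereditary : Prop where
  simple : ∀ i, IsSimpleModule A (L i)
  non_isomorphic : ∀ i j, Nonempty (L i ≃ₗ[A] L j) → i = j
  complete : ∀ (X : Type u) [AddCommGroup X] [Module A X], IsSimpleModule A X →
    ∃ i, Nonempty (X ≃ₗ[A] L i)
  highest_weight : ∀ i, ∃ (I : Type u) (_ : AddCommGroup I) (_ : Module A I) (f : L i →ₗ[A] I)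
    (C : Submodule A I), IsInjectiveHull f ∧ IsCostandardSubmodule A L i f C ∧
      HasFiltration A fun N N' : Submodule A (I ⧸ C) =>
        Subsingleton (↥N' ⧸ N.submoduleOf N') ∨
          ∃ j, i < j ∧ IsCostandard A L j (↥N' ⧸ N.submoduleOf N')

/-- `T` is a (partial) tilting module: it has both a standard and a costandard filtration. -/
def IsTilting (T : Type*) [AddCommGroup T] [Module A T] : Prop :=
  HasStandardFiltration A L T ∧ HasCostandardFiltration A L T

/-- `T` is (isomorphic to) the indecomposable tilting module `M(i)`, i.e. the indecomposable
tilting module with highest weight `i`: `L(i)` is a composition factor and all composition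
factors are of the form `L(j)` with `j ≤ i`. -/
structure IsIndecomposableTilting (i : Λ) (T : Type*) [AddCommGroup T] [Module A T] : Prop where
  tilting : IsTilting A L T
  indecomposable : IsIndecomposableModule A T
  highest_weight_mem : IsCompositionFactor A (L i) T
  belongs : BelongsTo A L (Set.Iic i) T

/-- `M` is a full tilting module: a tilting module in which each `M(i)` occurs as a direct
summand. -/
structure IsFullTilting (M : Type*) [AddCommGroup M] [Module A M] : Prop where
  tilting : IsTilting A L M
  full : ∀ i, ∃ T T' : Submodule A M, IsCompl T T' ∧ IsIndecomposableTilting A L i T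

end HighestWeight

section Bimodules

/-! ### `S`-bimodules, viewed as left `S ⊗ Sᵒᵖ`-modules -/

variable (k S : Type*) [Field k] [Ring S] [Algebra k S]

/-- For a left `S`-module `X`, the right action of `S` on `Hom_k(X, Y)`: `(f · s) x = f (s x)`. -/
def homRightAction (X Y : Type*) [AddCommGroup X] [Module k X] [Module S X]
    [IsScalarTower k S X] [AddCommGroup Y] [Module k Y] :
    Sᵐᵒᵖ →ₐ[k] Module.End k (X →ₗ[k] Y) where
  toFun s := LinearMap.lcomp k Y (Algebra.lsmul k k X s.unop)
  map_one' := by ext; simp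
  map_mul' s t := by ext; simp
  map_zero' := by ext; simp
  map_add' s t := by ext; simp
  commutes' c := by ext; simp

/-- For a left `S`-module `Y`, the left action of `S` on `Hom_k(X, Y)`: `(s · f) x = s (f x)`. -/
def homLeftAction (X Y : Type*) [AddCommGroup X] [Module k X] [AddCommGroup Y] [Module k Y]
    [Module S Y] [IsScalarTower k S Y] :
    S →ₐ[k] Module.End k (X →ₗ[k] Y) where
  toFun s := LinearMap.llcomp k X Y Y (Algebra.lsmul k k Y s)
  map_one' := by ext; simp
  map_mul' s t := by ext; simp
  map_zero' := by ext; simp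
  map_add' s t := by ext; simp
  commutes' c := by ext; simp

/-- `Hom_k(X, Y)` for left `S`-modules `X`, `Y`, regarded as an `S`-bimodule. -/
def HomBimodule (_k _S X Y : Type*) [Field _k] [AddCommGroup X] [Module _k X] [AddCommGroup Y]
    [Module _k Y] : Type _ :=
  X →ₗ[_k] Y

/-- The outer tensor product `X ⊗ Y^*` for left `S`-modules `X`, `Y`, regarded as an
`S`-bimodule. -/
def OuterTensorDual (_k _S X Y : Type*) [Field _k] [AddCommGroup X] [Module _k X]
    [AddCommGroup Y] [Module _k Y] : Type _ :=
  X ⊗[_k] Module.Dual _k Y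

variable (X Y : Type*) [AddCommGroup X] [Module k X] [Module S X] [IsScalarTower k S X]
  [AddCommGroup Y] [Module k Y] [Module S Y] [IsScalarTower k S Y]

theorem commute_homLeftAction_homRightAction (s : S) (t : Sᵐᵒᵖ) :
    Commute (homLeftAction k S X Y s) (homRightAction k S X Y t) := by
  ext; rfl

/-- The action `(s ⊗ t) f = (x ↦ s (f (t x)))` of `S ⊗ Sᵒᵖ` on `Hom_k(X, Y)`. -/
def homBimoduleAction : S ⊗[k] Sᵐᵒᵖ →ₐ[k] Module.End k (X →ₗ[k] Y) :=
  Algebra.TensorProduct.lift (homLeftAction k S X Y) (homRightAction k S X Y)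
    (commute_homLeftAction_homRightAction k S X Y)

/-- The action `(s ⊗ t) (x ⊗ α) = s x ⊗ α t` of `S ⊗ Sᵒᵖ` on `X ⊗ Y^*`, where
`(α t) y = α (t y)`. -/
noncomputable def outerTensorDualAction :
    S ⊗[k] Sᵐᵒᵖ →ₐ[k] Module.End k (X ⊗[k] Module.Dual k Y) :=
  (Module.endTensorEndAlgHom (R := k) (S := k) (A := k) (M := X) (N := Module.Dual k Y)).comp
    (Algebra.TensorProduct.map (Algebra.lsmul k k X) (homRightAction k S Y k))

instance : AddCommGroup (HomBimodule k S X Y) :=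
  inferInstanceAs (AddCommGroup (X →ₗ[k] Y))

instance : Module k (HomBimodule k S X Y) :=
  inferInstanceAs (Module k (X →ₗ[k] Y))

noncomputable instance : Module (S ⊗[k] Sᵐᵒᵖ) (HomBimodule k S X Y) :=
  Module.compHom (X →ₗ[k] Y) (homBimoduleAction k S X Y).toRingHom

noncomputable instance : AddCommGroup (OuterTensorDual k S X Y) :=
  inferInstanceAs (AddCommGroup (X ⊗[k] Module.Dual k Y))

noncomputable instance : Module k (OuterTensorDual k S X Y) :=
  inferInstanceAs (Module k (X ⊗[k] Module.Dual k Y))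

noncomputable instance : Module (S ⊗[k] Sᵐᵒᵖ) (OuterTensorDual k S X Y) :=
  Module.compHom (X ⊗[k] Module.Dual k Y) (outerTensorDualAction k S X Y).toRingHom

theorem homBimodule_tmul_smul (s t : S) (f : X →ₗ[k] Y) (x : X) :
    (show X →ₗ[k] Y from (s ⊗ₜ[k] MulOpposite.op t : S ⊗[k] Sᵐᵒᵖ) •
      (show HomBimodule k S X Y from f)) x = s • f (t • x) := by
  change homBimoduleAction k S X Y (s ⊗ₜ[k] MulOpposite.op t) f x = _
  rw [homBimoduleAction, Algebra.TensorProduct.lift_tmul]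
  rfl

theorem outerTensorDual_tmul_smul (s t : S) (x : X) (α : Module.Dual k Y) :
    (s ⊗ₜ[k] MulOpposite.op t : S ⊗[k] Sᵐᵒᵖ) • (show OuterTensorDual k S X Y from x ⊗ₜ[k] α) =
      (show OuterTensorDual k S X Y from (s • x) ⊗ₜ[k] (α ∘ₗ Algebra.lsmul k k Y t)) := by
  change outerTensorDualAction k S X Y (s ⊗ₜ[k] MulOpposite.op t) (x ⊗ₜ[k] α) = _
  simp only [outerTensorDualAction, AlgHom.comp_apply, Algebra.TensorProduct.map_tmul,
    Module.endTensorEndAlgHom_apply]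
  rfl

/-- The regular bimodule: `(s ⊗ t) x = s x t`. -/
noncomputable local instance : Module (S ⊗[k] Sᵐᵒᵖ) S :=
  Module.compHom S (AlgHom.mulLeftRight k S).toRingHom

/-- The representation `S → End_k(X)` as a homomorphism of `S`-bimodules. -/
noncomputable def bimoduleRepresentation : S →ₗ[S ⊗[k] Sᵐᵒᵖ] HomBimodule k S X X where
  toFun := Algebra.lsmul k k X
  map_add' := map_add (Algebra.lsmul k k X)
  map_smul' a s := by
    change Algebra.lsmul k k X (AlgHom.mulLeftRight k S a s) =
      homBimoduleAction k S X X a (Algebra.lsmul k k X s)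
    induction a with
    | zero => simp
    | add a b ha hb => simp only [map_add, LinearMap.add_apply, ha, hb]
    | tmul a b =>
      ext x
      rw [homBimoduleAction, Algebra.TensorProduct.lift_tmul, AlgHom.mulLeftRight_apply]
      change (a * s * b.unop) • x = a • s • b.unop • x
      simp only [mul_smul]

/-- The cokernel of the representation `S → End_k(X)`, as an `S`-bimodule. -/
abbrev RepresentationCokernel : Type _ :=
  HomBimodule k S X X ⧸ LinearMap.range (bimoduleRepresentation k S X)

end Bimodules

/-!
Write `A = S ⊗ Sᵒᵖ`, `Δ(i) = P(i) / K(i)` and `∇(i) ⊆ I(i)`.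

*Injectivity.* A full tilting module `M` maps onto every `∇(i)`, and `Ext¹(M, ∇(i)) = 0` because `M`
has a standard filtration. Hence an element of `S` annihilating `M` annihilates every module with a
costandard filtration, in particular all the injective hulls `I(i)`, and so it is `0`
(`HighestWeightSystem.eq_zero_of_smul_eq_zero`).

*Standard bimodules.* The standard `A`-module with label `(i, j)` is `Hom_k(∇(j), Δ(i))`
(`HighestWeightSystem.isStandard_homBimodule`): its projective cover is `Hom_k(I(j), P(i))`, and the
kernel of `Hom_k(I(j), P(i)) → Hom_k(∇(j), Δ(i))` is generated by the images of the projective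
covers with label `(l, j)`, `l > i`, and `(i, l)`, `l > j`.

*A cohomological criterion.* A finite dimensional bimodule `B` has a standard filtration as soon as
`Ext¹_S(B, ∇(ν)) = 0` and `Ext¹_S(Δ(μ), Hom_S(B, ∇(ν))) = 0` for all `μ` and `ν`
(`HighestWeightSystem.hasStandardFiltration_of_ext`). For `i` minimal with `Hom_S(B, ∇(i)) ≠ 0`, the
first condition shows that every homomorphism `B → ∇(i)` lifts uniquely along
`Δ(i) → L(i) → ∇(i)`, so that `H = Hom_S(B, Δ(i)) ≅ Hom_S(B, ∇(i))`. Since `L(i)` is split, the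
density theorem shows that the evaluation map `B → Hom_k(H, Δ(i))` is surjective. Its
target has a standard filtration because `Ext¹_S(Δ(μ), H) = 0`, so that `H` has a costandard
filtration, and its kernel satisfies the two conditions again.

*The cokernel.* For `B = End_k(M) / S` the first condition holds because any map `S → ∇(ν)` extends
to `End_k(M)` in the form `f ↦ π (f m)`, where `π : M → ∇(ν)` is surjective. As
`Hom_S(B, ∇(ν))` is the kernel of the evaluation at `1` from
`Hom_S(End_k(M), ∇(ν)) ≅ M ⊗ Hom_S(M, ∇(ν))` to `∇(ν)`, the second condition holds because maps
`Δ(μ) → ∇(ν)` lift along `π`.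

Only `Ext¹` is used, and only its vanishing (`ExtOneVanishes`), defined by the extension property
along the kernel of a free cover.
-/

/-! ### Composition factors -/

section CompositionFactors

variable {A : Type*} [Ring A]

theorem isCompositionFactor_iff {Y X : Type*} [AddCommGroup Y] [Module A Y] [AddCommGroup X]
    [Module A X] : IsCompositionFactor A Y X ↔
      ∃ (N : Submodule A X) (φ : N →ₗ[A] Y), Function.Surjective φ := by
  constructor
  · rintro ⟨N, N', -, ⟨e⟩⟩
    exact ⟨N', e.toLinearMap ∘ₗ (N.submoduleOf N').mkQ,
      e.surjective.comp (Submodule.mkQ_surjective _)⟩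
  · rintro ⟨N, φ, hφ⟩
    refine ⟨(LinearMap.ker φ).map N.subtype, N, Submodule.map_subtype_le _ _, ⟨?_⟩⟩
    have : ((LinearMap.ker φ).map N.subtype).submoduleOf N = LinearMap.ker φ :=
      Submodule.comap_map_eq_of_injective N.subtype_injective _
    exact (Submodule.quotEquivOfEq _ _ this).trans (φ.quotKerEquivOfSurjective hφ)

variable {Y X Z : Type*} [AddCommGroup Y] [Module A Y] [AddCommGroup X] [Module A X]
  [AddCommGroup Z] [Module A Z]

theorem IsCompositionFactor.of_surjective (f : X →ₗ[A] Y) (hf : Function.Surjective f) :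
    IsCompositionFactor A Y X :=
  isCompositionFactor_iff.2 ⟨⊤, f ∘ₗ Submodule.subtype _, fun y => by
    obtain ⟨x, rfl⟩ := hf y
    exact ⟨⟨x, trivial⟩, rfl⟩⟩

theorem IsCompositionFactor.of_injective_right (h : IsCompositionFactor A Y X) (f : X →ₗ[A] Z)
    (hf : Function.Injective f) : IsCompositionFactor A Y Z := by
  obtain ⟨N, φ, hφ⟩ := isCompositionFactor_iff.1 h
  let e := Submodule.equivMapOfInjective f hf N
  exact isCompositionFactor_iff.2 ⟨N.map f, φ ∘ₗ e.symm.toLinearMap, hφ.comp e.symm.surjective⟩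

theorem IsCompositionFactor.of_surjective_right (h : IsCompositionFactor A Y X) (f : Z →ₗ[A] X)
    (hf : Function.Surjective f) : IsCompositionFactor A Y Z := by
  obtain ⟨N, φ, hφ⟩ := isCompositionFactor_iff.1 h
  refine isCompositionFactor_iff.2 ⟨N.comap f, φ ∘ₗ f.restrict (fun _ hx => hx), fun y => ?_⟩
  obtain ⟨⟨x, hx⟩, rfl⟩ := hφ y
  obtain ⟨z, rfl⟩ := hf x
  exact ⟨⟨z, hx⟩, rfl⟩

theorem IsCompositionFactor.of_injective (f : Y →ₗ[A] X) (hf : Function.Injective f) :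
    IsCompositionFactor A Y X :=
  (IsCompositionFactor.of_surjective LinearMap.id Function.surjective_id).of_injective_right f hf

/-- A linear map that vanishes on the kernel of a surjection factors through it. -/
theorem LinearMap.exists_comp_eq_of_ker_le (q : X →ₗ[A] Y) (hq : Function.Surjective q)
    (h : X →ₗ[A] Z) (hle : ∀ x, q x = 0 → h x = 0) : ∃ g : Y →ₗ[A] Z, ∀ x, g (q x) = h x := by
  refine ⟨(LinearMap.ker q).liftQ h (fun x hx => hle x hx) ∘ₗ
    (q.quotKerEquivOfSurjective hq).symm.toLinearMap, fun x => ?_⟩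
  have : (q.quotKerEquivOfSurjective hq).symm (q x) = (LinearMap.ker q).mkQ x := by
    rw [LinearEquiv.symm_apply_eq]; rfl
  rw [LinearMap.comp_apply, LinearEquiv.coe_coe, this]
  exact Submodule.liftQ_apply _ h x

/-- A composition factor of the middle term of a left exact sequence is one of the outer terms. -/
theorem IsCompositionFactor.or_of_exact [IsSimpleModule A Y] (h : IsCompositionFactor A Y X)
    (f : X →ₗ[A] Z) : IsCompositionFactor A Y (LinearMap.ker f) ∨ IsCompositionFactor A Y Z := by
  obtain ⟨N, φ, hφ⟩ := isCompositionFactor_iff.1 h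
  let N₀ : Submodule A N := (LinearMap.ker f).submoduleOf N
  rcases (φ ∘ₗ N₀.subtype).surjective_or_eq_zero with hs | h0
  · left
    let j : N₀ →ₗ[A] LinearMap.ker f :=
      (N.subtype ∘ₗ N₀.subtype).codRestrict _ (fun x => x.2)
    refine (IsCompositionFactor.of_surjective _ hs).of_injective_right j ?_
    intro a b hab
    exact Subtype.ext (Subtype.ext (congrArg (fun z => z.1) hab))
  · right
    let q := (f ∘ₗ N.subtype).rangeRestrict
    obtain ⟨g, hg⟩ := LinearMap.exists_comp_eq_of_ker_le q (LinearMap.surjective_rangeRestrict _) φ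
      (fun x hx => LinearMap.congr_fun h0 ⟨x, congrArg Subtype.val hx⟩)
    have hgs : Function.Surjective g := fun y => by
      obtain ⟨x, rfl⟩ := hφ y
      exact ⟨q x, hg x⟩
    exact isCompositionFactor_iff.2 ⟨_, g, hgs⟩

variable {Λ : Type*} {L : Λ → Type*} [∀ i, AddCommGroup (L i)] [∀ i, Module A (L i)] {π : Set Λ}

theorem BelongsTo.of_injective (h : BelongsTo A L π X) (f : Z →ₗ[A] X)
    (hf : Function.Injective f) : BelongsTo A L π Z :=
  fun i hi => h i (hi.of_injective_right f hf)

theorem BelongsTo.of_surjective (h : BelongsTo A L π X) (f : X →ₗ[A] Z)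
    (hf : Function.Surjective f) : BelongsTo A L π Z :=
  fun i hi => h i (hi.of_surjective_right f hf)

theorem BelongsTo.mono {σ : Set Λ} (h : BelongsTo A L π X) (hσ : π ⊆ σ) : BelongsTo A L σ X :=
  fun i hi => hσ (h i hi)

theorem BelongsTo.of_exact (hL : ∀ i, IsSimpleModule A (L i)) (f : X →ₗ[A] Z)
    (h₁ : BelongsTo A L π (LinearMap.ker f)) (h₂ : BelongsTo A L π Z) : BelongsTo A L π X := by
  intro i hi
  have := hL i
  exact (hi.or_of_exact f).elim (h₁ i) (h₂ i)

theorem belongsTo_simple (hL : ∀ i, IsSimpleModule A (L i))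
    (hne : ∀ i j, Nonempty (L i ≃ₗ[A] L j) → i = j) (i : Λ) : BelongsTo A L {i} (L i) := by
  intro j hj
  have := hL i
  have := hL j
  obtain ⟨N, φ, hφ⟩ := isCompositionFactor_iff.1 hj
  have hN : N = ⊤ := (eq_bot_or_eq_top N).resolve_left fun h => by
    subst h
    have := IsSimpleModule.nontrivial A (L j)
    exact not_subsingleton (L j) hφ.subsingleton
  subst hN
  have hφ0 : φ ≠ 0 := fun h => by
    have := IsSimpleModule.nontrivial A (L j)
    obtain ⟨y, hy⟩ := exists_ne (0 : L j)
    obtain ⟨x, rfl⟩ := hφ y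
    exact hy (by rw [h]; rfl)
  have hs : IsSimpleModule A (⊤ : Submodule A (L i)) := IsSimpleModule.congr Submodule.topEquiv
  exact (hne i j ⟨Submodule.topEquiv.symm.trans
    (LinearEquiv.ofBijective φ (φ.bijective_of_ne_zero hφ0))⟩).symm

end CompositionFactors

/-! ### Vanishing of the first extension group -/

section ExtOneVanishes

variable (A : Type*) [Ring A]

/-- The canonical surjection onto `X` from the free module with basis `X`. -/
noncomputable abbrev freeCover (X : Type*) [AddCommGroup X] [Module A X] : (X →₀ A) →ₗ[A] X :=
  Finsupp.linearCombination A (id : X → X)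

theorem freeCover_surjective (X : Type*) [AddCommGroup X] [Module A X] :
    Function.Surjective (freeCover A X) :=
  fun x => ⟨Finsupp.single x 1, by simp [freeCover]⟩

/-- `Ext¹(X, Y) = 0`, expressed through the canonical free presentation of `X`: every linear map
from the module of relations of `X` to `Y` extends to the free module on `X`. In this form the
condition makes sense for modules in different universes. -/
def ExtOneVanishes (X Y : Type*) [AddCommGroup X] [Module A X] [AddCommGroup Y] [Module A Y] :
    Prop :=
  ∀ φ : LinearMap.ker (freeCover A X) →ₗ[A] Y, ∃ ψ : (X →₀ A) →ₗ[A] Y, ∀ x, ψ x.1 = φ x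

variable {A}
variable {X Y Z E : Type*} [AddCommGroup X] [Module A X] [AddCommGroup Y] [Module A Y]
  [AddCommGroup Z] [Module A Z] [AddCommGroup E] [Module A E]

/-- If `Ext¹(X, Y) = 0`, maps to `Y` extend along the kernel of any surjection onto `X`. -/
theorem ExtOneVanishes.extend (h : ExtOneVanishes A X Y) (p : E →ₗ[A] X)
    (hp : Function.Surjective p) (φ : LinearMap.ker p →ₗ[A] Y) :
    ∃ ψ : E →ₗ[A] Y, ∀ x, ψ x.1 = φ x := by
  obtain ⟨a, ha⟩ := Module.projective_lifting_property p (freeCover A X) hp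
  have ha' : ∀ x, p (a x) = freeCover A X x := fun x => LinearMap.congr_fun ha x
  let r : LinearMap.ker (freeCover A X) →ₗ[A] LinearMap.ker p :=
    a.restrict (fun x hx => by rw [LinearMap.mem_ker, ha']; exact hx)
  obtain ⟨ψ, hψ⟩ := h (φ ∘ₗ r)
  have hq : Function.Surjective ((LinearMap.ker p).subtype.coprod a) := fun e => by
    obtain ⟨x, hx⟩ := freeCover_surjective A X (p e)
    exact ⟨(⟨e - a x, by rw [LinearMap.mem_ker, map_sub, ha', hx, sub_self]⟩, x), by simp⟩
  obtain ⟨g, hg⟩ := LinearMap.exists_comp_eq_of_ker_le _ hq (φ.coprod ψ) (by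
    rintro ⟨n, x⟩ hnx
    simp only [LinearMap.coprod_apply, Submodule.subtype_apply] at hnx ⊢
    have hx : x ∈ LinearMap.ker (freeCover A X) := by
      have := congrArg p hnx
      rwa [map_add, n.2, zero_add, ha', map_zero] at this
    rw [hψ ⟨x, hx⟩, LinearMap.comp_apply, ← map_add]
    convert map_zero φ
    exact Subtype.ext hnx)
  exact ⟨g, fun x => by simpa using hg (x, 0)⟩

/-- If `Ext¹(X, ker q) = 0`, maps from `X` lift along the surjection `q`. -/
theorem ExtOneVanishes.lift {q : E →ₗ[A] Z} (h : ExtOneVanishes A X (LinearMap.ker q))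
    (hq : Function.Surjective q) (φ : X →ₗ[A] Z) : ∃ ψ : X →ₗ[A] E, ∀ x, q (ψ x) = φ x := by
  obtain ⟨b, hb⟩ := Module.projective_lifting_property q (φ ∘ₗ freeCover A X) hq
  have hb' : ∀ x, q (b x) = φ (freeCover A X x) := fun x => LinearMap.congr_fun hb x
  obtain ⟨ψ, hψ⟩ := h (b.restrict (fun x hx => by
    rw [LinearMap.mem_ker, hb', LinearMap.mem_ker.1 hx, map_zero]))
  obtain ⟨g, hg⟩ := LinearMap.exists_comp_eq_of_ker_le (freeCover A X) (freeCover_surjective A X)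
    (b - (LinearMap.ker q).subtype ∘ₗ ψ) (fun x hx => by
      have := congrArg Subtype.val (hψ ⟨x, hx⟩)
      simp only [LinearMap.coe_restrict_apply] at this
      simp [this])
  refine ⟨g, fun x => ?_⟩
  obtain ⟨y, rfl⟩ := freeCover_surjective A X x
  rw [hg, LinearMap.sub_apply, map_sub, hb', LinearMap.comp_apply, Submodule.subtype_apply,
    LinearMap.mem_ker.1 (ψ y).2, sub_zero]

theorem ExtOneVanishes.of_projective [Module.Projective A X] : ExtOneVanishes A X Y := by
  intro φ
  obtain ⟨b, hb⟩ := Module.projective_lifting_property (freeCover A X) LinearMap.id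
    (freeCover_surjective A X)
  have hb' : ∀ x, freeCover A X (b x) = x := fun x => LinearMap.congr_fun hb x
  let r : (X →₀ A) →ₗ[A] LinearMap.ker (freeCover A X) :=
    (LinearMap.id - b ∘ₗ freeCover A X).codRestrict _ (fun x => by
      rw [LinearMap.mem_ker, LinearMap.sub_apply, map_sub, LinearMap.comp_apply, hb']
      exact sub_self _)
  refine ⟨φ ∘ₗ r, fun x => ?_⟩
  rw [LinearMap.comp_apply]
  congr 1
  refine Subtype.ext ?_
  change x.1 - b (freeCover A X x.1) = x.1
  rw [LinearMap.mem_ker.1 x.2, map_zero, sub_zero]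

/-- The part `Hom(E, Y) → Hom(ker p, Y) → Ext¹(X, Y) → Ext¹(E, Y)` of the long exact sequence. -/
theorem ExtOneVanishes.of_extend (h : ExtOneVanishes A E Y) (p : E →ₗ[A] X)
    (hp : Function.Surjective p)
    (hφ : ∀ φ : LinearMap.ker p →ₗ[A] Y, ∃ ψ : E →ₗ[A] Y, ∀ x, ψ x.1 = φ x) :
    ExtOneVanishes A X Y := by
  intro φ
  -- A free module mapping onto `E`, lifted to the free cover of `X` and back.
  obtain ⟨a, ha⟩ := Module.projective_lifting_property p (freeCover A X) hp
  have ha' : ∀ x, p (a x) = freeCover A X x := fun x => LinearMap.congr_fun ha x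
  obtain ⟨b, hb⟩ := Module.projective_lifting_property (freeCover A X) (p ∘ₗ freeCover A E)
    (freeCover_surjective A X)
  have hb' : ∀ x, freeCover A X (b x) = p (freeCover A E x) := fun x => LinearMap.congr_fun hb x
  let r : LinearMap.ker (freeCover A E) →ₗ[A] LinearMap.ker (freeCover A X) :=
    b.restrict (fun x hx => by
      rw [LinearMap.mem_ker, hb', LinearMap.mem_ker.1 hx, map_zero])
  obtain ⟨ψ, hψ⟩ := h (φ ∘ₗ r)
  -- `φ ∘ b - ψ` on the preimage of `ker p` descends to `ker p`.
  let F : Submodule A (E →₀ A) := LinearMap.ker (p ∘ₗ freeCover A E)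
  let rb : F →ₗ[A] LinearMap.ker (freeCover A X) :=
    b.restrict (fun x hx => by rw [LinearMap.mem_ker, hb']; exact hx)
  let c : F →ₗ[A] LinearMap.ker p := (freeCover A E).restrict (fun x hx => hx)
  have hc : Function.Surjective c := fun y => by
    obtain ⟨x, hx⟩ := freeCover_surjective A E y.1
    exact ⟨⟨x, by change p (freeCover A E x) = 0; rw [hx]; exact y.2⟩, Subtype.ext hx⟩
  obtain ⟨g, hg⟩ := LinearMap.exists_comp_eq_of_ker_le (X := F) c hc (φ ∘ₗ rb - ψ ∘ₗ F.subtype) (by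
    intro x hx
    have hx' : freeCover A E x.1 = 0 := congrArg Subtype.val hx
    have := hψ ⟨x.1, hx'⟩
    rw [LinearMap.sub_apply, sub_eq_zero]
    exact this.symm)
  obtain ⟨G, hG⟩ := hφ g
  obtain ⟨s, hs⟩ := Module.projective_lifting_property (freeCover A E) a (freeCover_surjective A E)
  have hs' : ∀ x, freeCover A E (s x) = a x := fun x => LinearMap.congr_fun hs x
  let d : (X →₀ A) →ₗ[A] LinearMap.ker (freeCover A X) :=
    (LinearMap.id - b ∘ₗ s).codRestrict _ (fun x => by
      rw [LinearMap.mem_ker, LinearMap.sub_apply, map_sub, LinearMap.comp_apply, hb', hs', ha']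
      exact sub_self _)
  refine ⟨φ ∘ₗ d + G ∘ₗ a + ψ ∘ₗ s, fun x => ?_⟩
  have hsx : s x.1 ∈ F := by
    change p (freeCover A E (s x.1)) = 0
    rw [hs', ha']; exact x.2
  have h1 := hg ⟨s x.1, hsx⟩
  have h2 : G (a x.1) = g (c ⟨s x.1, hsx⟩) := by
    rw [← hG]; congr 1; exact (hs' x.1).symm
  have h3 : x = d x.1 + rb ⟨s x.1, hsx⟩ := Subtype.ext (by
    change x.1 = (x.1 - b (s x.1)) + b (s x.1)
    abel)
  simp only [LinearMap.add_apply, LinearMap.comp_apply]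
  rw [h2, h1]
  conv_rhs => rw [h3, map_add]
  simp only [LinearMap.sub_apply, LinearMap.comp_apply, Submodule.subtype_apply]
  abel

/-- The part `Hom(X, E) → Hom(X, Z) → Ext¹(X, ker q) → Ext¹(X, E)` of the long exact sequence,
for an injection `j` with image `ker q`. -/
theorem ExtOneVanishes.of_lift (h : ExtOneVanishes A X E) (j : Y →ₗ[A] E)
    (hj : Function.Injective j) (q : E →ₗ[A] Z) (hjq : ∀ e, q e = 0 ↔ e ∈ LinearMap.range j)
    (hφ : ∀ φ : X →ₗ[A] Z, ∃ ψ : X →ₗ[A] E, ∀ x, q (ψ x) = φ x) : ExtOneVanishes A X Y := by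
  intro φ
  obtain ⟨ψ, hψ⟩ := h (j ∘ₗ φ)
  obtain ⟨g, hg⟩ := LinearMap.exists_comp_eq_of_ker_le (freeCover A X) (freeCover_surjective A X)
    (q ∘ₗ ψ) (fun x hx => by
      rw [LinearMap.comp_apply, hψ ⟨x, hx⟩, hjq]
      exact ⟨_, rfl⟩)
  obtain ⟨t, ht⟩ := hφ g
  let e := LinearEquiv.ofInjective j hj
  let d : (X →₀ A) →ₗ[A] LinearMap.range j := (ψ - t ∘ₗ freeCover A X).codRestrict _ (fun x => by
    rw [← hjq, LinearMap.sub_apply, map_sub, LinearMap.comp_apply, ht, hg, LinearMap.comp_apply,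
      sub_self])
  refine ⟨e.symm.toLinearMap ∘ₗ d, fun x => ?_⟩
  rw [LinearMap.comp_apply, LinearEquiv.coe_coe, LinearEquiv.symm_apply_eq]
  refine Subtype.ext ?_
  change ψ x.1 - t (freeCover A X x.1) = j (φ x)
  rw [hψ, LinearMap.mem_ker.1 x.2, map_zero, sub_zero, LinearMap.comp_apply]

theorem ExtOneVanishes.of_equiv_right (h : ExtOneVanishes A X Y) (e : Y ≃ₗ[A] Z) :
    ExtOneVanishes A X Z := by
  intro φ
  obtain ⟨ψ, hψ⟩ := h (e.symm.toLinearMap ∘ₗ φ)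
  exact ⟨e.toLinearMap ∘ₗ ψ, fun x => by simp [hψ]⟩

theorem ExtOneVanishes.of_equiv_left (h : ExtOneVanishes A X Y) (e : X ≃ₗ[A] Z) :
    ExtOneVanishes A Z Y :=
  h.of_extend e.toLinearMap e.surjective (fun φ => ⟨0, fun x => by
    have : x = 0 := Subtype.ext (e.map_eq_zero_iff.1 x.2)
    simp [this]⟩)

theorem ExtOneVanishes.of_subsingleton_right [Subsingleton Y] : ExtOneVanishes A X Y :=
  fun _ => ⟨0, fun _ => Subsingleton.elim _ _⟩

theorem ExtOneVanishes.of_subsingleton_left [Subsingleton X] : ExtOneVanishes A X Y :=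
  ExtOneVanishes.of_projective

/-- `Ext¹(X, -)` vanishes on extensions. -/
theorem ExtOneVanishes.of_exact_right (q : Y →ₗ[A] Z) (hq : Function.Surjective q)
    (h₁ : ExtOneVanishes A X (LinearMap.ker q)) (h₂ : ExtOneVanishes A X Z) :
    ExtOneVanishes A X Y := by
  intro φ
  obtain ⟨g, hg⟩ := h₂ (q ∘ₗ φ)
  obtain ⟨t, ht⟩ := Module.projective_lifting_property q g hq
  have ht' : ∀ x, q (t x) = g x := fun x => LinearMap.congr_fun ht x
  obtain ⟨s, hs⟩ := h₁ ((φ - t ∘ₗ Submodule.subtype _).codRestrict _ (fun x => by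
    rw [LinearMap.mem_ker, LinearMap.sub_apply, map_sub, LinearMap.comp_apply, ht']
    exact sub_eq_zero.2 (hg x).symm))
  refine ⟨t + (LinearMap.ker q).subtype ∘ₗ s, fun x => ?_⟩
  rw [LinearMap.add_apply, LinearMap.comp_apply, hs]
  change t x.1 + (φ x - t x.1) = φ x
  abel

/-- `Ext¹(-, Y)` vanishes on extensions. -/
theorem ExtOneVanishes.of_exact_left (q : X →ₗ[A] Z) (hq : Function.Surjective q)
    (h₁ : ExtOneVanishes A (LinearMap.ker q) Y) (h₂ : ExtOneVanishes A Z Y) :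
    ExtOneVanishes A X Y := by
  intro φ
  let F : Submodule A (X →₀ A) := LinearMap.ker (q ∘ₗ freeCover A X)
  obtain ⟨c, hcx⟩ : ∃ c : F →ₗ[A] LinearMap.ker q, ∀ x, (c x).1 = freeCover A X x.1 :=
    ⟨(freeCover A X).restrict (fun x hx => hx), fun _ => rfl⟩
  have hc : Function.Surjective c := fun y => by
    obtain ⟨x, hx⟩ := freeCover_surjective A X y.1
    exact ⟨⟨x, by change q (freeCover A X x) = 0; rw [hx]; exact y.2⟩,
      Subtype.ext ((hcx _).trans hx)⟩
  let i : LinearMap.ker c →ₗ[A] LinearMap.ker (freeCover A X) :=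
    (F.subtype ∘ₗ Submodule.subtype _).codRestrict _ (fun x => by
      rw [LinearMap.mem_ker, LinearMap.comp_apply, Submodule.subtype_apply, Submodule.subtype_apply,
        ← hcx, LinearMap.mem_ker.1 x.2, ZeroMemClass.coe_zero])
  obtain ⟨ψ, hψ⟩ := h₁.extend (E := F) c hc (φ ∘ₗ i)
  obtain ⟨g, hg⟩ := h₂.extend (q ∘ₗ freeCover A X) (hq.comp (freeCover_surjective A X)) ψ
  refine ⟨g, fun x => ?_⟩
  have hx : x.1 ∈ F := by
    change q (freeCover A X x.1) = 0
    rw [LinearMap.mem_ker.1 x.2, map_zero]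
  rw [hg ⟨x.1, hx⟩]
  have hcx0 : (⟨x.1, hx⟩ : F) ∈ LinearMap.ker c := Subtype.ext ((hcx _).trans x.2)
  exact hψ ⟨_, hcx0⟩

theorem ExtOneVanishes.pi_right {ι : Type*} (h : ExtOneVanishes A X Y) :
    ExtOneVanishes A X (ι → Y) := by
  intro φ
  choose ψ hψ using fun i => h (LinearMap.proj i ∘ₗ φ)
  exact ⟨LinearMap.pi ψ, fun x => funext fun i => hψ i x⟩

theorem ExtOneVanishes.pi_left {ι : Type*} [Finite ι] (h : ExtOneVanishes A X Y) :
    ExtOneVanishes A (ι → X) Y := by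
  classical
  have := Fintype.ofFinite ι
  let p : (ι → (X →₀ A)) →ₗ[A] (ι → X) := LinearMap.pi fun i => freeCover A X ∘ₗ LinearMap.proj i
  have hp : Function.Surjective p := fun x =>
    ⟨fun i => (freeCover_surjective A X (x i)).choose,
      funext fun i => (freeCover_surjective A X (x i)).choose_spec⟩
  refine ExtOneVanishes.of_extend ExtOneVanishes.of_projective p hp fun φ => ?_
  let s : ∀ i, LinearMap.ker (freeCover A X) →ₗ[A] LinearMap.ker p := fun i =>
    (LinearMap.single A (fun _ : ι => X →₀ A) i).restrict (fun x hx => by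
      refine funext fun j => ?_
      change freeCover A X (Pi.single (M := fun _ : ι => X →₀ A) i x j) = 0
      rcases eq_or_ne j i with rfl | hj
      · simpa using hx
      · simp [Pi.single_eq_of_ne hj])
  choose ψ hψ using fun i => h (φ ∘ₗ s i)
  refine ⟨∑ i, ψ i ∘ₗ LinearMap.proj i, fun x => ?_⟩
  have hx : ∀ i, freeCover A X (x.1 i) = 0 := fun i => congrFun x.2 i
  have : x = ∑ i, s i ⟨x.1 i, hx i⟩ := by
    refine Subtype.ext ?_
    rw [AddSubmonoidClass.coe_finsetSum]
    exact (Finset.univ_sum_single x.1).symm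
  conv_rhs => rw [this, map_sum]
  simp only [LinearMap.coe_sum, Finset.sum_apply, LinearMap.comp_apply, LinearMap.proj_apply]
  exact Finset.sum_congr rfl fun i _ => hψ i ⟨x.1 i, hx i⟩

end ExtOneVanishes

/-! ### Filtrations -/

section Filtrations

variable {A : Type*} [Ring A] {X Z : Type*} [AddCommGroup X] [Module A X] [AddCommGroup Z]
  [Module A Z]

theorem mem_submoduleOf {N K : Submodule A X} {x : K} : x ∈ N.submoduleOf K ↔ x.1 ∈ N :=
  Iff.rfl

/-- Induction along a filtration `0 = F 0 ≤ ⋯ ≤ F n = X`. -/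
theorem HasFiltration.induction {Q : Submodule A X → Submodule A X → Prop}
    (h : HasFiltration A Q) (R : Submodule A X → Prop) (h0 : R ⊥)
    (hs : ∀ N N', N ≤ N' → Q N N' → R N → R N') : R ⊤ := by
  obtain ⟨n, F, hF, h0', hn, hQ⟩ := h
  rw [← hn]
  have : ∀ i ≤ n, R (F i) := by
    intro i
    induction i with
    | zero => intro _; rwa [h0']
    | succ i ih => exact fun hi => hs _ _ (hF (Nat.le_succ i)) (hQ i hi) (ih (Nat.le_of_succ_le hi))
  exact this n le_rfl

/-- Filtrations of the kernel and of the target of a surjection combine. -/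
theorem HasFiltration.of_exact {Q : Submodule A X → Submodule A X → Prop} (q : X →ₗ[A] Z)
    (h₁ : HasFiltration A fun N N' : Submodule A (LinearMap.ker q) =>
      Q (N.map (LinearMap.ker q).subtype) (N'.map (LinearMap.ker q).subtype))
    (h₂ : HasFiltration A fun N N' : Submodule A Z => Q (N.comap q) (N'.comap q)) :
    HasFiltration A Q := by
  obtain ⟨n, F, hF, hF0, hFn, hFQ⟩ := h₁
  obtain ⟨m, G, hG, hG0, hGm, hGQ⟩ := h₂
  have e0 : (G 0).comap q = LinearMap.ker q := by rw [hG0]; rfl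
  have en : (F n).map (LinearMap.ker q).subtype = LinearMap.ker q := by
    rw [hFn, Submodule.map_top, Submodule.range_subtype]
  let H : ℕ → Submodule A X := fun i =>
    if i ≤ n then (F i).map (LinearMap.ker q).subtype else (G (i - n)).comap q
  have Hle : ∀ i, i ≤ n → H i = (F i).map (LinearMap.ker q).subtype := fun i hi => if_pos hi
  have Hge : ∀ i, H (n + i) = (G i).comap q := by
    intro i
    rcases Nat.eq_zero_or_pos i with rfl | hi
    · rw [Nat.add_zero, Hle n le_rfl, en, e0]
    · have : ¬ n + i ≤ n := by omega
      simp only [H, if_neg this, Nat.add_sub_cancel_left]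
  refine ⟨n + m, H, monotone_nat_of_le_succ fun i => ?_, ?_, ?_, fun i hi => ?_⟩
  · rcases lt_or_ge i n with hi | hi
    · rw [Hle i hi.le, Hle (i + 1) hi]
      exact Submodule.map_mono (hF (Nat.le_succ i))
    · obtain ⟨j, rfl⟩ := Nat.exists_eq_add_of_le hi
      rw [Nat.add_assoc, Hge, Hge]
      exact Submodule.comap_mono (hG (Nat.le_succ j))
  · rw [Hle 0 (Nat.zero_le n), hF0, Submodule.map_bot]
  · rw [Hge, hGm, Submodule.comap_top]
  · rcases lt_or_ge i n with hi' | hi'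
    · rw [Hle i hi'.le, Hle (i + 1) hi']
      exact hFQ i hi'
    · obtain ⟨j, rfl⟩ := Nat.exists_eq_add_of_le hi'
      rw [Nat.add_assoc, Hge, Hge]
      exact hGQ j (by omega)

/-- The sections of the image of a filtration under an injection are the original ones. -/
theorem nonempty_section_map_equiv (j : Z →ₗ[A] X) (hj : Function.Injective j)
    (N N' : Submodule A Z) :
    Nonempty ((↥N' ⧸ N.submoduleOf N') ≃ₗ[A] (↥(N'.map j) ⧸ (N.map j).submoduleOf (N'.map j))) := by
  let e := Submodule.equivMapOfInjective j hj N'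
  refine ⟨Submodule.Quotient.equiv _ _ e ?_⟩
  ext ⟨x, y, hy, rfl⟩
  simp only [Submodule.mem_map, mem_submoduleOf]
  constructor
  · rintro ⟨z, hz, hze⟩
    exact ⟨z, hz, congrArg Subtype.val hze⟩
  · rintro ⟨z, hz, hze⟩
    exact ⟨⟨y, hy⟩, by have := hj hze; subst this; exact hz, Subtype.ext rfl⟩

/-- The sections of the preimage of a filtration under a surjection are the original ones. -/
theorem nonempty_section_comap_equiv (q : X →ₗ[A] Z) (hq : Function.Surjective q)
    (N N' : Submodule A Z) :
    Nonempty ((↥N' ⧸ N.submoduleOf N') ≃ₗ[A]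
      (↥(N'.comap q) ⧸ (N.comap q).submoduleOf (N'.comap q))) := by
  let r : N'.comap q →ₗ[A] N' := q.restrict (fun x hx => hx)
  have hr : Function.Surjective r := fun y => by
    obtain ⟨x, hx⟩ := hq y.1
    exact ⟨⟨x, by rw [Submodule.mem_comap, hx]; exact y.2⟩, Subtype.ext hx⟩
  let f := (N.submoduleOf N').mkQ ∘ₗ r
  have hf : Function.Surjective f := (Submodule.mkQ_surjective _).comp hr
  have hk : LinearMap.ker f = (N.comap q).submoduleOf (N'.comap q) := by
    ext x
    change (N.submoduleOf N').mkQ (r x) = 0 ↔ _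
    rw [Submodule.mkQ_apply, Submodule.Quotient.mk_eq_zero]
    rfl
  exact ⟨((Submodule.quotEquivOfEq _ _ hk.symm).trans (f.quotKerEquivOfSurjective hf)).symm⟩

end Filtrations

section StandardFiltrations

variable {A : Type u} [Ring A] {Λ : Type*} [PartialOrder Λ] {L : Λ → Type*}
  [∀ i, AddCommGroup (L i)] [∀ i, Module A (L i)] {X Z : Type*} [AddCommGroup X] [Module A X]
  [AddCommGroup Z] [Module A Z]

theorem IsStandard.of_equiv {i : Λ} (h : IsStandard A L i X) (e : X ≃ₗ[A] Z) :
    IsStandard A L i Z := by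
  obtain ⟨P, _, _, f, g, hf, hg, hK⟩ := h
  refine ⟨P, _, _, f, e.toLinearMap ∘ₗ g, hf, e.surjective.comp hg, ?_⟩
  rwa [LinearEquiv.ker_comp]

/-- A module with a surjection onto a standard-filtered module, whose kernel is
standard-filtered, is standard-filtered. -/
theorem HasStandardFiltration.of_exact (q : X →ₗ[A] Z) (hq : Function.Surjective q)
    (h₁ : HasStandardFiltration A L (LinearMap.ker q)) (h₂ : HasStandardFiltration A L Z) :
    HasStandardFiltration A L X := by
  refine HasFiltration.of_exact q ?_ ?_
  · obtain ⟨n, F, hF, h0, hn, h⟩ := h₁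
    refine ⟨n, F, hF, h0, hn, fun i hi => ?_⟩
    obtain ⟨e⟩ := nonempty_section_map_equiv (LinearMap.ker q).subtype
      (Submodule.subtype_injective _) (F i) (F (i + 1))
    exact (h i hi).imp (fun hs => @Equiv.subsingleton _ _ e.symm.toEquiv hs)
      (fun ⟨j, hj⟩ => ⟨j, hj.of_equiv e⟩)
  · obtain ⟨n, F, hF, h0, hn, h⟩ := h₂
    refine ⟨n, F, hF, h0, hn, fun i hi => ?_⟩
    obtain ⟨e⟩ := nonempty_section_comap_equiv q hq (F i) (F (i + 1))
    exact (h i hi).imp (fun hs => @Equiv.subsingleton _ _ e.symm.toEquiv hs)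
      (fun ⟨j, hj⟩ => ⟨j, hj.of_equiv e⟩)

theorem HasStandardFiltration.of_subsingleton [Subsingleton X] : HasStandardFiltration A L X :=
  ⟨0, fun _ => ⊥, monotone_const, rfl, Subsingleton.elim _ _, fun _ hi => absurd hi (by omega)⟩

theorem IsStandard.hasStandardFiltration {i : Λ} (h : IsStandard A L i X) :
    HasStandardFiltration A L X := by
  refine ⟨1, fun n => if n = 0 then ⊥ else ⊤, monotone_nat_of_le_succ fun n => ?_, by simp,
    by simp, fun n hn => Or.inr ⟨i, ?_⟩⟩
  · simp
  · obtain rfl : n = 0 := by omega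
    change IsStandard A L i (↥(⊤ : Submodule A X) ⧸ (⊥ : Submodule A X).submoduleOf ⊤)
    refine h.of_equiv ?_
    have : (⊥ : Submodule A X).submoduleOf ⊤ = ⊥ := by
      ext x; simp [mem_submoduleOf]
    exact (Submodule.topEquiv.symm).trans (Submodule.quotEquivOfEqBot _ this).symm

theorem HasStandardFiltration.of_equiv (h : HasStandardFiltration A L X) (e : X ≃ₗ[A] Z) :
    HasStandardFiltration A L Z := by
  have : Subsingleton (LinearMap.ker e.symm.toLinearMap) :=
    Submodule.subsingleton_iff_eq_bot.2 (LinearEquiv.ker _)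
  exact .of_exact e.symm.toLinearMap e.symm.surjective .of_subsingleton h

end StandardFiltrations

/-! ### Standard and costandard modules -/

section StandardCostandard

variable {A : Type u} [Ring A] {Λ : Type*} [PartialOrder Λ] {L : Λ → Type*}
  [∀ i, AddCommGroup (L i)] [∀ i, Module A (L i)]

theorem IsInjectiveHull.exists_extend {X : Type*} {I : Type u} [AddCommGroup X] [Module A X]
    [AddCommGroup I] [Module A I] {ι : X →ₗ[A] I} (h : IsInjectiveHull ι)
    {Y Z : Type*} [AddCommGroup Y] [Module A Y] [AddCommGroup Z] [Module A Z] (j : Y →ₗ[A] Z)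
    (hj : Function.Injective j) (φ : Y →ₗ[A] I) : ∃ ψ : Z →ₗ[A] I, ∀ y, ψ (j y) = φ y := by
  obtain ⟨ψ, hψ⟩ := (Module.Baer.of_injective h.injective_module).extension_property j hj φ
  exact ⟨ψ, fun y => LinearMap.congr_fun hψ y⟩

theorem IsInjectiveHull.extOneVanishes {X : Type*} {I : Type u} [AddCommGroup X] [Module A X]
    [AddCommGroup I] [Module A I] {ι : X →ₗ[A] I} (h : IsInjectiveHull ι)
    {Y : Type*} [AddCommGroup Y] [Module A Y] : ExtOneVanishes A Y I :=
  fun φ => h.exists_extend (Submodule.subtype _) (Submodule.subtype_injective _) φ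

theorem IsInjectiveHull.range_le {X : Type*} {I : Type u} [AddCommGroup X] [Module A X]
    [IsSimpleModule A X] [AddCommGroup I] [Module A I] {ι : X →ₗ[A] I} (h : IsInjectiveHull ι)
    {N : Submodule A I} (hN : N ≠ ⊥) : LinearMap.range ι ≤ N := by
  rintro _ ⟨x, rfl⟩
  have h1 : N.comap ι ≠ ⊥ := fun h0 => hN (h.essential N (by
    rw [eq_bot_iff]
    rintro _ ⟨hx, y, rfl⟩
    have : y ∈ N.comap ι := hx
    rw [h0, Submodule.mem_bot] at this
    simp [this]))
  have : x ∈ N.comap ι := by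
    rw [(eq_bot_or_eq_top (N.comap ι)).resolve_left h1]; trivial
  exact this

theorem IsProjectiveCover.le_ker {X P : Type*} [AddCommGroup X] [Module A X]
    [IsSimpleModule A X] [AddCommGroup P] [Module A P] {f : P →ₗ[A] X} (h : IsProjectiveCover f)
    {N : Submodule A P} (hN : N ≠ ⊤) : N ≤ LinearMap.ker f := by
  by_contra hle
  have hc : IsCoatom (LinearMap.ker f) := by
    rw [← isSimpleModule_iff_isCoatom]
    exact IsSimpleModule.congr (f.quotKerEquivOfSurjective h.surjective)
  refine hN (h.superfluous N (hc.2 _ (lt_of_le_of_ne le_sup_right fun he => hle ?_)))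
  rw [he]; exact le_sup_left

/-- The projective cover of a simple module is cyclic. -/
theorem IsProjectiveCover.finite {X P : Type*} [AddCommGroup X] [Module A X]
    [IsSimpleModule A X] [AddCommGroup P] [Module A P] {f : P →ₗ[A] X}
    (h : IsProjectiveCover f) : Module.Finite A P := by
  have := IsSimpleModule.nontrivial A X
  obtain ⟨x, hx⟩ := exists_ne (0 : X)
  obtain ⟨p, rfl⟩ := h.surjective x
  have : Submodule.span A {p} = ⊤ := by
    by_contra hne
    exact hx (h.le_ker hne (Submodule.mem_span_singleton_self p))
  exact ⟨⟨{p}, by simpa using this⟩⟩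

/-- If `K` is the kernel of `P(i) → Δ(i)`, there are no nonzero maps from `K` to a module all of
whose composition factors are of the form `L j` with `j < i`. -/
theorem hom_eq_zero_of_isLeast (hL : ∀ i, IsSimpleModule A (L i)) {i : Λ} {P X : Type*}
    [AddCommGroup P] [Module A P] [AddCommGroup X] [Module A X] {f : P →ₗ[A] L i}
    {K : Submodule A P}
    (hK : IsLeast {K : Submodule A P | K ≤ LinearMap.ker f ∧
      BelongsTo A L (Set.Iio i) (↥(LinearMap.ker f) ⧸ K.submoduleOf (LinearMap.ker f))} K)
    (hX : BelongsTo A L (Set.Iio i) X) (φ : K →ₗ[A] X) : φ = 0 := by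
  let K' : Submodule A P := (LinearMap.ker φ).map K.subtype
  have hK'K : K' ≤ K := Submodule.map_subtype_le _ _
  have key : K ≤ K' := by
    refine hK.2 ⟨hK'K.trans hK.1.1, ?_⟩
    let q : (↥(LinearMap.ker f) ⧸ K'.submoduleOf (LinearMap.ker f)) →ₗ[A]
        (↥(LinearMap.ker f) ⧸ K.submoduleOf (LinearMap.ker f)) :=
      Submodule.factor (fun x hx => hK'K hx)
    refine BelongsTo.of_exact hL q ?_ hK.1.2
    -- The kernel of `q` is the quotient `K / K'`, which embeds in `X`.
    let r : K →ₗ[A] (↥(LinearMap.ker f) ⧸ K'.submoduleOf (LinearMap.ker f)) :=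
      (K'.submoduleOf (LinearMap.ker f)).mkQ ∘ₗ Submodule.inclusion hK.1.1
    have hqr : ∀ x, q (r x) = 0 := fun x => by
      change (K.submoduleOf (LinearMap.ker f)).mkQ (Submodule.inclusion hK.1.1 x) = 0
      rw [Submodule.mkQ_apply, Submodule.Quotient.mk_eq_zero]
      exact x.2
    have hr0 : ∀ x, r x = 0 ↔ φ x = 0 := fun x => by
      change (K'.submoduleOf (LinearMap.ker f)).mkQ (Submodule.inclusion hK.1.1 x) = 0 ↔ _
      rw [Submodule.mkQ_apply, Submodule.Quotient.mk_eq_zero]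
      change x.1 ∈ K' ↔ _
      constructor
      · rintro ⟨y, hy, hyx⟩
        obtain rfl : y = x := Subtype.ext hyx
        exact hy
      · exact fun hx => ⟨x, hx, rfl⟩
    let r' : K →ₗ[A] LinearMap.ker q := r.codRestrict _ hqr
    have hr' : Function.Surjective r' := by
      rintro ⟨y, hy⟩
      obtain ⟨x, rfl⟩ := Submodule.mkQ_surjective _ y
      have hx : x.1 ∈ K := by
        have h1 : (K.submoduleOf (LinearMap.ker f)).mkQ x = 0 := hy
        rw [Submodule.mkQ_apply, Submodule.Quotient.mk_eq_zero] at h1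
        exact h1
      exact ⟨⟨x.1, hx⟩, rfl⟩
    obtain ⟨g, hg⟩ := LinearMap.exists_comp_eq_of_ker_le r' hr' φ
      (fun x hx => (hr0 x).1 (congrArg (fun z => z.1) hx))
    refine hX.of_injective g ((injective_iff_map_eq_zero g).2 fun y hy => ?_)
    obtain ⟨x, rfl⟩ := hr' y
    rw [hg] at hy
    exact Subtype.ext ((hr0 x).2 hy)
  ext x
  obtain ⟨y, hy, hyx⟩ := key x.2
  obtain rfl : y = x := Subtype.ext hyx
  exact hy

/-- The simple head of a standard module: the kernel of `Δ(i) → L(i)` is superfluous and belongs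
to the weights below `i`. -/
theorem IsStandard.exists_head_aux (hL : ∀ i, IsSimpleModule A (L i)) {i : Λ} {P D : Type*}
    [AddCommGroup P] [Module A P] [AddCommGroup D] [Module A D] {f : P →ₗ[A] L i} {g : P →ₗ[A] D}
    (hf : IsProjectiveCover f) (hg : Function.Surjective g)
    (hle : LinearMap.ker g ≤ LinearMap.ker f) (hb : BelongsTo A L (Set.Iio i)
      (↥(LinearMap.ker f) ⧸ (LinearMap.ker g).submoduleOf (LinearMap.ker f))) :
    ∃ d : D →ₗ[A] L i, (∀ x, d (g x) = f x) ∧ Function.Surjective d ∧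
      BelongsTo A L (Set.Iio i) (LinearMap.ker d) ∧
      ∀ N : Submodule A D, N ≠ ⊤ → N ≤ LinearMap.ker d := by
  have := hL i
  obtain ⟨d, hd⟩ := LinearMap.exists_comp_eq_of_ker_le g hg f (fun x hx => hle hx)
  refine ⟨d, hd, fun y => ?_, ?_, fun N hN => ?_⟩
  · obtain ⟨x, rfl⟩ := hf.surjective y
    exact ⟨g x, hd x⟩
  · let r : LinearMap.ker f →ₗ[A] LinearMap.ker d :=
      g.restrict (fun x hx => by rw [LinearMap.mem_ker, hd]; exact hx)
    have hr : Function.Surjective r := by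
      rintro ⟨y, hy⟩
      obtain ⟨x, rfl⟩ := hg y
      exact ⟨⟨x, by rw [LinearMap.mem_ker, ← hd]; exact hy⟩, rfl⟩
    obtain ⟨t, ht⟩ := LinearMap.exists_comp_eq_of_ker_le
      ((LinearMap.ker g).submoduleOf (LinearMap.ker f)).mkQ (Submodule.mkQ_surjective _) r
      (fun x hx => by
        rw [Submodule.mkQ_apply, Submodule.Quotient.mk_eq_zero] at hx
        exact Subtype.ext hx)
    refine hb.of_surjective t fun y => ?_
    obtain ⟨x, rfl⟩ := hr y
    exact ⟨_, ht x⟩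
  · intro y hy
    obtain ⟨x, rfl⟩ := hg y
    have hc : N.comap g ≠ ⊤ := fun h => hN (by
      rw [eq_top_iff]
      rintro z -
      obtain ⟨w, rfl⟩ := hg z
      have : w ∈ N.comap g := by rw [h]; trivial
      exact this)
    rw [LinearMap.mem_ker, hd]
    exact hf.le_ker hc hy

theorem IsStandard.exists_head (hL : ∀ i, IsSimpleModule A (L i)) {i : Λ} {D : Type*}
    [AddCommGroup D] [Module A D] (h : IsStandard A L i D) :
    ∃ d : D →ₗ[A] L i, Function.Surjective d ∧ BelongsTo A L (Set.Iio i) (LinearMap.ker d) ∧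
      ∀ N : Submodule A D, N ≠ ⊤ → N ≤ LinearMap.ker d := by
  obtain ⟨P, _, _, f, g, hf, hg, hK⟩ := h
  obtain ⟨d, -, hd⟩ := IsStandard.exists_head_aux hL hf hg hK.1.1 hK.1.2
  exact ⟨d, hd⟩

/-- The simple socle of a costandard module: the image of `L(i) → ∇(i)` is essential, and the
quotient by it belongs to the weights below `i`. -/
theorem IsCostandard.exists_socle_aux (hL : ∀ i, IsSimpleModule A (L i)) {i : Λ} {D : Type*}
    {I : Type u} [AddCommGroup I] [Module A I] [AddCommGroup D] [Module A D] {f : L i →ₗ[A] I}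
    {g : D →ₗ[A] I} (hf : IsInjectiveHull f) (hg : Function.Injective g)
    (hC : IsCostandardSubmodule A L i f (LinearMap.range g)) :
    ∃ s : L i →ₗ[A] D, (∀ x, g (s x) = f x) ∧ Function.Injective s ∧
      BelongsTo A L (Set.Iio i) (D ⧸ LinearMap.range s) ∧
      ∀ N : Submodule A D, N ≠ ⊥ → LinearMap.range s ≤ N := by
  have := hL i
  let e := LinearEquiv.ofInjective g hg
  let s : L i →ₗ[A] D := e.symm.toLinearMap ∘ₗ f.codRestrict (LinearMap.range g)
    (fun x => hC.1.1 ⟨x, rfl⟩)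
  have hs : ∀ x, g (s x) = f x := fun x =>
    congrArg Subtype.val (e.apply_symm_apply (f.codRestrict (LinearMap.range g)
      (fun x => hC.1.1 ⟨x, rfl⟩) x))
  refine ⟨s, hs, fun x y hxy => hf.injective (by rw [← hs, ← hs, hxy]), ?_, fun N hN => ?_⟩
  · obtain ⟨t, ht⟩ := LinearMap.exists_comp_eq_of_ker_le
      ((LinearMap.range f).submoduleOf (LinearMap.range g)).mkQ (Submodule.mkQ_surjective _)
      ((LinearMap.range s).mkQ ∘ₗ e.symm.toLinearMap) (fun x hx => by
        rw [Submodule.mkQ_apply, Submodule.Quotient.mk_eq_zero] at hx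
        obtain ⟨y, hy⟩ := hx
        rw [LinearMap.comp_apply, Submodule.mkQ_apply, Submodule.Quotient.mk_eq_zero]
        refine ⟨y, hg ?_⟩
        rw [hs, hy]
        exact (congrArg Subtype.val (e.apply_symm_apply x)).symm)
    refine hC.1.2.of_surjective t fun y => ?_
    obtain ⟨x, rfl⟩ := Submodule.mkQ_surjective _ y
    refine ⟨Submodule.mkQ _ (e x), ?_⟩
    rw [ht]
    simp
  · rintro _ ⟨x, rfl⟩
    have hm : N.map g ≠ ⊥ := fun h => hN (Submodule.map_injective_of_injective hg (h.trans (Submodule.map_bot g).symm))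
    obtain ⟨y, hy, hyx⟩ := hf.range_le hm ⟨x, rfl⟩
    rw [← hs] at hyx
    rw [← hg hyx]
    exact hy

theorem IsCostandard.exists_socle (hL : ∀ i, IsSimpleModule A (L i)) {i : Λ} {D : Type*}
    [AddCommGroup D] [Module A D] (h : IsCostandard A L i D) :
    ∃ s : L i →ₗ[A] D, Function.Injective s ∧ BelongsTo A L (Set.Iio i) (D ⧸ LinearMap.range s) ∧
      ∀ N : Submodule A D, N ≠ ⊥ → LinearMap.range s ≤ N := by
  obtain ⟨I, _, _, f, g, hf, hg, hC⟩ := h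
  obtain ⟨s, -, hs⟩ := IsCostandard.exists_socle_aux hL hf hg hC
  exact ⟨s, hs⟩

/-- The weights of a standard module are at most its label. -/
theorem IsStandard.belongsTo (hL : ∀ i, IsSimpleModule A (L i))
    (hne : ∀ i j, Nonempty (L i ≃ₗ[A] L j) → i = j) {i : Λ} {D : Type*}
    [AddCommGroup D] [Module A D] (h : IsStandard A L i D) : BelongsTo A L (Set.Iic i) D := by
  obtain ⟨d, -, hb, -⟩ := h.exists_head hL
  refine .of_exact hL d (hb.mono fun j hj => le_of_lt hj)
    ((belongsTo_simple hL hne i).mono fun j hj => le_of_eq hj)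

/-- The weights of a costandard module are at most its label. -/
theorem IsCostandard.belongsTo (hL : ∀ i, IsSimpleModule A (L i))
    (hne : ∀ i j, Nonempty (L i ≃ₗ[A] L j) → i = j) {i : Λ} {D : Type*}
    [AddCommGroup D] [Module A D] (h : IsCostandard A L i D) : BelongsTo A L (Set.Iic i) D := by
  obtain ⟨s, hs, hb, -⟩ := h.exists_socle hL
  refine .of_exact hL (LinearMap.range s).mkQ ?_ (hb.mono fun j hj => le_of_lt hj)
  rw [Submodule.ker_mkQ]
  exact ((belongsTo_simple hL hne i).mono fun j hj => le_of_eq hj).of_injective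
    (LinearEquiv.ofInjective s hs).symm.toLinearMap (LinearEquiv.injective _)

theorem IsStandard.isCompositionFactor (hL : ∀ i, IsSimpleModule A (L i)) {i : Λ} {D : Type*}
    [AddCommGroup D] [Module A D] (h : IsStandard A L i D) : IsCompositionFactor A (L i) D := by
  obtain ⟨d, hd, -, -⟩ := h.exists_head hL
  exact .of_surjective d hd

theorem IsCostandard.isCompositionFactor (hL : ∀ i, IsSimpleModule A (L i)) {i : Λ} {D : Type*}
    [AddCommGroup D] [Module A D] (h : IsCostandard A L i D) : IsCompositionFactor A (L i) D := by
  obtain ⟨s, hs, -, -⟩ := h.exists_socle hL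
  exact .of_injective s hs

/-- A composition factor of a filtered module is a composition factor of a section. -/
theorem IsCompositionFactor.exists_section {Y X : Type*} [AddCommGroup Y] [Module A Y]
    [IsSimpleModule A Y] [AddCommGroup X] [Module A X] {Q : Submodule A X → Submodule A X → Prop}
    (hX : HasFiltration A Q) (h : IsCompositionFactor A Y X) :
    ∃ N N' : Submodule A X, N ≤ N' ∧ Q N N' ∧
      IsCompositionFactor A Y (↥N' ⧸ N.submoduleOf N') := by
  have := hX.induction (fun F => IsCompositionFactor A Y F → ∃ N N' : Submodule A X, N ≤ N' ∧
    Q N N' ∧ IsCompositionFactor A Y (↥N' ⧸ N.submoduleOf N')) ?_ ?_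
  · exact this (h.of_surjective_right (Submodule.topEquiv (R := A) (M := X)).toLinearMap
      (LinearEquiv.surjective _))
  · intro h0
    obtain ⟨N, φ, hφ⟩ := isCompositionFactor_iff.1 h0
    have := IsSimpleModule.nontrivial A Y
    exact absurd hφ.subsingleton (not_subsingleton Y)
  · intro N N' hN hQ ih hN'
    rcases hN'.or_of_exact (N.submoduleOf N').mkQ with h1 | h1
    · rw [Submodule.ker_mkQ] at h1
      exact ih (h1.of_injective_right (Submodule.submoduleOfEquivOfLe hN).toLinearMap
        (LinearEquiv.injective _))
    · exact ⟨N, N', hN, hQ, h1⟩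

/-- A standard-filtered module with highest weight `i` has a section `Δ(i)`; in particular
`Δ(i)` exists. -/
theorem exists_isStandard {T : Type*} [AddCommGroup T] [Module A T]
    (hL : ∀ i, IsSimpleModule A (L i)) (hne : ∀ i j, Nonempty (L i ≃ₗ[A] L j) → i = j) {i : Λ}
    (hT : HasStandardFiltration A L T) (hi : IsCompositionFactor A (L i) T)
    (hb : BelongsTo A L (Set.Iic i) T) :
    ∃ N N' : Submodule A T, IsStandard A L i (↥N' ⧸ N.submoduleOf N') := by
  have := hL i
  obtain ⟨N, N', hN, hQ | ⟨j, hj⟩, hc⟩ := hi.exists_section hT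
  · obtain ⟨N₀, φ, hφ⟩ := isCompositionFactor_iff.1 hc
    have := IsSimpleModule.nontrivial A (L i)
    exact absurd hφ.subsingleton (not_subsingleton (L i))
  · have hij : i ≤ j := hj.belongsTo hL hne i hc
    have hji : j ≤ i := hb j (((hj.isCompositionFactor hL).of_surjective_right _
      (Submodule.mkQ_surjective _)).of_injective_right N'.subtype N'.subtype_injective)
    obtain rfl := le_antisymm hij hji
    exact ⟨N, N', hj⟩

theorem ExtOneVanishes.of_section_right {X Y : Type*} [AddCommGroup X] [Module A X]
    [AddCommGroup Y] [Module A Y] {N N' : Submodule A Y} (hN : N ≤ N') (h : ExtOneVanishes A X N)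
    (hs : ExtOneVanishes A X (↥N' ⧸ N.submoduleOf N')) : ExtOneVanishes A X N' := by
  refine .of_exact_right (N.submoduleOf N').mkQ (Submodule.mkQ_surjective _) ?_ hs
  rw [Submodule.ker_mkQ]
  exact h.of_equiv_right (Submodule.submoduleOfEquivOfLe hN).symm

theorem ExtOneVanishes.of_filtration_right {X Y : Type*} [AddCommGroup X] [Module A X]
    [AddCommGroup Y] [Module A Y] {Q : Submodule A Y → Submodule A Y → Prop}
    (h : HasFiltration A Q) (hQ : ∀ N N', Q N N' → ExtOneVanishes A X (↥N' ⧸ N.submoduleOf N')) :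
    ExtOneVanishes A X Y := by
  have := h.induction (fun F => ExtOneVanishes A X F) .of_subsingleton_right
    (fun N N' hN hq ih => .of_section_right hN ih (hQ N N' hq))
  exact this.of_equiv_right Submodule.topEquiv

theorem ExtOneVanishes.of_filtration_left {X Y : Type*} [AddCommGroup X] [Module A X]
    [AddCommGroup Y] [Module A Y] {Q : Submodule A X → Submodule A X → Prop}
    (h : HasFiltration A Q) (hQ : ∀ N N', Q N N' → ExtOneVanishes A (↥N' ⧸ N.submoduleOf N') Y) :
    ExtOneVanishes A X Y := by
  have := h.induction (fun F => ExtOneVanishes A F Y) .of_subsingleton_left (by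
    intro N N' hN hq ih
    refine .of_exact_left (N.submoduleOf N').mkQ (Submodule.mkQ_surjective _) ?_ (hQ N N' hq)
    rw [Submodule.ker_mkQ]
    exact ih.of_equiv_left (Submodule.submoduleOfEquivOfLe hN).symm)
  exact this.of_equiv_left Submodule.topEquiv

end StandardCostandard

/-! ### Quasi-hereditary algebras with chosen standard and costandard modules -/

section System

variable {A : Type u} [Ring A] {Λ : Type*} [PartialOrder Λ] {L : Λ → Type*} {P I : Λ → Type u}
  [∀ i, AddCommGroup (L i)] [∀ i, Module A (L i)] [∀ i, AddCommGroup (P i)]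
  [∀ i, Module A (P i)] [∀ i, AddCommGroup (I i)] [∀ i, Module A (I i)]

/-- A quasi-hereditary ring `A` with chosen projective covers `f i : P i → L i` and injective
hulls `ι i : L i → I i` of its simple modules. The standard modules are `Δ(i) = P i ⧸ K i`, the
costandard modules are the submodules `∇(i) = C i` of `I i`. -/
structure HighestWeightSystem (f : ∀ i, P i →ₗ[A] L i) (ι : ∀ i, L i →ₗ[A] I i)
    (K : ∀ i, Submodule A (P i)) (C : ∀ i, Submodule A (I i)) : Prop where
  simple : ∀ i, IsSimpleModule A (L i)
  non_isomorphic : ∀ i j, Nonempty (L i ≃ₗ[A] L j) → i = j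
  complete : ∀ (X : Type u) [AddCommGroup X] [Module A X], IsSimpleModule A X →
    ∃ i, Nonempty (X ≃ₗ[A] L i)
  finite : ∀ i, Module.Finite A (I i)
  cover : ∀ i, IsProjectiveCover (f i)
  least : ∀ i, IsLeast {K : Submodule A (P i) | K ≤ LinearMap.ker (f i) ∧
    BelongsTo A L (Set.Iio i) (↥(LinearMap.ker (f i)) ⧸ K.submoduleOf (LinearMap.ker (f i)))} (K i)
  hull : ∀ i, IsInjectiveHull (ι i)
  greatest : ∀ i, IsCostandardSubmodule A L i (ι i) (C i)
  highest_weight : ∀ i, HasFiltration A fun N N' : Submodule A (I i ⧸ C i) =>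
    Subsingleton (↥N' ⧸ N.submoduleOf N') ∨ ∃ j, i < j ∧ IsCostandard A L j (↥N' ⧸ N.submoduleOf N')

end System

/-- Of two costandard modules with the same label, each embeds in the other one. -/
theorem IsCostandardSubmodule.exists_injective {A : Type u} [Ring A] {Λ : Type*} [PartialOrder Λ]
    {L : Λ → Type*} [∀ i, AddCommGroup (L i)] [∀ i, Module A (L i)]
    (hL : ∀ i, IsSimpleModule A (L i)) {i : Λ} {D D' : Type*} {J J' : Type u} [AddCommGroup D]
    [Module A D] [AddCommGroup D'] [Module A D'] [AddCommGroup J] [Module A J] [AddCommGroup J']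
    [Module A J'] (a : L i →ₗ[A] J) (b : L i →ₗ[A] J') (g : D →ₗ[A] J) (g' : D' →ₗ[A] J')
    (ha : IsInjectiveHull a) (hb : IsInjectiveHull b) (hg : Function.Injective g)
    (hg' : Function.Injective g') (hCa : IsCostandardSubmodule A L i a (LinearMap.range g))
    (hCb : IsCostandardSubmodule A L i b (LinearMap.range g')) :
    ∃ t : D →ₗ[A] D', Function.Injective t := by
  obtain ⟨e, he⟩ := hb.exists_extend a ha.injective b
  have hei : Function.Injective e := by
    rw [← LinearMap.ker_eq_bot]
    refine ha.essential _ ?_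
    rw [eq_bot_iff]
    rintro _ ⟨hx, y, rfl⟩
    have : b y = 0 := by rw [← he]; exact hx
    rw [hb.injective (this.trans (map_zero b).symm), map_zero]
    exact Submodule.zero_mem _
  obtain ⟨s, hs, -, hsb, -⟩ := IsCostandard.exists_socle_aux hL ha hg hCa
  have hle : LinearMap.range (e ∘ₗ g) ≤ LinearMap.range g' := by
    refine hCb.2 ⟨?_, ?_⟩
    · rintro _ ⟨x, rfl⟩
      exact ⟨s x, by rw [LinearMap.comp_apply, hs, he]⟩
    · let E := LinearEquiv.ofInjective (e ∘ₗ g) (hei.comp hg)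
      obtain ⟨t, ht⟩ := LinearMap.exists_comp_eq_of_ker_le (LinearMap.range s).mkQ
        (Submodule.mkQ_surjective _)
        (((LinearMap.range b).submoduleOf (LinearMap.range (e ∘ₗ g))).mkQ ∘ₗ E.toLinearMap)
        (fun x hx => by
          rw [Submodule.mkQ_apply, Submodule.Quotient.mk_eq_zero] at hx
          obtain ⟨y, rfl⟩ := hx
          rw [LinearMap.comp_apply, Submodule.mkQ_apply, Submodule.Quotient.mk_eq_zero]
          refine ⟨y, ?_⟩
          change b y = e (g (s y))
          rw [hs, he])
      refine hsb.of_surjective t fun y => ?_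
      obtain ⟨x, rfl⟩ := Submodule.mkQ_surjective _ y
      obtain ⟨z, rfl⟩ := E.surjective x
      exact ⟨_, ht z⟩
  let E' := LinearEquiv.ofInjective g' hg'
  refine ⟨E'.symm.toLinearMap ∘ₗ (e ∘ₗ g).codRestrict _ (fun x => hle ⟨x, rfl⟩), ?_⟩
  refine E'.symm.injective.comp fun x y hxy => ?_
  exact hg (hei (congrArg Subtype.val hxy))

namespace HighestWeightSystem

variable {A : Type u} [Ring A] {Λ : Type*} [PartialOrder Λ] {L : Λ → Type*} {P I : Λ → Type u}
  [∀ i, AddCommGroup (L i)] [∀ i, Module A (L i)] [∀ i, AddCommGroup (P i)]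
  [∀ i, Module A (P i)] [∀ i, AddCommGroup (I i)] [∀ i, Module A (I i)]
  {f : ∀ i, P i →ₗ[A] L i} {ι : ∀ i, L i →ₗ[A] I i} {K : ∀ i, Submodule A (P i)}
  {C : ∀ i, Submodule A (I i)}

theorem isStandard (h : HighestWeightSystem f ι K C) (i : Λ) : IsStandard A L i (P i ⧸ K i) :=
  ⟨P i, _, _, f i, (K i).mkQ, h.cover i, Submodule.mkQ_surjective _, by
    rw [Submodule.ker_mkQ]; exact h.least i⟩

theorem isCostandard (h : HighestWeightSystem f ι K C) (i : Λ) : IsCostandard A L i (C i) :=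
  ⟨I i, _, _, ι i, (C i).subtype, h.hull i, Submodule.subtype_injective _, by
    rw [Submodule.range_subtype]; exact h.greatest i⟩

theorem exists_equiv (h : HighestWeightSystem f ι K C) {X : Type*} [AddCommGroup X] [Module A X]
    [hX : IsSimpleModule A X] : ∃ i, Nonempty (X ≃ₗ[A] L i) := by
  obtain ⟨m, _, ⟨e⟩⟩ := isSimpleModule_iff_quot_maximal.1 hX
  obtain ⟨i, ⟨e'⟩⟩ := h.complete (A ⧸ m) (IsSimpleModule.congr e.symm)
  exact ⟨i, ⟨e.trans e'⟩⟩

theorem exists_surjective (h : HighestWeightSystem f ι K C) {X : Type*} [AddCommGroup X]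
    [Module A X] [Module.Finite A X] [Nontrivial X] :
    ∃ i, ∃ φ : X →ₗ[A] L i, Function.Surjective φ := by
  obtain ⟨m, hm, -⟩ := (eq_top_or_exists_le_coatom (⊥ : Submodule A X)).resolve_left bot_ne_top
  have : IsSimpleModule A (X ⧸ m) := isSimpleModule_iff_isCoatom.2 hm
  obtain ⟨i, ⟨e⟩⟩ := h.exists_equiv (X := X ⧸ m)
  exact ⟨i, e.toLinearMap ∘ₗ m.mkQ, e.surjective.comp (Submodule.mkQ_surjective m)⟩

theorem exists_injective [IsArtinianRing A] (h : HighestWeightSystem f ι K C) {X : Type*}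
    [AddCommGroup X] [Module A X] [Module.Finite A X] [Nontrivial X] :
    ∃ i, ∃ φ : L i →ₗ[A] X, Function.Injective φ := by
  obtain ⟨m, hm, -⟩ := (eq_bot_or_exists_atom_le (⊤ : Submodule A X)).resolve_left top_ne_bot
  have : IsSimpleModule A m := isSimpleModule_iff_isAtom.2 hm
  obtain ⟨i, ⟨e⟩⟩ := h.exists_equiv (X := m)
  exact ⟨i, m.subtype ∘ₗ e.symm.toLinearMap, m.subtype_injective.comp e.symm.injective⟩

/-- Maps from `X` to a module whose composition factors are not quotients of `X` vanish. -/
theorem hom_eq_zero_of_hom_simple (h : HighestWeightSystem f ι K C) {X Y : Type*} [AddCommGroup X]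
    [Module A X] [Module.Finite A X] [AddCommGroup Y] [Module A Y] {π : Set Λ}
    (hY : BelongsTo A L π Y) (hX : ∀ i ∈ π, ∀ φ : X →ₗ[A] L i, φ = 0) (φ : X →ₗ[A] Y) : φ = 0 := by
  by_contra hφ
  have : Nontrivial (LinearMap.range φ) := by
    rw [Submodule.nontrivial_iff_ne_bot]
    exact fun h0 => hφ (LinearMap.range_eq_bot.1 h0)
  obtain ⟨i, ψ, hψ⟩ := h.exists_surjective (X := LinearMap.range φ)
  have := h.simple i
  have := IsSimpleModule.nontrivial A (L i)
  obtain ⟨y, hy⟩ := exists_ne (0 : L i)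
  obtain ⟨x, rfl⟩ := (hψ.comp φ.surjective_rangeRestrict) y
  exact hy (LinearMap.congr_fun (hX i (hY i ((IsCompositionFactor.of_surjective ψ
    hψ).of_injective_right _ (Submodule.subtype_injective _))) (ψ ∘ₗ φ.rangeRestrict)) x)

/-- Maps to `Y` from a module whose composition factors are not submodules of `Y` vanish. -/
theorem hom_eq_zero_of_simple_hom [IsArtinianRing A] (h : HighestWeightSystem f ι K C)
    {X Y : Type*} [AddCommGroup X] [Module A X] [Module.Finite A X] [AddCommGroup Y] [Module A Y]
    {π : Set Λ} (hX : BelongsTo A L π X) (hY : ∀ i ∈ π, ∀ φ : L i →ₗ[A] Y, φ = 0)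
    (φ : X →ₗ[A] Y) : φ = 0 := by
  by_contra hφ
  have : Nontrivial (LinearMap.range φ) := by
    rw [Submodule.nontrivial_iff_ne_bot]
    exact fun h0 => hφ (LinearMap.range_eq_bot.1 h0)
  obtain ⟨i, ψ, hψ⟩ := h.exists_injective (X := LinearMap.range φ)
  have := h.simple i
  have := IsSimpleModule.nontrivial A (L i)
  obtain ⟨y, hy⟩ := exists_ne (0 : L i)
  have h0 := hY i (hX i ((IsCompositionFactor.of_injective ψ hψ).of_surjective_right _
    φ.surjective_rangeRestrict)) ((LinearMap.range φ).subtype ∘ₗ ψ)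
  refine hy (hψ ?_)
  rw [map_zero]
  exact Subtype.ext (LinearMap.congr_fun h0 y)

theorem finite_costandard [IsArtinianRing A] (h : HighestWeightSystem f ι K C) (i : Λ) :
    Module.Finite A (C i) := by
  have := h.finite i
  infer_instance

theorem finite_cover (h : HighestWeightSystem f ι K C) (i : Λ) : Module.Finite A (P i) := by
  have := h.simple i
  exact (h.cover i).finite

/-- Every costandard module with label `i` is isomorphic to the chosen one. -/
theorem equiv_of_isCostandard [IsArtinianRing A] (h : HighestWeightSystem f ι K C) {i : Λ}
    {D : Type*} [AddCommGroup D] [Module A D] (hD : IsCostandard A L i D) :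
    Nonempty (D ≃ₗ[A] C i) := by
  have := h.simple i
  obtain ⟨J, _, _, a, g, ha, hg, hC⟩ := hD
  have hC' : IsCostandardSubmodule A L i (ι i) (LinearMap.range (C i).subtype) := by
    rw [Submodule.range_subtype]; exact h.greatest i
  obtain ⟨t, ht⟩ := IsCostandardSubmodule.exists_injective h.simple a (ι i) g
    (C i).subtype ha (h.hull i) hg (Submodule.subtype_injective _)
    hC hC'
  obtain ⟨t', ht'⟩ := IsCostandardSubmodule.exists_injective h.simple (ι i) a
    (C i).subtype g (h.hull i) ha (Submodule.subtype_injective _) hg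
    hC' hC
  have := h.finite_costandard i
  have hs : Function.Surjective (t ∘ₗ t') :=
    IsArtinian.surjective_of_injective_endomorphism _ (ht.comp ht')
  exact ⟨LinearEquiv.ofBijective t ⟨ht, fun y => (hs y).imp' t' fun x hx => hx⟩⟩

/-- The highest weight condition: a nonzero submodule of `I(i) / ∇(i)` has a composition factor
of weight greater than `i`. -/
theorem exists_lt_of_submodule [IsArtinianRing A] (h : HighestWeightSystem f ι K C) (i : Λ)
    (N : Submodule A (I i ⧸ C i)) (hN : N ≠ ⊥) : ∃ j, i < j ∧ IsCompositionFactor A (L j) N := by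
  refine (h.highest_weight i).induction
    (fun F => ∀ N ≤ F, N ≠ ⊥ → ∃ j, i < j ∧ IsCompositionFactor A (L j) N) ?_ ?_ N le_top hN
  · exact fun N hN hne => absurd (le_bot_iff.1 hN) hne
  · intro F F' hF hQ ih N hNF hN
    by_cases hN0 : N ⊓ F = ⊥
    · let t : N →ₗ[A] (↥F' ⧸ F.submoduleOf F') := (F.submoduleOf F').mkQ ∘ₗ Submodule.inclusion hNF
      have ht : Function.Injective t := (injective_iff_map_eq_zero t).2 fun x hx => by
        rw [LinearMap.comp_apply, Submodule.mkQ_apply, Submodule.Quotient.mk_eq_zero] at hx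
        have : x.1 ∈ N ⊓ F := ⟨x.2, hx⟩
        rw [hN0] at this
        exact Subtype.ext this
      rcases hQ with hQ | ⟨j, hij, hj⟩
      · refine absurd ?_ hN
        rw [← Submodule.subsingleton_iff_eq_bot]
        exact ht.subsingleton
      · obtain ⟨s, hs, -, hmin⟩ := hj.exists_socle h.simple
        have hle := hmin (LinearMap.range t) fun h0 => hN (by
          rw [← Submodule.subsingleton_iff_eq_bot]
          refine ⟨fun a b => ht ?_⟩
          rw [LinearMap.range_eq_bot.1 h0]
          rfl)
        let e := LinearEquiv.ofInjective t ht
        refine ⟨j, hij, .of_injective (e.symm.toLinearMap ∘ₗ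
          s.codRestrict (LinearMap.range t) (fun x => hle ⟨x, rfl⟩)) ?_⟩
        exact e.symm.injective.comp fun x y hxy => hs (congrArg Subtype.val hxy)
    · obtain ⟨j, hij, hj⟩ := ih _ inf_le_right hN0
      exact ⟨j, hij, hj.of_injective_right (Submodule.inclusion inf_le_left)
        (Submodule.inclusion_injective _)⟩

/-- There are no maps to `I(i) / ∇(i)` from modules without weights greater than `i`. -/
theorem hom_hull_quotient_eq_zero [IsArtinianRing A] (h : HighestWeightSystem f ι K C) {i : Λ}
    {X : Type*} [AddCommGroup X] [Module A X] (hX : BelongsTo A L {j | ¬ i < j} X)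
    (φ : X →ₗ[A] I i ⧸ C i) : φ = 0 := by
  by_contra hφ
  obtain ⟨j, hij, hj⟩ := h.exists_lt_of_submodule i (LinearMap.range φ)
    (fun h0 => hφ (LinearMap.range_eq_bot.1 h0))
  exact hX j (hj.of_surjective_right _ φ.surjective_rangeRestrict) hij

/-- `Ext¹(X, ∇(i)) = 0` if no weight of `X` is greater than `i`. -/
theorem ext_costandard_of_belongsTo [IsArtinianRing A] (h : HighestWeightSystem f ι K C) {i : Λ}
    {X : Type*} [AddCommGroup X] [Module A X] (hX : BelongsTo A L {j | ¬ i < j} X) :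
    ExtOneVanishes A X (C i) :=
  (h.hull i).extOneVanishes.of_lift (C i).subtype (Submodule.subtype_injective _) (C i).mkQ
    (fun e => by rw [Submodule.range_subtype, Submodule.mkQ_apply, Submodule.Quotient.mk_eq_zero])
    (fun φ => ⟨0, fun x => by rw [h.hom_hull_quotient_eq_zero hX φ]; simp⟩)

/-- `Ext¹(Δ(i), ∇(j)) = 0`. -/
theorem ext_standard_costandard [IsArtinianRing A] (h : HighestWeightSystem f ι K C) {i : Λ}
    {D : Type*} [AddCommGroup D] [Module A D] (hD : IsStandard A L i D) (j : Λ) :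
    ExtOneVanishes A D (C j) := by
  by_cases hji : j < i
  · obtain ⟨P', _, _, f', g, hf', hg, hK⟩ := hD
    have := hf'.projective
    refine ExtOneVanishes.of_extend .of_projective g hg fun φ => ⟨0, fun x => ?_⟩
    rw [hom_eq_zero_of_isLeast h.simple hK (((h.isCostandard j).belongsTo h.simple
      h.non_isomorphic).mono fun l hl => lt_of_le_of_lt hl hji) φ]
    rfl
  · exact h.ext_costandard_of_belongsTo ((hD.belongsTo h.simple h.non_isomorphic).mono
      fun l hl hjl => hji (lt_of_lt_of_le hjl hl))

theorem ext_standard_hull_quotient [IsArtinianRing A] (h : HighestWeightSystem f ι K C)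
    (i j : Λ) : ExtOneVanishes A (P i ⧸ K i) (I j ⧸ C j) := by
  refine .of_filtration_right (h.highest_weight j) fun N N' hN => ?_
  rcases hN with hN | ⟨l, -, hl⟩
  · exact .of_subsingleton_right
  · obtain ⟨e⟩ := h.equiv_of_isCostandard hl
    exact (h.ext_standard_costandard (h.isStandard i) l).of_equiv_right e.symm

/-- If `Ext¹(X, ∇(j)) = 0`, maps from `X` to `I(j) / ∇(j)` lift to `I(j)`. -/
theorem lift_hull (_h : HighestWeightSystem f ι K C) {j : Λ} {X : Type*} [AddCommGroup X]
    [Module A X] (hX : ExtOneVanishes A X (C j)) (φ : X →ₗ[A] I j ⧸ C j) :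
    ∃ ψ : X →ₗ[A] I j, ∀ x, (C j).mkQ (ψ x) = φ x := by
  refine ExtOneVanishes.lift ?_ (Submodule.mkQ_surjective (C j)) φ
  rw [Submodule.ker_mkQ]
  exact hX

/-- The consequence `Ext¹(ker q, ∇(j)) = 0` of `Ext¹(X, ∇(j)) = 0` and `Ext²(Z, ∇(j)) = 0`, for a
surjection `q : X → Z`; the latter condition is expressed by dimension shift. -/
theorem ext_ker [IsArtinianRing A] (h : HighestWeightSystem f ι K C) {j : Λ} {X Z : Type*}
    [AddCommGroup X] [Module A X] [AddCommGroup Z] [Module A Z] (q : X →ₗ[A] Z)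
    (hq : Function.Surjective q) (hX : ExtOneVanishes A X (C j))
    (hZ : ExtOneVanishes A Z (I j ⧸ C j)) : ExtOneVanishes A (LinearMap.ker q) (C j) := by
  refine (h.hull j).extOneVanishes.of_lift (C j).subtype (Submodule.subtype_injective _) (C j).mkQ
    (fun e => by rw [Submodule.range_subtype, Submodule.mkQ_apply, Submodule.Quotient.mk_eq_zero])
    (fun φ => ?_)
  obtain ⟨ψ, hψ⟩ := hZ.extend q hq φ
  obtain ⟨t, ht⟩ := h.lift_hull hX ψ
  exact ⟨t ∘ₗ Submodule.subtype _, fun x => by rw [LinearMap.comp_apply, ht]; exact hψ x⟩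

theorem ext_relations_costandard [IsArtinianRing A] (h : HighestWeightSystem f ι K C) (i j : Λ) :
    ExtOneVanishes A (K i) (C j) := by
  have := (h.cover i).projective
  have := h.ext_ker (j := j) (K i).mkQ (Submodule.mkQ_surjective _) .of_projective
    (h.ext_standard_hull_quotient i j)
  rwa [Submodule.ker_mkQ] at this

/-- The head `Δ(i) → L(i)`. -/
theorem exists_head (h : HighestWeightSystem f ι K C) (i : Λ) :
    ∃ d : (P i ⧸ K i) →ₗ[A] L i, (∀ x, d ((K i).mkQ x) = f i x) ∧ Function.Surjective d ∧
      BelongsTo A L (Set.Iio i) (LinearMap.ker d) ∧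
      ∀ N : Submodule A (P i ⧸ K i), N ≠ ⊤ → N ≤ LinearMap.ker d := by
  have hl := h.least i
  rw [← Submodule.ker_mkQ (K i)] at hl
  exact IsStandard.exists_head_aux h.simple (h.cover i) (Submodule.mkQ_surjective (K i))
    hl.1.1 hl.1.2

/-- The socle `L(i) → ∇(i)`. -/
theorem exists_socle (h : HighestWeightSystem f ι K C) (i : Λ) :
    ∃ s : L i →ₗ[A] C i, (∀ x, (s x).1 = ι i x) ∧ Function.Injective s ∧
      BelongsTo A L (Set.Iio i) (C i ⧸ LinearMap.range s) ∧
      ∀ N : Submodule A (C i), N ≠ ⊥ → LinearMap.range s ≤ N :=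
  IsCostandard.exists_socle_aux h.simple (h.hull i) (Submodule.subtype_injective (C i)) (by
    rw [Submodule.range_subtype]; exact h.greatest i)

/-- `Hom(Δ(i), ∇(j)) = 0` for `i ≠ j`. -/
theorem hom_standard_costandard_eq_zero (h : HighestWeightSystem f ι K C)
    {i j : Λ} (hij : i ≠ j) (φ : (P i ⧸ K i) →ₗ[A] C j) : φ = 0 := by
  by_contra hφ
  obtain ⟨d, -, hd, -, hmax⟩ := h.exists_head i
  obtain ⟨s, -, hs, -, hmin⟩ := h.exists_socle j
  -- The image of `φ` has head `L i` and socle `L j`.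
  have hk := hmax (LinearMap.ker φ) fun h0 => hφ (LinearMap.ker_eq_top.1 h0)
  have hr := hmin (LinearMap.range φ) fun h0 => hφ (LinearMap.range_eq_bot.1 h0)
  obtain ⟨g, hg⟩ := LinearMap.exists_comp_eq_of_ker_le φ.rangeRestrict φ.surjective_rangeRestrict d
    (fun x hx => hk (congrArg Subtype.val hx))
  have hgs : Function.Surjective g := fun y => by
    obtain ⟨x, rfl⟩ := hd y
    exact ⟨_, hg x⟩
  have h1 : i ≤ j := (h.isCostandard j).belongsTo h.simple h.non_isomorphic i
    ((IsCompositionFactor.of_surjective g hgs).of_injective_right _ (Submodule.subtype_injective _))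
  have h2 : j ≤ i := (h.isStandard i).belongsTo h.simple h.non_isomorphic j
    (IsCompositionFactor.of_surjective_right (.of_injective
      (s.codRestrict (LinearMap.range φ) (fun x => hr ⟨x, rfl⟩))
      (fun x y hxy => hs (congrArg Subtype.val hxy))) _ φ.surjective_rangeRestrict)
  exact hij (le_antisymm h1 h2)

/-- If `K(i)` is the kernel of `P(i) → Δ(i)`, then `L(j)` is a quotient of `K(i)` only if
`j > i`. -/
theorem hom_relations_simple_eq_zero [IsArtinianRing A] (h : HighestWeightSystem f ι K C)
    {i j : Λ} (hij : ¬ i < j) (φ : K i →ₗ[A] L j) : φ = 0 := by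
  have := h.simple i
  have := h.simple j
  obtain ⟨d, -, hd, -, hmax⟩ := h.exists_head i
  obtain ⟨s, -, hs, hsb, -⟩ := h.exists_socle j
  have hext : ExtOneVanishes A (P i ⧸ K i) (L j) := by
    refine (h.ext_standard_costandard (h.isStandard i) j).of_lift s hs (LinearMap.range s).mkQ
      (fun e => by rw [Submodule.mkQ_apply, Submodule.Quotient.mk_eq_zero]) fun φ => ⟨0, fun x => ?_⟩
    suffices φ = 0 by rw [this]; simp
    by_contra hφ
    have hk := hmax (LinearMap.ker φ) fun h0 => hφ (LinearMap.ker_eq_top.1 h0)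
    obtain ⟨g, hg⟩ := LinearMap.exists_comp_eq_of_ker_le φ.rangeRestrict
      φ.surjective_rangeRestrict d (fun x hx => hk (congrArg Subtype.val hx))
    have hgs : Function.Surjective g := fun y => by
      obtain ⟨x, rfl⟩ := hd y
      exact ⟨_, hg x⟩
    exact hij (hsb i ((IsCompositionFactor.of_surjective g hgs).of_injective_right _
      (Submodule.subtype_injective _)))
  obtain ⟨ψ, hψ⟩ := hext.extend (K i).mkQ (Submodule.mkQ_surjective _)
    (φ ∘ₗ (LinearEquiv.ofEq _ _ (Submodule.ker_mkQ (K i))).toLinearMap)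
  have hψ' : ∀ x : K i, ψ x.1 = φ x := fun x => hψ ⟨x.1, by rw [Submodule.ker_mkQ]; exact x.2⟩
  rcases ψ.surjective_or_eq_zero with hs | h0
  · -- The kernel of a surjection `P i → L j` is the maximal submodule `ker (f i)`.
    have hc : IsCoatom (LinearMap.ker ψ) := by
      rw [← isSimpleModule_iff_isCoatom]
      exact IsSimpleModule.congr (ψ.quotKerEquivOfSurjective hs)
    have hne : LinearMap.ker (f i) ≠ ⊤ := fun h0 => by
      have := IsSimpleModule.nontrivial A (L i)
      obtain ⟨y, hy⟩ := exists_ne (0 : L i)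
      obtain ⟨x, rfl⟩ := (h.cover i).surjective y
      exact hy (by rw [LinearMap.ker_eq_top.1 h0]; rfl)
    have he := (hc.le_iff.1 ((h.cover i).le_ker hc.1)).resolve_left hne
    ext x
    rw [← hψ']
    have : x.1 ∈ LinearMap.ker ψ := by rw [← he]; exact (h.least i).1.1 x.2
    exact this
  · ext x
    rw [← hψ', h0]; rfl

/-- A costandard-filtered module with highest weight `i` maps onto `∇(i)`, in such a way that
all maps from standard modules to `∇(i)` lift. -/
theorem exists_surjective_costandard [IsArtinianRing A] (h : HighestWeightSystem f ι K C) {i : Λ}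
    {T : Type*} [AddCommGroup T] [Module A T] (hT : HasCostandardFiltration A L T)
    (hi : IsCompositionFactor A (L i) T) (hb : BelongsTo A L (Set.Iic i) T) :
    ∃ π : T →ₗ[A] C i, Function.Surjective π ∧
      ∀ (j : Λ) (φ : (P j ⧸ K j) →ₗ[A] C i), ∃ ψ : (P j ⧸ K j) →ₗ[A] T, ∀ x, π (ψ x) = φ x := by
  have := h.simple i
  have hstep : ∀ N N' : Submodule A T, N ≤ N' → (Subsingleton (↥N' ⧸ N.submoduleOf N') ∨
      ∃ j, IsCostandard A L j (↥N' ⧸ N.submoduleOf N')) →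
      (∀ j, ExtOneVanishes A (P j ⧸ K j) N) → ∀ j, ExtOneVanishes A (P j ⧸ K j) N' := by
    intro N N' hN hQ hE j
    refine .of_section_right hN (hE j) ?_
    rcases hQ with hQ | ⟨l, hl⟩
    · exact .of_subsingleton_right
    · obtain ⟨e⟩ := h.equiv_of_isCostandard hl
      exact (h.ext_standard_costandard (h.isStandard j) l).of_equiv_right e.symm
  -- There is a section `∇(i) = N' / N` with `N` costandard-filtered.
  have key := hT.induction (fun F => (∀ j, ExtOneVanishes A (P j ⧸ K j) F) ∧
    (IsCompositionFactor A (L i) F → ∃ N N' : Submodule A T, N ≤ N' ∧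
      (∀ j, ExtOneVanishes A (P j ⧸ K j) N) ∧ IsCostandard A L i (↥N' ⧸ N.submoduleOf N'))) ?_ ?_
  · obtain ⟨N, N', hN, hE, hC⟩ := key.2 (hi.of_surjective_right
      (Submodule.topEquiv (R := A) (M := T)).toLinearMap (LinearEquiv.surjective _))
    obtain ⟨e⟩ := h.equiv_of_isCostandard hC
    let q : N' →ₗ[A] C i := e.toLinearMap ∘ₗ (N.submoduleOf N').mkQ
    have hq : Function.Surjective q := e.surjective.comp (Submodule.mkQ_surjective _)
    have hqk : LinearMap.ker q = N.submoduleOf N' := by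
      rw [LinearEquiv.ker_comp, Submodule.ker_mkQ]
    obtain ⟨π₀, hπ₀⟩ := (h.hull i).exists_extend N'.subtype N'.subtype_injective
      ((C i).subtype ∘ₗ q)
    have h0 := h.hom_hull_quotient_eq_zero
      (hb.mono fun j (hj : j ≤ i) hij => not_lt_of_ge hj hij) ((C i).mkQ ∘ₗ π₀)
    let π := π₀.codRestrict (C i) (fun x => by
      rw [← Submodule.Quotient.mk_eq_zero, ← Submodule.mkQ_apply]
      exact LinearMap.congr_fun h0 x)
    have hπ : ∀ x : N', π x.1 = q x := fun x => Subtype.ext (hπ₀ x)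
    refine ⟨π, fun y => ?_, fun j φ => ?_⟩
    · obtain ⟨x, rfl⟩ := hq y
      exact ⟨x.1, hπ x⟩
    · have hEq : ExtOneVanishes A (P j ⧸ K j) (LinearMap.ker q) := by
        rw [hqk]
        exact (hE j).of_equiv_right (Submodule.submoduleOfEquivOfLe hN).symm
      obtain ⟨ψ, hψ⟩ := hEq.lift hq φ
      exact ⟨N'.subtype ∘ₗ ψ, fun x => (hπ (ψ x)).trans (hψ x)⟩
  · refine ⟨fun j => .of_subsingleton_right, fun hc => ?_⟩
    obtain ⟨N₀, φ, hφ⟩ := isCompositionFactor_iff.1 hc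
    have := IsSimpleModule.nontrivial A (L i)
    exact absurd hφ.subsingleton (not_subsingleton (L i))
  · rintro N N' hN hQ ⟨hE, ih⟩
    refine ⟨hstep N N' hN hQ hE, fun hc => ?_⟩
    rcases hc.or_of_exact (N.submoduleOf N').mkQ with h1 | h1
    · rw [Submodule.ker_mkQ] at h1
      exact ih (h1.of_injective_right (Submodule.submoduleOfEquivOfLe hN).toLinearMap
        (LinearEquiv.injective _))
    · rcases hQ with hQ | ⟨j, hj⟩
      · obtain ⟨N₀, φ, hφ⟩ := isCompositionFactor_iff.1 h1
        have := IsSimpleModule.nontrivial A (L i)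
        exact absurd hφ.subsingleton (not_subsingleton (L i))
      · have hij : i ≤ j := hj.belongsTo h.simple h.non_isomorphic i h1
        have hji : j ≤ i := hb j (((hj.isCompositionFactor h.simple).of_surjective_right _
          (Submodule.mkQ_surjective _)).of_injective_right N'.subtype N'.subtype_injective)
        obtain rfl := le_antisymm hij hji
        exact ⟨N, N', hN, hE, hj⟩

/-- A module that maps onto all costandard modules and has no extensions by them is faithful. -/
theorem eq_zero_of_smul_eq_zero [IsArtinianRing A] (h : HighestWeightSystem f ι K C) {M : Type*}
    [AddCommGroup M] [Module A M] (hM : ∀ i, ExtOneVanishes A M (C i))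
    (hπ : ∀ i, ∃ π : M →ₗ[A] C i, Function.Surjective π) {a : A} (ha : ∀ m : M, a • m = 0) :
    a = 0 := by
  -- An annihilator of `M` annihilates all costandard-filtered modules, hence all `I i`.
  have hC : ∀ i (y : C i), a • y = 0 := fun i y => by
    obtain ⟨π, hπ⟩ := hπ i
    obtain ⟨m, rfl⟩ := hπ y
    rw [← map_smul, ha, map_zero]
  have hI : ∀ i (y : I i), a • y = 0 := by
    intro i
    have key := (h.highest_weight i).induction (fun F => ExtOneVanishes A M (F.comap (C i).mkQ) ∧
      ∀ y ∈ F.comap (C i).mkQ, a • y = 0) ?_ ?_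
    · exact fun y => key.2 y trivial
    · rw [Submodule.comap_bot, Submodule.ker_mkQ]
      exact ⟨hM i, fun y hy => congrArg Subtype.val (hC i ⟨y, hy⟩)⟩
    · rintro N N' hN hQ ⟨hE, hk⟩
      have hle := Submodule.comap_mono (f := (C i).mkQ) hN
      obtain ⟨e⟩ := nonempty_section_comap_equiv (C i).mkQ (Submodule.mkQ_surjective _) N N'
      generalize N.comap (C i).mkQ = F at hE hk hle e ⊢
      generalize N'.comap (C i).mkQ = F' at hle e ⊢
      have hEk : ExtOneVanishes A M (LinearMap.ker (F.submoduleOf F').mkQ) := by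
        rw [Submodule.ker_mkQ]
        exact hE.of_equiv_right (Submodule.submoduleOfEquivOfLe hle).symm
      have hsec : ExtOneVanishes A M (↥F' ⧸ F.submoduleOf F') ∧
          ∀ z : ↥F' ⧸ F.submoduleOf F', ∃ (t : M →ₗ[A] ↥F' ⧸ F.submoduleOf F') (m : M),
            t m = z := by
        rcases hQ with hQ | ⟨j, -, hj⟩
        · have : Subsingleton (↥F' ⧸ F.submoduleOf F') := e.symm.toEquiv.subsingleton
          exact ⟨.of_subsingleton_right, fun z => ⟨0, 0, Subsingleton.elim _ _⟩⟩
        · obtain ⟨e'⟩ := h.equiv_of_isCostandard hj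
          refine ⟨(hM j).of_equiv_right (e'.symm.trans e), fun z => ?_⟩
          obtain ⟨π, hπ⟩ := hπ j
          obtain ⟨m, hm⟩ := hπ (e' (e.symm z))
          exact ⟨(e'.symm.trans e).toLinearMap ∘ₗ π, m, by simp [hm]⟩
      refine ⟨.of_section_right hle hE hsec.1, fun y hy => ?_⟩
      obtain ⟨t, m, hm⟩ := hsec.2 ((F.submoduleOf F').mkQ ⟨y, hy⟩)
      obtain ⟨t', ht'⟩ := hEk.lift (Submodule.mkQ_surjective _) t
      have hd : (⟨y, hy⟩ : F') - t' m ∈ F.submoduleOf F' := by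
        rw [← Submodule.Quotient.mk_eq_zero, ← Submodule.mkQ_apply, map_sub, ht', hm, sub_self]
      have h1 := hk _ hd
      have h2 : a • (t' m).1 = 0 := by
        rw [← Submodule.coe_smul, ← map_smul, ha, map_zero]; rfl
      have h3 : y = F'.subtype ((⟨y, hy⟩ : F') - t' m) + (t' m).1 := by simp
      rw [h3, smul_add, h1, h2, add_zero]
  by_contra ha0
  have : Nontrivial (Submodule.span A {a}) := by
    rw [Submodule.nontrivial_iff_ne_bot, Ne, Submodule.span_singleton_eq_bot]
    exact ha0
  obtain ⟨i, φ, hφ⟩ := h.exists_surjective (X := Submodule.span A {a})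
  have := h.simple i
  obtain ⟨ψ, hψ⟩ := (h.hull i).exists_extend (Submodule.span A {a}).subtype
    (Submodule.subtype_injective _) (ι i ∘ₗ φ)
  have := IsSimpleModule.nontrivial A (L i)
  obtain ⟨y, hy⟩ := exists_ne (0 : L i)
  obtain ⟨⟨x, hx⟩, rfl⟩ := hφ y
  obtain ⟨r, rfl⟩ := Submodule.mem_span_singleton.1 hx
  refine hy ((h.hull i).injective ?_)
  rw [map_zero, ← LinearMap.comp_apply, ← hψ, Submodule.subtype_apply, map_smul,
    show a = a • (1 : A) by simp, map_smul, hI, smul_zero]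

end HighestWeightSystem

/-! ### Detecting costandard filtrations and lifting to standard modules -/

namespace HighestWeightSystem

variable {A : Type u} [Ring A] {Λ : Type*} [PartialOrder Λ] {L : Λ → Type*} {P I : Λ → Type u}
  [∀ i, AddCommGroup (L i)] [∀ i, Module A (L i)] [∀ i, AddCommGroup (P i)]
  [∀ i, Module A (P i)] [∀ i, AddCommGroup (I i)] [∀ i, Module A (I i)]
  {f : ∀ i, P i →ₗ[A] L i} {ι : ∀ i, L i →ₗ[A] I i} {K : ∀ i, Submodule A (P i)}
  {C : ∀ i, Submodule A (I i)}

theorem ext_of_ext_simple_left [IsArtinianRing A] (h : HighestWeightSystem f ι K C) {π : Set Λ}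
    {X Y : Type*} [AddCommGroup X] [Module A X] [Module.Finite A X] [AddCommGroup Y] [Module A Y]
    (hY : ∀ i ∈ π, ExtOneVanishes A (L i) Y) (hX : BelongsTo A L π X) : ExtOneVanishes A X Y := by
  have hfl : IsFiniteLength A X :=
    isFiniteLength_iff_isNoetherian_isArtinian.2 ⟨inferInstance, inferInstance⟩
  induction hfl with
  | of_subsingleton => exact .of_subsingleton_left
  | @of_simple_quotient X _ _ N _ _ ih =>
    refine .of_exact_left N.mkQ (Submodule.mkQ_surjective N) ?_ ?_
    · rw [Submodule.ker_mkQ]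
      exact ih (hX.of_injective N.subtype N.subtype_injective)
    · obtain ⟨i, ⟨e⟩⟩ := h.exists_equiv (X := X ⧸ N)
      have hi : i ∈ π := hX i (.of_surjective (e.toLinearMap ∘ₗ N.mkQ)
        (e.surjective.comp (Submodule.mkQ_surjective N)))
      exact (hY i hi).of_equiv_left e.symm

theorem ext_of_ext_simple_right [IsArtinianRing A] (h : HighestWeightSystem f ι K C) {π : Set Λ}
    {X Y : Type*} [AddCommGroup X] [Module A X] [AddCommGroup Y] [Module A Y] [Module.Finite A Y]
    (hX : ∀ i ∈ π, ExtOneVanishes A X (L i)) (hY : BelongsTo A L π Y) : ExtOneVanishes A X Y := by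
  have hfl : IsFiniteLength A Y :=
    isFiniteLength_iff_isNoetherian_isArtinian.2 ⟨inferInstance, inferInstance⟩
  induction hfl with
  | of_subsingleton => exact .of_subsingleton_right
  | @of_simple_quotient Y _ _ N _ _ ih =>
    refine .of_exact_right N.mkQ (Submodule.mkQ_surjective N) ?_ ?_
    · rw [Submodule.ker_mkQ]
      exact ih (hY.of_injective N.subtype N.subtype_injective)
    · obtain ⟨i, ⟨e⟩⟩ := h.exists_equiv (X := Y ⧸ N)
      have hi : i ∈ π := hY i (.of_surjective (e.toLinearMap ∘ₗ N.mkQ)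
        (e.surjective.comp (Submodule.mkQ_surjective N)))
      exact (hX i hi).of_equiv_right e.symm

/-- If `Ext¹(Δ(j), Y) = 0` for all `j`, then `Y` has a costandard submodule such that the quotient
by it has the same property. -/
theorem exists_costandard_submodule [IsArtinianRing A] [Finite Λ]
    (h : HighestWeightSystem f ι K C) {Y : Type*} [AddCommGroup Y] [Module A Y] [Module.Finite A Y]
    [Nontrivial Y] (hY : ∀ j, ExtOneVanishes A (P j ⧸ K j) Y) :
    ∃ (i : Λ) (t : C i →ₗ[A] Y), Function.Injective t ∧
      ∀ j, ExtOneVanishes A (P j ⧸ K j) (Y ⧸ LinearMap.range t) := by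
  -- Choose `i` minimal with a nonzero map `Δ(i) → Y`.
  have hne : ∃ i, ∃ φ : (P i ⧸ K i) →ₗ[A] Y, φ ≠ 0 := by
    obtain ⟨i, φ, hφ⟩ := h.exists_injective (X := Y)
    obtain ⟨d, -, hd, -⟩ := h.exists_head i
    refine ⟨i, φ ∘ₗ d, fun h0 => ?_⟩
    have := h.simple i
    have := IsSimpleModule.nontrivial A (L i)
    obtain ⟨y, hy⟩ := exists_ne (0 : L i)
    obtain ⟨x, rfl⟩ := hd y
    exact hy (hφ ((LinearMap.congr_fun h0 x).trans (map_zero φ).symm))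
  obtain ⟨i, ⟨φ, hφ⟩, hmin⟩ := WellFounded.has_min (wellFounded_lt (α := Λ))
    {i | ∃ φ : (P i ⧸ K i) →ₗ[A] Y, φ ≠ 0} hne
  have := h.simple i
  have := h.finite_cover i
  have := h.finite_costandard i
  have hsimple : ∀ j ∈ Set.Iio i, ∀ φ : L j →ₗ[A] Y, φ = 0 := by
    intro j hj φ
    obtain ⟨d, -, hd, -⟩ := h.exists_head j
    have h0 : φ ∘ₗ d = 0 := by
      by_contra hc
      exact hmin j ⟨_, hc⟩ hj
    ext y
    obtain ⟨x, rfl⟩ := hd y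
    exact LinearMap.congr_fun h0 x
  obtain ⟨d, -, hd, hdb, -⟩ := h.exists_head i
  obtain ⟨s, -, hs, hsb, hsmin⟩ := h.exists_socle i
  -- That map factors through `L i`, and extends from there to `∇(i)`.
  have hdk := h.hom_eq_zero_of_simple_hom hdb hsimple (φ ∘ₗ (LinearMap.ker d).subtype)
  obtain ⟨g, hg⟩ := LinearMap.exists_comp_eq_of_ker_le d hd φ
    (fun x hx => LinearMap.congr_fun hdk ⟨x, hx⟩)
  have hg0 : g ≠ 0 := by
    rintro rfl
    exact hφ (LinearMap.ext fun x => (hg x).symm)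
  have hext : ExtOneVanishes A (C i ⧸ LinearMap.range s) Y := by
    refine h.ext_of_ext_simple_left (fun j hj => ?_) hsb
    obtain ⟨d', -, hd', hdb', -⟩ := h.exists_head j
    have := h.finite_cover j
    refine (hY j).of_extend d' hd' fun ψ => ⟨0, fun x => ?_⟩
    rw [h.hom_eq_zero_of_simple_hom (hdb'.mono fun l hl => lt_trans hl hj) hsimple ψ]
    rfl
  have hk : LinearMap.ker (LinearMap.range s).mkQ = LinearMap.range s := Submodule.ker_mkQ _
  obtain ⟨t, ht⟩ := hext.extend (LinearMap.range s).mkQ (Submodule.mkQ_surjective _)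
    (g ∘ₗ ((LinearEquiv.ofEq _ _ hk).trans (LinearEquiv.ofInjective s hs).symm).toLinearMap)
  have hts : ∀ x, t (s x) = g x := fun x => by
    have := ht ⟨s x, by rw [hk]; exact ⟨x, rfl⟩⟩
    refine this.trans ?_
    rw [LinearMap.comp_apply]
    congr 1
    rw [LinearEquiv.coe_coe, LinearEquiv.trans_apply, LinearEquiv.symm_apply_eq]
    rfl
  have hti : Function.Injective t := by
    rw [← LinearMap.ker_eq_bot]
    by_contra hc
    refine hg0 (LinearMap.ext fun x => ?_)
    rw [← hts]
    exact hsmin _ hc ⟨x, rfl⟩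
  refine ⟨i, t, hti, fun j => ?_⟩
  -- `Ext¹(Δ(j), Y) → Ext¹(Δ(j), Y / ∇(i)) → Ext²(Δ(j), ∇(i)) = Ext¹(K j, ∇(i))`.
  have := (h.cover j).projective
  refine ExtOneVanishes.of_extend .of_projective (K j).mkQ (Submodule.mkQ_surjective _) fun ψ => ?_
  have h1 : ExtOneVanishes A (LinearMap.ker (K j).mkQ)
      (LinearMap.ker (LinearMap.range t).mkQ) := by
    rw [Submodule.ker_mkQ, Submodule.ker_mkQ]
    exact (h.ext_relations_costandard j i).of_equiv_right (LinearEquiv.ofInjective t hti)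
  obtain ⟨ψ', hψ'⟩ := h1.lift (Submodule.mkQ_surjective _) ψ
  obtain ⟨χ, hχ⟩ := (hY j).extend (K j).mkQ (Submodule.mkQ_surjective _) ψ'
  exact ⟨(LinearMap.range t).mkQ ∘ₗ χ, fun x => by rw [LinearMap.comp_apply, hχ, hψ']⟩

/-- Suppose that `Ext¹(X, ∇(j)) = 0` for all `j`. For `i` minimal among the labels with a nonzero
map `X → ∇(i)`, maps `X → ∇(i)` lift uniquely along `Δ(i) → L(i) → ∇(i)`. -/
theorem exists_lift_standard [IsArtinianRing A] [Finite Λ]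
    (h : HighestWeightSystem f ι K C) {X : Type*} [AddCommGroup X] [Module A X] [Module.Finite A X]
    [Nontrivial X] (hX : ∀ j, ExtOneVanishes A X (C j)) :
    ∃ (i : Λ) (d : (P i ⧸ K i) →ₗ[A] L i) (s : L i →ₗ[A] C i), Function.Surjective d ∧
      Function.Injective s ∧ (∀ N : Submodule A (P i ⧸ K i), N ≠ ⊤ → N ≤ LinearMap.ker d) ∧
      (∃ φ : X →ₗ[A] C i, φ ≠ 0) ∧
      (∀ ψ : X →ₗ[A] P i ⧸ K i, (∀ x, d (ψ x) = 0) → ψ = 0) ∧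
      ∀ φ : X →ₗ[A] C i, ∃ ψ : X →ₗ[A] P i ⧸ K i, ∀ x, s (d (ψ x)) = φ x := by
  have hne : ∃ i, ∃ φ : X →ₗ[A] C i, φ ≠ 0 := by
    obtain ⟨i, φ, hφ⟩ := h.exists_surjective (X := X)
    obtain ⟨s, -, hs, -⟩ := h.exists_socle i
    refine ⟨i, s ∘ₗ φ, fun h0 => ?_⟩
    have := h.simple i
    have := IsSimpleModule.nontrivial A (L i)
    obtain ⟨y, hy⟩ := exists_ne (0 : L i)
    obtain ⟨x, rfl⟩ := hφ y
    exact hy (hs ((LinearMap.congr_fun h0 x).trans (map_zero s).symm))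
  obtain ⟨i, hi, hmin⟩ := WellFounded.has_min (wellFounded_lt (α := Λ))
    {i | ∃ φ : X →ₗ[A] C i, φ ≠ 0} hne
  have := h.finite_cover i
  have := h.finite_costandard i
  have hsimple : ∀ j ∈ Set.Iio i, ∀ φ : X →ₗ[A] L j, φ = 0 := by
    intro j hj φ
    obtain ⟨s, -, hs, -⟩ := h.exists_socle j
    have h0 : s ∘ₗ φ = 0 := by
      by_contra hc
      exact hmin j ⟨_, hc⟩ hj
    ext x
    exact hs ((LinearMap.congr_fun h0 x).trans (map_zero s).symm)
  obtain ⟨d, -, hd, hdb, hdmax⟩ := h.exists_head i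
  obtain ⟨s, -, hs, hsb, hsmin⟩ := h.exists_socle i
  refine ⟨i, d, s, hd, hs, hdmax, hi, fun ψ hψ => ?_, fun φ => ?_⟩
  · have h0 := h.hom_eq_zero_of_hom_simple hdb hsimple (ψ.codRestrict (LinearMap.ker d) hψ)
    exact LinearMap.ext fun x => congrArg Subtype.val (LinearMap.congr_fun h0 x)
  · have h0 := h.hom_eq_zero_of_hom_simple hsb hsimple ((LinearMap.range s).mkQ ∘ₗ φ)
    let φ' : X →ₗ[A] L i := (LinearEquiv.ofInjective s hs).symm.toLinearMap ∘ₗ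
      φ.codRestrict (LinearMap.range s) (fun x => by
        rw [← Submodule.Quotient.mk_eq_zero, ← Submodule.mkQ_apply]
        exact LinearMap.congr_fun h0 x)
    have hφ' : ∀ x, s (φ' x) = φ x := fun x =>
      congrArg Subtype.val ((LinearEquiv.ofInjective s hs).apply_symm_apply _)
    have hext : ExtOneVanishes A X (LinearMap.ker d) := by
      refine h.ext_of_ext_simple_right (fun j hj => ?_) hdb
      obtain ⟨s', -, hs', hsb', -⟩ := h.exists_socle j
      have := h.finite_costandard j
      refine (hX j).of_lift s' hs' (LinearMap.range s').mkQ
        (fun e => by rw [Submodule.mkQ_apply, Submodule.Quotient.mk_eq_zero])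
        fun χ => ⟨0, fun x => ?_⟩
      rw [h.hom_eq_zero_of_hom_simple (hsb'.mono fun l hl => lt_trans hl hj) hsimple χ]
      simp
    obtain ⟨ψ, hψ⟩ := hext.lift hd φ'
    exact ⟨ψ, fun x => by rw [hψ, hφ']⟩

end HighestWeightSystem

/-! ### Bimodules of linear maps -/

section BimoduleBasics

variable {k S : Type*} [Field k] [Ring S] [Algebra k S]

theorem smul_eq_tmul_one_smul {B : Type*} [AddCommGroup B] [Module S B]
    [Module (S ⊗[k] Sᵐᵒᵖ) B] [IsScalarTower S (S ⊗[k] Sᵐᵒᵖ) B] (s : S) (b : B) :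
    s • b = (s ⊗ₜ[k] 1 : S ⊗[k] Sᵐᵒᵖ) • b := by
  rw [show (s ⊗ₜ[k] (1 : Sᵐᵒᵖ) : S ⊗[k] Sᵐᵒᵖ) = s • (1 : S ⊗[k] Sᵐᵒᵖ) by
    rw [Algebra.TensorProduct.one_def, TensorProduct.smul_tmul', smul_eq_mul, mul_one],
    smul_assoc, one_smul]

/-- An additive map commuting with the action of pure tensors is a homomorphism of bimodules. -/
def bimoduleHomOfTmul {B B' : Type*} [AddCommGroup B] [AddCommGroup B']
    [Module (S ⊗[k] Sᵐᵒᵖ) B] [Module (S ⊗[k] Sᵐᵒᵖ) B'] (φ : B →+ B')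
    (h : ∀ (s t : S) (b : B), φ ((s ⊗ₜ[k] MulOpposite.op t : S ⊗[k] Sᵐᵒᵖ) • b) =
      (s ⊗ₜ[k] MulOpposite.op t : S ⊗[k] Sᵐᵒᵖ) • φ b) : B →ₗ[S ⊗[k] Sᵐᵒᵖ] B' where
  toFun := φ
  map_add' := map_add φ
  map_smul' a b := by
    induction a with
    | zero =>
      exact (congrArg φ (zero_smul (S ⊗[k] Sᵐᵒᵖ) b)).trans
        ((map_zero φ).trans (zero_smul (S ⊗[k] Sᵐᵒᵖ) (φ b)).symm)
    | add a a' ha ha' => simp only [add_smul, map_add, ha, ha', RingHom.id_apply]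
    | tmul s t => exact h s t.unop b

end BimoduleBasics

namespace HomBimodule

section Instances

variable (k S X Y : Type*) [Field k] [AddCommGroup X] [Module k X] [AddCommGroup Y] [Module k Y]

instance : FunLike (HomBimodule k S X Y) X Y := inferInstanceAs (FunLike (X →ₗ[k] Y) X Y)

instance : LinearMapClass (HomBimodule k S X Y) k X Y :=
  inferInstanceAs (LinearMapClass (X →ₗ[k] Y) k X Y)

instance [FiniteDimensional k X] [FiniteDimensional k Y] :
    FiniteDimensional k (HomBimodule k S X Y) :=
  inferInstanceAs (FiniteDimensional k (X →ₗ[k] Y))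

variable [Ring S] [Algebra k S] [Module S Y] [IsScalarTower k S Y]

instance : Module S (HomBimodule k S X Y) :=
  Module.compHom (X →ₗ[k] Y) (homLeftAction k S X Y).toRingHom

instance : IsScalarTower k S (HomBimodule k S X Y) where
  smul_assoc c s φ := LinearMap.ext fun x => smul_assoc c s ((φ : X →ₗ[k] Y) x)

end Instances

variable {k S X Y : Type*} [Field k] [AddCommGroup X] [Module k X] [AddCommGroup Y] [Module k Y]

@[ext]
theorem ext {φ ψ : HomBimodule k S X Y} (h : ∀ x, φ x = ψ x) : φ = ψ :=
  LinearMap.ext h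

@[simp]
theorem add_apply (φ ψ : HomBimodule k S X Y) (x : X) : (φ + ψ) x = φ x + ψ x :=
  rfl

@[simp]
theorem sub_apply (φ ψ : HomBimodule k S X Y) (x : X) : (φ - ψ) x = φ x - ψ x :=
  rfl

@[simp]
theorem zero_apply (x : X) : (0 : HomBimodule k S X Y) x = 0 :=
  rfl

@[simp]
theorem smul_apply' (c : k) (φ : HomBimodule k S X Y) (x : X) : (c • φ) x = c • φ x :=
  rfl

/-- A linear map regarded as an element of the bimodule `Hom_k(X, Y)`. -/
def of (φ : X →ₗ[k] Y) : HomBimodule k S X Y :=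
  φ

/-- The rank one map `v ↦ α v • y`. -/
def rankOne (α : Module.Dual k X) (y : Y) : HomBimodule k S X Y :=
  of (α.smulRight y)

@[simp]
theorem rankOne_apply (α : Module.Dual k X) (y : Y) (x : X) :
    (rankOne α y : HomBimodule k S X Y) x = α x • y :=
  rfl

variable [Ring S] [Algebra k S] [Module S Y] [IsScalarTower k S Y]

@[simp]
theorem left_smul_apply (s : S) (φ : HomBimodule k S X Y) (x : X) : (s • φ) x = s • φ x :=
  rfl

variable [Module S X] [IsScalarTower k S X]

@[simp]
theorem tmul_smul_apply (s t : S) (φ : HomBimodule k S X Y) (x : X) :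
    ((s ⊗ₜ[k] MulOpposite.op t : S ⊗[k] Sᵐᵒᵖ) • φ) x = s • φ (t • x) :=
  homBimodule_tmul_smul k S X Y s t φ x

instance : IsScalarTower S (S ⊗[k] Sᵐᵒᵖ) (HomBimodule k S X Y) where
  smul_assoc s a φ := by
    induction a with
    | zero =>
      rw [smul_zero, show (0 : S ⊗[k] Sᵐᵒᵖ) • φ = 0 from zero_smul (S ⊗[k] Sᵐᵒᵖ) φ, smul_zero]
    | add a a' ha ha' => rw [smul_add, add_smul, add_smul, ha, ha', smul_add]
    | tmul a t =>
      rw [TensorProduct.smul_tmul', ← MulOpposite.op_unop t]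
      ext x
      rw [tmul_smul_apply, left_smul_apply, tmul_smul_apply, smul_assoc]

instance : IsScalarTower k (S ⊗[k] Sᵐᵒᵖ) (HomBimodule k S X Y) where
  smul_assoc c a φ := by
    induction a with
    | zero =>
      rw [smul_zero, show (0 : S ⊗[k] Sᵐᵒᵖ) • φ = 0 from zero_smul (S ⊗[k] Sᵐᵒᵖ) φ, smul_zero]
    | add a a' ha ha' => rw [smul_add, add_smul, add_smul, ha, ha', smul_add]
    | tmul a t =>
      rw [TensorProduct.smul_tmul', ← MulOpposite.op_unop t]
      ext x
      rw [tmul_smul_apply, smul_apply', tmul_smul_apply, smul_assoc]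

section Functoriality

variable {X' Y' : Type*} [AddCommGroup X'] [Module k X'] [Module S X'] [IsScalarTower k S X']
  [AddCommGroup Y'] [Module k Y'] [Module S Y'] [IsScalarTower k S Y']

/-- The homomorphism `φ ↦ b ∘ φ ∘ a` of bimodules from `Hom_k(X, Y)` to `Hom_k(X', Y')`. -/
noncomputable def map (a : X' →ₗ[S] X) (b : Y →ₗ[S] Y') :
    HomBimodule k S X Y →ₗ[S ⊗[k] Sᵐᵒᵖ] HomBimodule k S X' Y' :=
  bimoduleHomOfTmul
    { toFun := fun φ => of (b.restrictScalars k ∘ₗ (φ : X →ₗ[k] Y) ∘ₗ a.restrictScalars k)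
      map_zero' := by ext x; exact map_zero b
      map_add' := fun φ ψ => by ext x; exact map_add b _ _ }
    (fun s t φ => by
      ext x
      rw [tmul_smul_apply]
      change b (((s ⊗ₜ[k] MulOpposite.op t : S ⊗[k] Sᵐᵒᵖ) • φ) (a x)) = s • b (φ (a (t • x)))
      rw [tmul_smul_apply, b.map_smul, a.map_smul])

@[simp]
theorem map_apply (a : X' →ₗ[S] X) (b : Y →ₗ[S] Y') (φ : HomBimodule k S X Y) (x : X') :
    map a b φ x = b (φ (a x)) :=
  rfl

theorem map_surjective {a : X' →ₗ[S] X} {b : Y →ₗ[S] Y'} (ha : Function.Injective a)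
    (hb : Function.Surjective b) : Function.Surjective (map (k := k) a b) := by
  intro φ
  obtain ⟨a', ha'⟩ := LinearMap.exists_leftInverse_of_injective (a.restrictScalars k)
    (LinearMap.ker_eq_bot.2 ha)
  obtain ⟨b', hb'⟩ := LinearMap.exists_rightInverse_of_surjective (b.restrictScalars k)
    (LinearMap.range_eq_top.2 hb)
  refine ⟨of (b' ∘ₗ (φ : X' →ₗ[k] Y') ∘ₗ a'), ext fun x => ?_⟩
  rw [map_apply]
  change b (b' (φ (a' (a x)))) = φ x
  rw [show a' (a x) = x from LinearMap.congr_fun ha' x]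
  exact LinearMap.congr_fun hb' _

end Functoriality

end HomBimodule

namespace HomBimodule

/-! ### Rank one maps -/

section RankOne

variable {k S X Y : Type*} [Field k] [AddCommGroup X] [Module k X] [AddCommGroup Y] [Module k Y]

theorem rankOne_add (α : Module.Dual k X) (y y' : Y) :
    (rankOne α (y + y') : HomBimodule k S X Y) = rankOne α y + rankOne α y' := by
  ext x; simp

theorem rankOne_zero (α : Module.Dual k X) :
    (rankOne α (0 : Y) : HomBimodule k S X Y) = 0 := by
  ext x; simp

theorem add_rankOne (α β : Module.Dual k X) (y : Y) :
    (rankOne (α + β) y : HomBimodule k S X Y) = rankOne α y + rankOne β y := by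
  ext x; simp [add_smul]

theorem smul_rankOne (c : k) (α : Module.Dual k X) (y : Y) :
    (rankOne (c • α) y : HomBimodule k S X Y) = c • rankOne α y := by
  ext x; simp [mul_smul]

/-- The bimodule of linear maps is spanned by rank one maps. -/
theorem induction_rankOne [FiniteDimensional k X] {p : HomBimodule k S X Y → Prop}
    (h0 : p 0) (hadd : ∀ φ ψ, p φ → p ψ → p (φ + ψ))
    (h1 : ∀ (α : Module.Dual k X) (y : Y), p (rankOne α y)) (φ : HomBimodule k S X Y) : p φ := by
  classical
  let b := Module.finBasis k X
  have : φ = ∑ i, rankOne (b.coord i) (φ (b i)) := by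
    have : ∀ x, φ x = ∑ i, (b.coord i x) • φ (b i) := fun x => by
      conv_lhs => rw [← b.sum_repr x]
      rw [map_sum]
      exact Finset.sum_congr rfl fun i _ => map_smul φ _ _
    refine ext fun x => (this x).trans ?_
    exact (LinearMap.sum_apply Finset.univ (fun i => (b.coord i).smulRight (φ (b i))) x).symm
  rw [this]
  exact Finset.sum_induction _ p hadd h0 fun i _ => h1 _ _

variable [Ring S] [Algebra k S] [Module S Y] [IsScalarTower k S Y]

theorem rankOne_smul (α : Module.Dual k X) (s : S) (y : Y) :
    (rankOne α (s • y) : HomBimodule k S X Y) = s • rankOne α y := by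
  ext x
  have := IsScalarTower.to_smulCommClass' (R := k) (A := S) (M := Y)
  rw [rankOne_apply, left_smul_apply, rankOne_apply, smul_comm]

/-- The `S`-linear map `y ↦ (x ↦ α x • y)` from `Y` to `Hom_k(X, Y)`. -/
def rankOneHom (α : Module.Dual k X) : Y →ₗ[S] HomBimodule k S X Y where
  toFun := rankOne α
  map_add' := rankOne_add α
  map_smul' s y := rankOne_smul α s y

variable [Module S X] [IsScalarTower k S X]

theorem tmul_smul_rankOne (t : S) (α : Module.Dual k X) (y : Y) :
    ((1 : S) ⊗ₜ[k] MulOpposite.op t : S ⊗[k] Sᵐᵒᵖ) • (rankOne α y : HomBimodule k S X Y) =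
      rankOne (α ∘ₗ Algebra.lsmul k k X t) y := by
  ext x
  rw [tmul_smul_apply, one_smul]
  rfl

end RankOne

/-! ### Slices of bimodule homomorphisms -/

section Slices

variable {k S : Type*} [Field k] [Ring S] [Algebra k S]
  {X Y X' Y' : Type*} [AddCommGroup X] [Module k X] [Module S X] [IsScalarTower k S X]
  [AddCommGroup Y] [Module k Y] [Module S Y] [IsScalarTower k S Y]
  [AddCommGroup X'] [Module k X'] [Module S X'] [IsScalarTower k S X']
  [AddCommGroup Y'] [Module k Y'] [Module S Y'] [IsScalarTower k S Y'] [FiniteDimensional k X]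

theorem eq_zero_of_rankOne {Z : Type*} [AddCommGroup Z] [Module (S ⊗[k] Sᵐᵒᵖ) Z]
    (θ : HomBimodule k S X Y →ₗ[S ⊗[k] Sᵐᵒᵖ] Z) (h : ∀ α y, θ (rankOne α y) = 0) : θ = 0 := by
  refine LinearMap.ext fun φ => ?_
  refine induction_rankOne (p := fun φ => θ φ = 0) (map_zero θ) (fun φ ψ hφ hψ => ?_) h φ
  rw [map_add, hφ, hψ, add_zero]

/-- A bimodule homomorphism `Hom_k(X, Y) → Hom_k(X', Y')` vanishes if there are no nonzero
homomorphisms `Y → Y'`. -/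
theorem eq_zero_of_left (θ : HomBimodule k S X Y →ₗ[S ⊗[k] Sᵐᵒᵖ] HomBimodule k S X' Y')
    (x : X') (h : ∀ a : Y →ₗ[S] Y', (∀ y, ∃ φ, a y = θ φ x) → a = 0)
    (φ : HomBimodule k S X Y) : θ φ x = 0 := by
  refine induction_rankOne (p := fun φ => θ φ x = 0) (by rw [map_zero, zero_apply])
    (fun φ ψ hφ hψ => by rw [map_add, add_apply, hφ, hψ, add_zero]) (fun α y => ?_) φ
  let a : Y →ₗ[S] Y' :=
    { toFun := fun y => θ (rankOne α y) x
      map_add' := fun y y' => by rw [rankOne_add, map_add, add_apply]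
      map_smul' := fun s y => by
        rw [rankOne_smul, smul_eq_tmul_one_smul (k := k), map_smul, ← smul_eq_tmul_one_smul]
        rfl }
  exact LinearMap.congr_fun (h a fun y => ⟨_, rfl⟩) y

/-- For a bimodule homomorphism `θ : Hom_k(X, Y) → Hom_k(X', Y')`, a vector `y` and a linear form
`β` on `Y'` there is a homomorphism `b : X' → X` that is adjoint to `θ`. -/
theorem exists_right_slice (θ : HomBimodule k S X Y →ₗ[S ⊗[k] Sᵐᵒᵖ] HomBimodule k S X' Y')
    (y : Y) (β : Module.Dual k Y') :
    ∃ b : X' →ₗ[S] X, ∀ (α : Module.Dual k X) (x : X'), α (b x) = β (θ (rankOne α y) x) := by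
  have hk : ∀ (c : k) (φ : HomBimodule k S X Y), θ (c • φ) = c • θ φ := fun c φ => by
    rw [← one_smul (S ⊗[k] Sᵐᵒᵖ) φ, ← smul_assoc, map_smul, smul_assoc, one_smul, one_smul]
  let ev : X' → Module.Dual k (Module.Dual k X) := fun x =>
    { toFun := fun α => β (θ (rankOne α y) x)
      map_add' := fun α α' => by rw [add_rankOne, map_add, add_apply, map_add]
      map_smul' := fun c α => by
        rw [smul_rankOne, hk, smul_apply', map_smul, RingHom.id_apply] }
  let b : X' → X := fun x => (Module.evalEquiv k X).symm (ev x)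
  have hb : ∀ (α : Module.Dual k X) (x : X'), α (b x) = β (θ (rankOne α y) x) := fun α x => by
    rw [Module.apply_evalEquiv_symm_apply]
    rfl
  have hext : ∀ x x' : X, (∀ α : Module.Dual k X, α x = α x') → x = x' := fun x x' h => by
    rw [← sub_eq_zero, ← Module.forall_dual_apply_eq_zero_iff k]
    exact fun α => by rw [map_sub, h, sub_self]
  have hadd : ∀ x x', b (x + x') = b x + b x' := fun x x' => hext _ _ fun α => by
    rw [map_add, hb, hb, hb, map_add, map_add]
  have hsmul : ∀ (s : S) x, b (s • x) = s • b x := fun s x => hext _ _ fun α => by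
    have h1 := hb (α ∘ₗ Algebra.lsmul k k X s) x
    rw [← tmul_smul_rankOne, map_smul, tmul_smul_apply, one_smul] at h1
    rw [hb, ← h1]
    rfl
  exact ⟨{ toFun := b, map_add' := hadd, map_smul' := hsmul }, hb⟩

/-- A bimodule homomorphism `Hom_k(X, Y) → Hom_k(X', Y')` vanishes if there are no nonzero
homomorphisms `X' → X`. -/
theorem eq_zero_of_right (θ : HomBimodule k S X Y →ₗ[S ⊗[k] Sᵐᵒᵖ] HomBimodule k S X' Y')
    (h : ∀ b : X' →ₗ[S] X, (∀ x, (∀ φ, θ φ x = 0) → b x = 0) → b = 0) : θ = 0 := by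
  refine eq_zero_of_rankOne θ fun α y => ext fun x => ?_
  rw [zero_apply, ← Module.forall_dual_apply_eq_zero_iff k]
  intro β
  obtain ⟨b, hb⟩ := exists_right_slice θ y β
  rw [← hb, h b fun x hx => ?_, LinearMap.zero_apply, map_zero]
  rw [← Module.forall_dual_apply_eq_zero_iff k]
  intro α
  rw [hb, hx, map_zero]

end Slices

/-! ### Density and superfluous submodules -/

section Density

variable {k S : Type*} [Field k] [Ring S] [Algebra k S]
  {V X : Type*} [AddCommGroup V] [Module k V] [FiniteDimensional k V]
  [AddCommGroup X] [Module k X] [Module S X] [IsScalarTower k S X] [FiniteDimensional k X]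

instance : Module.Finite S (HomBimodule k S V X) :=
  Module.Finite.of_restrictScalars_finite k S _

/-- If every proper submodule of `X` lies in `X₀`, the maps with values in `X₀` form a superfluous
submodule of `Hom_k(V, X)`. -/
theorem eq_top_of_superfluous (X₀ : Submodule S X) (hne : X₀ ≠ ⊤) (hX₀ : ∀ N, N ≠ ⊤ → N ≤ X₀)
    (R : Submodule S (HomBimodule k S V X))
    (hR : ∀ φ : HomBimodule k S V X, ∃ r ∈ R, ∀ v, φ v - r v ∈ X₀) : R = ⊤ := by
  refine (eq_top_or_exists_le_coatom R).resolve_right ?_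
  rintro ⟨m, hm, hRm⟩
  have := isSimpleModule_iff_isCoatom.2 hm
  have key : ∀ (α : Module.Dual k V) (x : X), x ∈ X₀ → (rankOne α x : HomBimodule k S V X) ∈ m := by
    intro α x hx
    rw [← Submodule.Quotient.mk_eq_zero, ← Submodule.mkQ_apply]
    rcases (m.mkQ ∘ₗ (rankOneHom α : X →ₗ[S] HomBimodule k S V X)).surjective_or_eq_zero with hs | h0
    · have hc : IsCoatom (LinearMap.ker (m.mkQ ∘ₗ (rankOneHom α : X →ₗ[S] HomBimodule k S V X))) := by
        rw [← isSimpleModule_iff_isCoatom]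
        exact IsSimpleModule.congr (LinearMap.quotKerEquivOfSurjective _ hs)
      have := (hc.le_iff.1 (hX₀ _ hc.1)).resolve_left hne
      rw [this] at hx
      exact hx
    · exact LinearMap.congr_fun h0 x
  refine hm.1 (eq_top_iff.2 fun φ _ => ?_)
  obtain ⟨r, hr, hφ⟩ := hR φ
  rw [← sub_add_cancel φ r]
  refine m.add_mem ?_ (hRm hr)
  -- `φ - r` factors through `X₀`, where it is a sum of rank one maps.
  let ψ : HomBimodule k S V X₀ := of
    { toFun := fun v => ⟨φ v - r v, hφ v⟩
      map_add' := fun v w => Subtype.ext (by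
        change φ (v + w) - r (v + w) = (φ v - r v) + (φ w - r w)
        rw [map_add, map_add]; abel)
      map_smul' := fun c v => Subtype.ext (by
        change φ (c • v) - r (c • v) = c • (φ v - r v)
        rw [map_smul, map_smul, smul_sub]) }
  have : ∀ ψ : HomBimodule k S V X₀,
      (of ((X₀.subtype.restrictScalars k) ∘ₗ (ψ : V →ₗ[k] X₀)) : HomBimodule k S V X) ∈ m := by
    refine induction_rankOne ?_ (fun a b ha hb => ?_) fun α x => ?_
    · have : (of ((X₀.subtype.restrictScalars k) ∘ₗ ((0 : HomBimodule k S V X₀) : V →ₗ[k] X₀)) :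
        HomBimodule k S V X) = 0 := rfl
      rw [this]
      exact m.zero_mem
    · exact m.add_mem ha hb
    · exact key α x.1 x.2
  exact this ψ

/-- The density theorem for a split simple module `X`: an `S`-linear map `T : B → Hom_k(V, X)` is
surjective if no nonzero vector of `V` is killed by all maps `T b`. -/
theorem surjective_of_split [IsSimpleModule S X]
    (hsplit : ∀ g : X →ₗ[S] X, ∃ c : k, ∀ x, g x = c • x) {B : Type*} [AddCommGroup B] [Module S B]
    (T : B →ₗ[S] HomBimodule k S V X) (hT : ∀ v, (∀ b, T b v = 0) → v = 0) :
    Function.Surjective T := by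
  rw [← LinearMap.range_eq_top]
  refine (eq_top_or_exists_le_coatom (LinearMap.range T)).resolve_right ?_
  rintro ⟨m, hm, hRm⟩
  have := isSimpleModule_iff_isCoatom.2 hm
  obtain ⟨α₀, hα₀⟩ : ∃ α : Module.Dual k V,
      m.mkQ ∘ₗ (rankOneHom α : X →ₗ[S] HomBimodule k S V X) ≠ 0 := by
    by_contra! hc
    refine hm.1 (eq_top_iff.2 fun φ _ => ?_)
    refine induction_rankOne (p := fun φ => φ ∈ m) m.zero_mem (fun _ _ => m.add_mem)
      (fun α x => ?_) φ
    rw [← Submodule.Quotient.mk_eq_zero, ← Submodule.mkQ_apply]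
    exact LinearMap.congr_fun (hc α) x
  let e := LinearEquiv.ofBijective _ (LinearMap.bijective_of_ne_zero hα₀)
  let θ : HomBimodule k S V X →ₗ[S] X := e.symm.toLinearMap ∘ₗ m.mkQ
  have hθ : Function.Surjective θ := e.symm.surjective.comp (Submodule.mkQ_surjective m)
  have hθk : ∀ (c : k) φ, θ (c • φ) = c • θ φ := fun c φ => by
    rw [← one_smul S φ, ← smul_assoc, map_smul, smul_assoc, one_smul, one_smul]
  -- `θ` is the evaluation at some vector `v`, which is killed by all `T b`.
  have := IsSimpleModule.nontrivial S X
  obtain ⟨x₀, hx₀⟩ := exists_ne (0 : X)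
  obtain ⟨β, hβ⟩ : ∃ β : Module.Dual k X, β x₀ ≠ 0 := by
    by_contra! hc
    exact hx₀ ((Module.forall_dual_apply_eq_zero_iff k x₀).1 hc)
  let ev : Module.Dual k (Module.Dual k V) :=
    { toFun := fun α => (β x₀)⁻¹ * β (θ (rankOne α x₀))
      map_add' := fun α α' => by rw [add_rankOne, map_add, map_add, mul_add]
      map_smul' := fun c α => by
        rw [smul_rankOne, hθk, map_smul, smul_eq_mul, RingHom.id_apply, smul_eq_mul]; ring }
  let v := (Module.evalEquiv k V).symm ev
  have hv : ∀ α : Module.Dual k V, α v = (β x₀)⁻¹ * β (θ (rankOne α x₀)) := fun α => by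
    rw [Module.apply_evalEquiv_symm_apply]; rfl
  have hθv : ∀ φ, θ φ = φ v := by
    refine induction_rankOne (by simp) (fun φ ψ hφ hψ => by rw [map_add, hφ, hψ, add_apply])
      fun α x => ?_
    obtain ⟨c, hc⟩ := hsplit (θ ∘ₗ (rankOneHom α : X →ₗ[S] HomBimodule k S V X))
    have hc' : ∀ x, θ (rankOne α x) = c • x := hc
    rw [hc', rankOne_apply, hv, hc', map_smul, smul_eq_mul, mul_comm c, inv_mul_cancel_left₀ hβ]
  have hv0 : v = 0 := hT v fun b => by
    rw [← hθv]
    have hb : T b ∈ m := hRm ⟨b, rfl⟩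
    rw [← Submodule.Quotient.mk_eq_zero, ← Submodule.mkQ_apply] at hb
    rw [LinearMap.comp_apply, hb, map_zero]
  obtain ⟨φ, hφ⟩ := hθ x₀
  rw [hθv, hv0, map_zero] at hφ
  exact hx₀ hφ.symm

end Density

section Bimodules

variable {k S : Type*} [Field k] [Ring S] [Algebra k S]
  {X Y : Type*} [AddCommGroup X] [Module k X] [Module S X] [IsScalarTower k S X]
  [AddCommGroup Y] [Module k Y] [Module S Y] [IsScalarTower k S Y] [FiniteDimensional k X]
  [FiniteDimensional k Y]

/-- Burnside's theorem for split simple modules. -/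
theorem exists_smul_eq_of_split [IsSimpleModule S X]
    (hsplit : ∀ g : X →ₗ[S] X, ∃ c : k, ∀ x, g x = c • x) (φ : X →ₗ[k] X) :
    ∃ s : S, ∀ x, φ x = s • x := by
  let T : S →ₗ[S] HomBimodule k S X X :=
    { toFun := fun s => of (Algebra.lsmul k k X s)
      map_add' := fun s t => by ext x; exact add_smul s t x
      map_smul' := fun s t => by ext x; exact mul_smul s t x }
  obtain ⟨s, hs⟩ := surjective_of_split hsplit T
    (fun x hx => (one_smul S x).symm.trans (hx 1)) (of φ)
  exact ⟨s, fun x => congrArg (fun ψ : HomBimodule k S X X => ψ x) hs.symm⟩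

/-- For split simple modules `X` and `Y`, the bimodule `Hom_k(X, Y)` is simple. -/
theorem isSimpleModule [IsSimpleModule S X] [IsSimpleModule S Y]
    (hX : ∀ g : X →ₗ[S] X, ∃ c : k, ∀ x, g x = c • x)
    (hY : ∀ g : Y →ₗ[S] Y, ∃ c : k, ∀ x, g x = c • x) :
    IsSimpleModule (S ⊗[k] Sᵐᵒᵖ) (HomBimodule k S X Y) := by
  have := IsSimpleModule.nontrivial S X
  have := IsSimpleModule.nontrivial S Y
  have hnt : Nontrivial (HomBimodule k S X Y) := by
    obtain ⟨x, hx⟩ := exists_ne (0 : X)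
    obtain ⟨y, hy⟩ := exists_ne (0 : Y)
    obtain ⟨α, hα⟩ : ∃ α : Module.Dual k X, α x ≠ 0 := by
      by_contra! hc
      exact hx ((Module.forall_dual_apply_eq_zero_iff k x).1 hc)
    refine ⟨rankOne α y, 0, fun h => smul_ne_zero hα hy ?_⟩
    rw [← rankOne_apply (k := k) (S := S), h, zero_apply]
  rw [isSimpleModule_iff]
  refine { eq_bot_or_eq_top := fun N => or_iff_not_imp_left.2 fun hN => ?_ }
  obtain ⟨φ, hφN, hφ⟩ := Submodule.exists_mem_ne_zero_of_ne_bot hN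
  obtain ⟨x₀, hx₀⟩ : ∃ x, φ x ≠ 0 := by
    by_contra! hc
    exact hφ (ext hc)
  obtain ⟨β, hβ⟩ : ∃ β : Module.Dual k Y, β (φ x₀) ≠ 0 := by
    by_contra! hc
    exact hx₀ ((Module.forall_dual_apply_eq_zero_iff k _).1 hc)
  refine eq_top_iff.2 fun ψ _ => ?_
  refine induction_rankOne (p := fun ψ => ψ ∈ N) N.zero_mem (fun _ _ => N.add_mem)
    (fun α y => ?_) ψ
  -- The rank one map is `e ∘ φ ∘ e'` for endomorphisms `e` of `Y` and `e'` of `X`.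
  obtain ⟨t, ht⟩ := exists_smul_eq_of_split hX (α.smulRight x₀)
  obtain ⟨s, hs⟩ := exists_smul_eq_of_split hY (((β (φ x₀))⁻¹ • β).smulRight y)
  have : (rankOne α y : HomBimodule k S X Y) =
      (s ⊗ₜ[k] MulOpposite.op t : S ⊗[k] Sᵐᵒᵖ) • φ := by
    ext x
    rw [tmul_smul_apply, ← ht, ← hs, LinearMap.smulRight_apply, LinearMap.smulRight_apply, map_smul,
      map_smul, LinearMap.smul_apply, smul_eq_mul, smul_eq_mul, inv_mul_cancel₀ hβ, mul_one]
    rfl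
  rw [this]
  exact N.smul_mem _ hφN

variable {L : Type*} [AddCommGroup L] [Module S L]

/-- For an essential simple submodule `ι : L → X`, the maps vanishing on `L` form a superfluous
submodule of the bimodule `Hom_k(X, Y)`. -/
theorem eq_top_of_essential (ι : L →ₗ[S] X)
    (hess : ∀ N : Submodule S X, N ≠ ⊥ → LinearMap.range ι ≤ N)
    (hι : ι ≠ 0) (N : Submodule (S ⊗[k] Sᵐᵒᵖ) (HomBimodule k S X Y))
    (hN : ∀ φ : HomBimodule k S X Y, ∃ n ∈ N, ∀ l, φ (ι l) = n (ι l)) : N = ⊤ := by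
  by_contra hne
  obtain ⟨ℓ, hℓ, hNℓ⟩ : ∃ ℓ : Module.Dual k (HomBimodule k S X Y), ℓ ≠ 0 ∧ ∀ n ∈ N, ℓ n = 0 := by
    obtain ⟨ℓ, hℓ, hle⟩ := Submodule.exists_le_ker_of_lt_top (N.restrictScalars k)
      (lt_top_iff_ne_top.2 fun h => hne (by
        rw [Submodule.restrictScalars_eq_top_iff] at h
        exact h))
    exact ⟨ℓ, hℓ, fun n hn => hle hn⟩
  -- The orthogonal of `N` for the trace pairing with `Hom_k(Y, X)`.
  let M : Submodule S (HomBimodule k S Y X) :=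
    { carrier := {ψ | ∀ φ ∈ N, LinearMap.trace k Y ((φ : X →ₗ[k] Y) ∘ₗ (ψ : Y →ₗ[k] X)) = 0}
      zero_mem' := fun φ _ => by
        have : (φ : X →ₗ[k] Y) ∘ₗ ((0 : HomBimodule k S Y X) : Y →ₗ[k] X) = 0 :=
          LinearMap.ext fun y => map_zero φ
        rw [this, map_zero]
      add_mem' := fun {ψ ψ'} h h' φ hφ => by
        have : (φ : X →ₗ[k] Y) ∘ₗ ((ψ + ψ' : HomBimodule k S Y X) : Y →ₗ[k] X) =
            (φ : X →ₗ[k] Y) ∘ₗ (ψ : Y →ₗ[k] X) + (φ : X →ₗ[k] Y) ∘ₗ (ψ' : Y →ₗ[k] X) :=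
          LinearMap.ext fun y => map_add φ _ _
        rw [this, map_add, h φ hφ, h' φ hφ, add_zero]
      smul_mem' := fun s ψ h φ hφ => by
        have := h _ (N.smul_mem ((1 : S) ⊗ₜ[k] MulOpposite.op s : S ⊗[k] Sᵐᵒᵖ) hφ)
        rw [← this]
        congr 1
        refine LinearMap.ext fun y => ?_
        exact ((tmul_smul_apply 1 s φ (ψ y)).trans (one_smul S _)).symm }
  have hM : M ≠ ⊥ := by
    obtain ⟨y₀, α₀, h₀⟩ : ∃ y α, ℓ (rankOne α y) ≠ 0 := by
      by_contra! hc
      refine hℓ (LinearMap.ext fun φ => ?_)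
      exact induction_rankOne (p := fun φ => ℓ φ = 0) (map_zero ℓ)
        (fun φ ψ hφ hψ => by rw [map_add, hφ, hψ, add_zero]) (fun α y => hc y α) φ
    let ev : Y →ₗ[k] Module.Dual k (Module.Dual k X) :=
      LinearMap.mk₂ k (fun y α => ℓ (rankOne α y))
        (fun y y' α => by rw [rankOne_add, map_add])
        (fun c y α => by
          rw [← map_smul]; congr 1; ext x
          rw [rankOne_apply, smul_apply', rankOne_apply, smul_comm])
        (fun y α α' => by rw [add_rankOne, map_add])
        (fun c y α => by rw [smul_rankOne, map_smul])
    let ψ : Y →ₗ[k] X := (Module.evalEquiv k X).symm.toLinearMap ∘ₗ ev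
    have hψ : ∀ α y, α (ψ y) = ℓ (rankOne α y) := fun α y =>
      Module.apply_evalEquiv_symm_apply k X α (ev y)
    have htr : ∀ φ : HomBimodule k S X Y,
        LinearMap.trace k Y ((φ : X →ₗ[k] Y) ∘ₗ ψ) = ℓ φ := by
      refine induction_rankOne ?_ (fun φ φ' h h' => ?_) fun α y => ?_
      · have : ((0 : HomBimodule k S X Y) : X →ₗ[k] Y) ∘ₗ ψ = 0 := LinearMap.zero_comp ψ
        rw [this, map_zero, map_zero]
      · have : ((φ + φ' : HomBimodule k S X Y) : X →ₗ[k] Y) ∘ₗ ψ =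
          (φ : X →ₗ[k] Y) ∘ₗ ψ + (φ' : X →ₗ[k] Y) ∘ₗ ψ := LinearMap.add_comp ψ φ' φ
        rw [this, map_add, map_add, h, h']
      · have : ((rankOne α y : HomBimodule k S X Y) : X →ₗ[k] Y) ∘ₗ ψ = (α ∘ₗ ψ).smulRight y := rfl
        rw [this, LinearMap.trace_smulRight, LinearMap.comp_apply, hψ]
    have hmem : (of ψ : HomBimodule k S Y X) ∈ M := fun φ hφ => (htr φ).trans (hNℓ φ hφ)
    intro hbot
    rw [hbot, Submodule.mem_bot] at hmem
    refine h₀ ?_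
    rw [← hψ, show ψ y₀ = 0 from congrArg (fun χ : HomBimodule k S Y X => χ y₀) hmem, map_zero]
  have hart : IsArtinian S (HomBimodule k S Y X) := isArtinian_of_tower k inferInstance
  have : Nontrivial M := (Submodule.nontrivial_iff_ne_bot).2 hM
  obtain ⟨T, hT, -⟩ := (eq_bot_or_exists_atom_le (⊤ : Submodule S M)).resolve_left top_ne_bot
  have hTs : IsSimpleModule S T := isSimpleModule_iff_isAtom.2 hT
  -- All maps in a simple submodule of the orthogonal have values in the image of `L`.
  have hval : ∀ (t : T) (y : Y), (t.1.1 : HomBimodule k S Y X) y ∈ LinearMap.range ι := by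
    intro t y
    let ev : T →ₗ[S] X :=
      { toFun := fun t => t.1.1 y, map_add' := fun _ _ => rfl, map_smul' := fun _ _ => rfl }
    rcases eq_bot_or_eq_top ((LinearMap.range ι).comap ev) with hb | ht
    · refine absurd (LinearMap.ext fun l => ?_) hι
      by_cases hev : LinearMap.range ev = ⊥
      · have hmem : t ∈ (LinearMap.range ι).comap ev := by
          rw [Submodule.mem_comap, LinearMap.range_eq_bot.1 hev]
          exact Submodule.zero_mem _
        have : (⊤ : Submodule S T) = ⊥ := by
          rw [← hb, eq_comm, eq_top_iff]
          intro t' _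
          rw [Submodule.mem_comap, LinearMap.range_eq_bot.1 hev]
          exact Submodule.zero_mem _
        exact absurd this top_ne_bot
      · obtain ⟨t', ht'⟩ := hess _ hev ⟨l, rfl⟩
        have hmem : t' ∈ (LinearMap.range ι).comap ev := by
          rw [Submodule.mem_comap, ht']; exact ⟨l, rfl⟩
        rw [hb, Submodule.mem_bot] at hmem
        rw [← ht', hmem, map_zero, LinearMap.zero_apply]
    · have : t ∈ (LinearMap.range ι).comap ev := by rw [ht]; trivial
      exact this
  have := IsSimpleModule.nontrivial S T
  obtain ⟨t, ht⟩ := exists_ne (0 : T)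
  refine ht (Subtype.ext (Subtype.ext (ext fun y => ?_)))
  change t.1.1 y = 0
  rw [← Module.forall_dual_apply_eq_zero_iff k]
  intro α
  obtain ⟨n, hn, hn'⟩ := hN (rankOne α y)
  have h1 := t.1.2 n hn
  have h2 : (n : X →ₗ[k] Y) ∘ₗ (t.1.1 : Y →ₗ[k] X) = (α ∘ₗ (t.1.1 : Y →ₗ[k] X)).smulRight y := by
    refine LinearMap.ext fun z => ?_
    obtain ⟨l, hl⟩ := hval t z
    change n (t.1.1 z) = (rankOne α y : HomBimodule k S X Y) (t.1.1 z)
    rw [← hl, hn']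
  rw [h2, LinearMap.trace_smulRight] at h1
  exact h1

end Bimodules

end HomBimodule

/-! ### Projective covers of simple bimodules -/

/-- The coregular left module `S^* = Hom_k(S, k)`, with `(s α) t = α (t s)`. -/
def CoregularModule (k S : Type*) [Field k] [Ring S] [Algebra k S] : Type _ :=
  Module.Dual k S

namespace CoregularModule

variable (k S : Type*) [Field k] [Ring S] [Algebra k S]

instance : AddCommGroup (CoregularModule k S) :=
  inferInstanceAs (AddCommGroup (Module.Dual k S))

instance : Module k (CoregularModule k S) :=
  inferInstanceAs (Module k (Module.Dual k S))

instance [FiniteDimensional k S] : FiniteDimensional k (CoregularModule k S) :=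
  inferInstanceAs (FiniteDimensional k (Module.Dual k S))

instance : FunLike (CoregularModule k S) S k :=
  inferInstanceAs (FunLike (Module.Dual k S) S k)

instance : LinearMapClass (CoregularModule k S) k S k :=
  inferInstanceAs (LinearMapClass (Module.Dual k S) k S k)

instance : SMul S (CoregularModule k S) where
  smul s α := (α : Module.Dual k S) ∘ₗ LinearMap.mulRight k s

variable {k S}

theorem ext {α β : CoregularModule k S} (h : ∀ t, α t = β t) : α = β :=
  LinearMap.ext h

theorem smul_apply (s t : S) (α : CoregularModule k S) : (s • α) t = α (t * s) :=
  rfl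

instance : Module S (CoregularModule k S) where
  one_smul α := ext fun t => by rw [smul_apply, mul_one]
  mul_smul s t α := ext fun x => by rw [smul_apply, smul_apply, smul_apply, mul_assoc]
  smul_zero s := ext fun _ => rfl
  smul_add s α β := ext fun _ => rfl
  add_smul s t α := ext fun x => by rw [smul_apply, mul_add, map_add]; rfl
  zero_smul α := ext fun x => by rw [smul_apply, mul_zero, map_zero]; rfl

instance : IsScalarTower k S (CoregularModule k S) where
  smul_assoc c s α := ext fun x => by rw [smul_apply, mul_smul_comm, map_smul]; rfl

/-- The injective hull of a simple module embeds in the coregular module. -/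
theorem exists_injective_of_hull {S : Type u} [Ring S] [Algebra k S] {L : Type*} {I : Type u}
    [AddCommGroup L] [Module S L] [IsSimpleModule S L] [AddCommGroup I] [Module k I] [Module S I]
    [IsScalarTower k S I] {ι : L →ₗ[S] I} (hι : IsInjectiveHull ι) :
    ∃ j : I →ₗ[S] CoregularModule k S, Function.Injective j := by
  have := IsSimpleModule.nontrivial S L
  obtain ⟨l, hl⟩ := exists_ne (0 : L)
  obtain ⟨χ, hχ⟩ : ∃ χ : Module.Dual k I, χ (ι l) ≠ 0 := by
    by_contra! hc
    exact hl (hι.injective (((Module.forall_dual_apply_eq_zero_iff k _).1 hc).trans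
      (map_zero ι).symm))
  let j : I →ₗ[S] CoregularModule k S :=
    { toFun := fun x => χ ∘ₗ (LinearMap.toSpanSingleton S I x).restrictScalars k
      map_add' := fun x y => LinearMap.ext fun t =>
        (congrArg χ (smul_add t x y)).trans (map_add χ _ _)
      map_smul' := fun s x => ext fun t => (congrArg χ (mul_smul t s x).symm : _) }
  refine ⟨j, ?_⟩
  rw [← LinearMap.ker_eq_bot]
  by_contra hne
  have hm : j (ι l) = 0 := hι.range_le hne ⟨l, rfl⟩
  refine hχ ?_
  have := LinearMap.congr_fun (f := (j (ι l) : Module.Dual k S)) hm 1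
  exact (congrArg χ (one_smul S (ι l)).symm).trans this

/-- The bimodule `Hom_k(S^*, S)` is free of rank one. -/
theorem nonempty_equiv_homBimodule (k S : Type*) [Field k] [Ring S] [Algebra k S]
    [FiniteDimensional k S] :
    Nonempty ((S ⊗[k] Sᵐᵒᵖ) ≃ₗ[S ⊗[k] Sᵐᵒᵖ] HomBimodule k S (CoregularModule k S) S) := by
  let ev (t : S) : Module.Dual k (CoregularModule k S) :=
    { toFun := fun α => α t, map_add' := fun _ _ => rfl
      map_smul' := fun _ _ => rfl }
  let φ₀ : HomBimodule k S (CoregularModule k S) S := HomBimodule.rankOne (ev 1) 1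
  let F := LinearMap.toSpanSingleton (S ⊗[k] Sᵐᵒᵖ) _ φ₀
  have hF : ∀ s t : S, F (s ⊗ₜ[k] MulOpposite.op t) = HomBimodule.rankOne (ev t) s := by
    intro s t
    refine HomBimodule.ext fun α => ?_
    change ((s ⊗ₜ[k] MulOpposite.op t : S ⊗[k] Sᵐᵒᵖ) • φ₀) α = _
    rw [HomBimodule.tmul_smul_apply, HomBimodule.rankOne_apply, HomBimodule.rankOne_apply,
      smul_eq_mul, mul_smul_comm, mul_one]
    exact congrArg (· • s) (congrArg α (one_mul t))
  have hsurj : Function.Surjective F := by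
    refine fun φ => HomBimodule.induction_rankOne (p := fun φ => ∃ a, F a = φ)
      ⟨0, map_zero F⟩ ?_ (fun α s => ?_) φ
    · rintro _ _ ⟨a, rfl⟩ ⟨b, rfl⟩
      exact ⟨a + b, map_add F a b⟩
    · let t : S := (Module.evalEquiv k S).symm α
      refine ⟨s ⊗ₜ[k] MulOpposite.op t, ?_⟩
      rw [hF]
      congr 1
      exact LinearMap.ext fun β => Module.apply_evalEquiv_symm_apply k S (β : Module.Dual k S) α
  have hrank : Module.finrank k (S ⊗[k] Sᵐᵒᵖ) =
      Module.finrank k (HomBimodule k S (CoregularModule k S) S) := by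
    have h1 : Module.finrank k (HomBimodule k S (CoregularModule k S) S) =
        Module.finrank k (Module.Dual k S) * Module.finrank k S := Module.finrank_linearMap k k _ _
    rw [h1, Subspace.dual_finrank_eq, Module.finrank_tensorProduct]
    congr 1
    exact (MulOpposite.opLinearEquiv k (M := S)).symm.finrank_eq
  have hinj : Function.Injective (F.restrictScalars k) :=
    (LinearMap.injective_iff_surjective_of_finrank_eq_finrank hrank).2 hsurj
  exact ⟨LinearEquiv.ofBijective F ⟨hinj, hsurj⟩⟩

end CoregularModule

section OuterTensor

variable {k S L L' : Type*} [Field k] [Ring S] [Algebra k S]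
  [AddCommGroup L] [Module k L] [Module S L] [IsScalarTower k S L]
  [AddCommGroup L'] [Module k L'] [Module S L'] [IsScalarTower k S L']

/-- The outer tensor product `L ⊗ L'^*` is the bimodule `Hom_k(L', L)`. -/
theorem nonempty_outerTensorDual_equiv [FiniteDimensional k L'] :
    Nonempty (OuterTensorDual k S L L' ≃ₗ[S ⊗[k] Sᵐᵒᵖ] HomBimodule k S L' L) := by
  let e : (L ⊗[k] Module.Dual k L') ≃ₗ[k] (L' →ₗ[k] L) :=
    (TensorProduct.comm k L (Module.Dual k L')).trans (dualTensorHomEquiv k L' L)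
  have he : ∀ x α y, e (x ⊗ₜ α) y = α y • x := fun x α y => by
    simp [e]
  let F : OuterTensorDual k S L L' →ₗ[S ⊗[k] Sᵐᵒᵖ] HomBimodule k S L' L :=
    bimoduleHomOfTmul (B := OuterTensorDual k S L L') (B' := HomBimodule k S L' L)
      (e.toLinearMap.toAddMonoidHom) (fun s t b => by
        have hk := IsScalarTower.to_smulCommClass' (R := k) (A := S) (M := L)
        refine TensorProduct.induction_on (R := k) (M := L) (N := Module.Dual k L')
          (motive := fun b => e ((s ⊗ₜ[k] MulOpposite.op t : S ⊗[k] Sᵐᵒᵖ) •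
            (show OuterTensorDual k S L L' from b)) = ((s ⊗ₜ[k] MulOpposite.op t : S ⊗[k] Sᵐᵒᵖ) •
            (show HomBimodule k S L' L from e b) : HomBimodule k S L' L)) b ?_ (fun x α => ?_)
            (fun x y hx hy => ?_)
        · refine (congrArg e (smul_zero (A := OuterTensorDual k S L L') _)).trans ?_
          refine (map_zero e).trans (Eq.symm ?_)
          refine (congrArg (fun z : HomBimodule k S L' L =>
            (s ⊗ₜ[k] MulOpposite.op t : S ⊗[k] Sᵐᵒᵖ) • z) (map_zero e)).trans ?_
          exact smul_zero (A := HomBimodule k S L' L) _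
        · rw [outerTensorDual_tmul_smul]
          refine HomBimodule.ext fun y => ?_
          rw [HomBimodule.tmul_smul_apply]
          refine (he _ _ _).trans ?_
          refine Eq.trans ?_ (congrArg (s • ·) (he x α (t • y)).symm)
          rw [smul_comm]
          rfl
        · refine (congrArg e (smul_add (A := OuterTensorDual k S L L') _ x y)).trans ?_
          refine (map_add e _ _).trans ?_
          refine (congrArg₂ (· + ·) hx hy).trans ?_
          refine Eq.trans ?_ (congrArg (fun z : HomBimodule k S L' L =>
            (s ⊗ₜ[k] MulOpposite.op t : S ⊗[k] Sᵐᵒᵖ) • z) (map_add e x y)).symm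
          exact (smul_add (A := HomBimodule k S L' L) _ _ _).symm)
  exact ⟨LinearEquiv.ofBijective F e.bijective⟩

end OuterTensor

section ProjectiveCover

variable {k S : Type u} [Field k] [Ring S] [Algebra k S] {L L' : Type*} {P I : Type u}
  [AddCommGroup L] [Module S L] [AddCommGroup L'] [Module S L']
  [AddCommGroup P] [Module k P] [Module S P] [IsScalarTower k S P]
  [AddCommGroup I] [Module k I] [Module S I] [IsScalarTower k S I]
  [IsSimpleModule S L] [IsSimpleModule S L'] {f : P →ₗ[S] L} {ι : L' →ₗ[S] I}

/-- `Hom_k(I(j), P(i))` is a direct summand of the free bimodule `Hom_k(S^*, S)`. -/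
theorem HomBimodule.projective [FiniteDimensional k S] (hf : IsProjectiveCover f)
    (hι : IsInjectiveHull ι) :
    Module.Projective (S ⊗[k] Sᵐᵒᵖ) (HomBimodule k S I P) := by
  obtain ⟨j, hj⟩ := CoregularModule.exists_injective_of_hull (k := k) hι
  obtain ⟨r, hr⟩ := hι.exists_extend j hj LinearMap.id
  have := hf.projective
  have := IsSimpleModule.nontrivial S L
  obtain ⟨l, hl⟩ := exists_ne (0 : L)
  obtain ⟨p, rfl⟩ := hf.surjective l
  let a : S →ₗ[S] P := LinearMap.toSpanSingleton S P p
  have ha : Function.Surjective a := by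
    rw [← LinearMap.range_eq_top]
    by_contra hne
    exact hl (hf.le_ker hne ⟨1, one_smul S p⟩)
  obtain ⟨σ, hσ⟩ := Module.projective_lifting_property a LinearMap.id ha
  obtain ⟨e⟩ := CoregularModule.nonempty_equiv_homBimodule k S
  have := Module.Projective.of_equiv e
  refine Module.Projective.of_split (HomBimodule.map (k := k) r σ) (HomBimodule.map j a) ?_
  refine LinearMap.ext fun φ => HomBimodule.ext fun x => ?_
  change a (σ (φ (r (j x)))) = φ x
  rw [hr]
  exact LinearMap.congr_fun hσ _

variable [Module k L] [IsScalarTower k S L] [Module k L'] [IsScalarTower k S L']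

/-- The sub-bimodule of maps `I(j) → P(i)` inducing the zero map `L(j) → L(i)` is superfluous. -/
theorem HomBimodule.eq_top_of_sup_ker [FiniteDimensional k P] [FiniteDimensional k I]
    (hf : IsProjectiveCover f) (hι : IsInjectiveHull ι)
    (N : Submodule (S ⊗[k] Sᵐᵒᵖ) (HomBimodule k S I P))
    (hN : N ⊔ LinearMap.ker (HomBimodule.map (k := k) ι f) = ⊤) : N = ⊤ := by
  have := IsSimpleModule.nontrivial S L
  have := IsSimpleModule.nontrivial S L'
  obtain ⟨ι', hι'⟩ := LinearMap.exists_leftInverse_of_injective (ι.restrictScalars k)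
    (LinearMap.ker_eq_bot.2 hι.injective)
  have hι'' : ∀ l, ι' (ι l) = l := fun l => LinearMap.congr_fun hι' l
  have hι0 : ι ≠ 0 := by
    obtain ⟨l, hl⟩ := exists_ne (0 : L')
    exact fun h0 => hl (hι.injective (by rw [h0]; rfl))
  have hf0 : LinearMap.ker f ≠ ⊤ := fun h0 => by
    obtain ⟨l, hl⟩ := exists_ne (0 : L)
    obtain ⟨p, rfl⟩ := hf.surjective l
    exact hl (by rw [LinearMap.ker_eq_top.1 h0]; rfl)
  -- Maps agreeing on `L'` with an element of `N`.
  let R : Submodule S (HomBimodule k S I P) :=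
    { carrier := {φ | ∃ n ∈ N, ∀ l, φ (ι l) = n (ι l)}
      zero_mem' := ⟨0, N.zero_mem, fun _ => rfl⟩
      add_mem' := by
        rintro φ φ' ⟨n, hn, h⟩ ⟨n', hn', h'⟩
        exact ⟨n + n', N.add_mem hn hn', fun l => by
          rw [HomBimodule.add_apply, HomBimodule.add_apply, h, h']⟩
      smul_mem' := by
        rintro s φ ⟨n, hn, h⟩
        refine ⟨s • n, ?_, fun l => by
          rw [HomBimodule.left_smul_apply, HomBimodule.left_smul_apply, h]⟩
        rw [smul_eq_tmul_one_smul (k := k)]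
        exact N.smul_mem _ hn }
  have hR : R = ⊤ := by
    refine HomBimodule.eq_top_of_superfluous (LinearMap.ker f) hf0 (fun _ => hf.le_ker) R
      fun φ => ?_
    have hφ : φ ∈ N ⊔ LinearMap.ker (HomBimodule.map (k := k) ι f) := by rw [hN]; trivial
    obtain ⟨n, hn, w, hw, rfl⟩ := Submodule.mem_sup.1 hφ
    let w' : HomBimodule k S I P :=
      HomBimodule.of ((w : I →ₗ[k] P) ∘ₗ ι.restrictScalars k ∘ₗ ι')
    have hw' : ∀ x, w' x = w (ι (ι' x)) := fun _ => rfl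
    refine ⟨n + (w - w'), ⟨n, hn, fun l => ?_⟩, fun x => ?_⟩
    · rw [HomBimodule.add_apply, HomBimodule.sub_apply, hw', hι'', sub_self, add_zero]
    · rw [HomBimodule.add_apply, HomBimodule.add_apply, HomBimodule.sub_apply, hw',
        add_sub_add_left_eq_sub, sub_sub_cancel]
      exact congrArg (fun ψ : HomBimodule k S L' L => ψ (ι' x)) (LinearMap.mem_ker.1 hw)
  refine HomBimodule.eq_top_of_essential ι (fun _ => hι.range_le) hι0 N fun φ => ?_
  have : φ ∈ R := by rw [hR]; trivial
  exact this

/-- The projective cover of the simple bimodule `L(i) ⊗ L(j)^*` is `Hom_k(I(j), P(i))`. -/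
theorem HomBimodule.isProjectiveCover [FiniteDimensional k S] [FiniteDimensional k P]
    [FiniteDimensional k I] {Z : Type*} [AddCommGroup Z] [Module (S ⊗[k] Sᵐᵒᵖ) Z]
    (hf : IsProjectiveCover f) (hι : IsInjectiveHull ι)
    (e : HomBimodule k S L' L ≃ₗ[S ⊗[k] Sᵐᵒᵖ] Z) :
    IsProjectiveCover (e.toLinearMap ∘ₗ HomBimodule.map (k := k) ι f) where
  projective := HomBimodule.projective hf hι
  surjective := e.surjective.comp (HomBimodule.map_surjective hι.injective hf.surjective)
  superfluous N hN := HomBimodule.eq_top_of_sup_ker hf hι N (by rwa [LinearEquiv.ker_comp] at hN)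

end ProjectiveCover

set_option linter.unusedSectionVars false

/-! ### Standard bimodules -/

section CoversAndHulls

variable {A : Type*} [Ring A] {Y X : Type*} [AddCommGroup Y] [Module A Y] [IsSimpleModule A Y]
  [AddCommGroup X] [Module A X]

/-- A nonzero map from the projective cover of `Y` exhibits `Y` as a composition factor. -/
theorem IsProjectiveCover.isCompositionFactor {P : Type*} [AddCommGroup P] [Module A P]
    {f : P →ₗ[A] Y} (hf : IsProjectiveCover f) {φ : P →ₗ[A] X} (hφ : φ ≠ 0) :
    IsCompositionFactor A Y X := by
  have hk := hf.le_ker fun h0 => hφ (LinearMap.ker_eq_top.1 h0)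
  obtain ⟨g, hg⟩ := LinearMap.exists_comp_eq_of_ker_le φ.rangeRestrict
    φ.surjective_rangeRestrict f (fun x hx => hk (congrArg Subtype.val hx))
  refine isCompositionFactor_iff.2 ⟨_, g, fun y => ?_⟩
  obtain ⟨x, rfl⟩ := hf.surjective y
  exact ⟨_, hg x⟩

/-- The projective cover of a composition factor of `X` maps nontrivially to `X`. -/
theorem IsProjectiveCover.exists_hom_ne_zero {P : Type*} [AddCommGroup P] [Module A P]
    {f : P →ₗ[A] Y} (hf : IsProjectiveCover f) (h : IsCompositionFactor A Y X) :
    ∃ φ : P →ₗ[A] X, φ ≠ 0 := by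
  have := hf.projective
  obtain ⟨N, ψ, hψ⟩ := isCompositionFactor_iff.1 h
  obtain ⟨φ, hφ⟩ := Module.projective_lifting_property ψ f hψ
  refine ⟨N.subtype ∘ₗ φ, fun h0 => ?_⟩
  have := IsSimpleModule.nontrivial A Y
  obtain ⟨y, hy⟩ := exists_ne (0 : Y)
  obtain ⟨x, rfl⟩ := hf.surjective y
  refine hy ?_
  rw [← hφ, LinearMap.comp_apply, show φ x = 0 from Subtype.ext (LinearMap.congr_fun h0 x),
    map_zero]

/-- A composition factor of `ker F / ker G` is detected by a nonzero homomorphism from its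
projective cover to the target of `G`, with values in `G (ker F)`. -/
theorem IsProjectiveCover.exists_hom_of_section {P W Z Z' : Type*} [AddCommGroup P] [Module A P]
    [AddCommGroup W] [Module A W] [AddCommGroup Z] [Module A Z] [AddCommGroup Z'] [Module A Z']
    {f : P →ₗ[A] Y} (hf : IsProjectiveCover f) (F : W →ₗ[A] Z) (G : W →ₗ[A] Z')
    (h : IsCompositionFactor A Y
      (↥(LinearMap.ker F) ⧸ (LinearMap.ker G).submoduleOf (LinearMap.ker F))) :
    ∃ θ : P →ₗ[A] Z', θ ≠ 0 ∧ ∀ p, ∃ w, F w = 0 ∧ θ p = G w := by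
  obtain ⟨T, hT⟩ := LinearMap.exists_comp_eq_of_ker_le
    ((LinearMap.ker G).submoduleOf (LinearMap.ker F)).mkQ (Submodule.mkQ_surjective _)
    (G ∘ₗ (LinearMap.ker F).subtype) (fun x hx => by
      rw [Submodule.mkQ_apply, Submodule.Quotient.mk_eq_zero] at hx
      exact hx)
  have hTi : Function.Injective T := (injective_iff_map_eq_zero T).2 fun y hy => by
    obtain ⟨x, rfl⟩ := Submodule.mkQ_surjective _ y
    rw [hT] at hy
    rw [Submodule.mkQ_apply, Submodule.Quotient.mk_eq_zero]
    exact hy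
  obtain ⟨φ, hφ⟩ := hf.exists_hom_ne_zero h
  refine ⟨T ∘ₗ φ, fun h0 => hφ (LinearMap.ext fun x => hTi ?_), fun p => ?_⟩
  · exact (LinearMap.congr_fun h0 x).trans (map_zero T).symm
  · obtain ⟨y, hy⟩ := Submodule.mkQ_surjective _ (φ p)
    exact ⟨y.1, y.2, by rw [LinearMap.comp_apply, ← hy, hT]; rfl⟩

/-- If `Y` is not a composition factor of `N / N'`, then homomorphisms from the projective cover
of `Y` with values in `N` have values in `N'`. -/
theorem IsProjectiveCover.apply_mem {P W : Type*} [AddCommGroup P] [Module A P]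
    [AddCommGroup W] [Module A W] {f : P →ₗ[A] Y} (hf : IsProjectiveCover f)
    {N N' : Submodule A W} (h : ¬ IsCompositionFactor A Y (↥N ⧸ N'.submoduleOf N))
    (θ : P →ₗ[A] W) (hθ : ∀ p, θ p ∈ N) (p : P) : θ p ∈ N' := by
  by_contra hp
  refine h (hf.isCompositionFactor (φ := (N'.submoduleOf N).mkQ ∘ₗ θ.codRestrict N hθ)
    fun h0 => hp ?_)
  have := LinearMap.congr_fun h0 p
  rw [LinearMap.comp_apply, Submodule.mkQ_apply, LinearMap.zero_apply,
    Submodule.Quotient.mk_eq_zero] at this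
  exact this

end CoversAndHulls

/-- A nonzero map to the injective hull of `Y` exhibits `Y` as a composition factor. -/
theorem IsInjectiveHull.isCompositionFactor {A : Type u} [Ring A] {Y X : Type*} {I : Type u}
    [AddCommGroup Y] [Module A Y] [IsSimpleModule A Y] [AddCommGroup X] [Module A X]
    [AddCommGroup I] [Module A I] {ι : Y →ₗ[A] I} (hι : IsInjectiveHull ι) {φ : X →ₗ[A] I}
    (hφ : φ ≠ 0) : IsCompositionFactor A Y X := by
  have hr := hι.range_le fun h0 => hφ (LinearMap.range_eq_bot.1 h0)
  exact IsCompositionFactor.of_surjective_right (.of_injective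
    (ι.codRestrict (LinearMap.range φ) (fun x => hr ⟨x, rfl⟩))
    (fun x y hxy => hι.injective (congrArg Subtype.val hxy))) _ φ.surjective_rangeRestrict

/-- A linear map that maps `C` to `K` is the sum of a map with values in `K` and a map vanishing
on `C`. -/
theorem HomBimodule.exists_eq_add {k S : Type*} [Field k] [Ring S] [Algebra k S] {X Y : Type*}
    [AddCommGroup X] [Module k X] [Module S X] [IsScalarTower k S X]
    [AddCommGroup Y] [Module k Y] [Module S Y] [IsScalarTower k S Y]
    (C : Submodule S X) (K : Submodule S Y) (w : HomBimodule k S X Y) (hw : ∀ x ∈ C, w x ∈ K) :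
    ∃ (w₁ : HomBimodule k S X K) (w₂ : HomBimodule k S (X ⧸ C) Y),
      w = map LinearMap.id K.subtype w₁ + map C.mkQ LinearMap.id w₂ := by
  obtain ⟨p, hp⟩ := LinearMap.exists_leftInverse_of_injective
    (C.subtype.restrictScalars k) (LinearMap.ker_eq_bot.2 (Submodule.subtype_injective _))
  have hp' : ∀ x : C, p x.1 = x := fun x => LinearMap.congr_fun hp x
  let w₁ : X →ₗ[k] K :=
    { toFun := fun x => ⟨w (p x).1, hw _ (p x).2⟩
      map_add' := fun x y => Subtype.ext
        ((congrArg (fun z : C => w z.1) (map_add p x y)).trans (map_add w _ _))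
      map_smul' := fun c x => Subtype.ext
        ((congrArg (fun z : C => w z.1) (map_smul p c x)).trans (map_smul w c _)) }
  let w₂' : X →ₗ[k] Y :=
    { toFun := fun x => w x - w (p x).1
      map_add' := fun x y => by
        rw [map_add, map_add, C.coe_add, map_add]
        abel
      map_smul' := fun c x => by
        rw [map_smul, map_smul, RingHom.id_apply, smul_sub]
        exact congrArg _ (map_smul w c _) }
  obtain ⟨q, hq⟩ : ∃ q : X →ₗ[k] X ⧸ C, ∀ x, q x = C.mkQ x :=
    ⟨C.mkQ.restrictScalars k, fun _ => rfl⟩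
  have hqs : Function.Surjective q := fun y => by
    obtain ⟨x, hx⟩ := C.mkQ_surjective y
    exact ⟨x, (hq x).trans hx⟩
  obtain ⟨w₂, hw₂⟩ := LinearMap.exists_comp_eq_of_ker_le q hqs w₂' (fun x hx => by
    have hxC : x ∈ C := by
      rwa [hq, Submodule.mkQ_apply, Submodule.Quotient.mk_eq_zero] at hx
    change w x - w (p x).1 = 0
    rw [hp' ⟨x, hxC⟩, sub_self])
  refine ⟨of w₁, of w₂, ext fun x => ?_⟩
  change w x = w (p x).1 + w₂ (C.mkQ x)
  rw [← hq]
  exact (eq_add_of_sub_eq' (hw₂ x).symm)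

namespace HighestWeightSystem

section OneSided

variable {A : Type u} [Ring A] {Λ : Type*} [PartialOrder Λ] {L : Λ → Type*} {P I : Λ → Type u}
  [∀ i, AddCommGroup (L i)] [∀ i, Module A (L i)] [∀ i, AddCommGroup (P i)]
  [∀ i, Module A (P i)] [∀ i, AddCommGroup (I i)] [∀ i, Module A (I i)]
  {f : ∀ i, P i →ₗ[A] L i} {ι : ∀ i, L i →ₗ[A] I i} {K : ∀ i, Submodule A (P i)}
  {C : ∀ i, Submodule A (I i)}

/-- The kernel of `P(i) → Δ(i)` is generated by the images of the `P(l)` with `l > i`. -/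
theorem relations_eq_top [IsArtinianRing A] (h : HighestWeightSystem f ι K C) {i : Λ}
    (R : Submodule A (K i)) (hR : ∀ l, i < l → ∀ t : P l →ₗ[A] K i, LinearMap.range t ≤ R) :
    R = ⊤ := by
  have := h.finite_cover i
  refine (eq_top_or_exists_le_coatom R).resolve_right ?_
  rintro ⟨m, hm, hRm⟩
  have := isSimpleModule_iff_isCoatom.2 hm
  obtain ⟨l, ⟨e⟩⟩ := h.exists_equiv (X := K i ⧸ m)
  have hq : Function.Surjective (e.toLinearMap ∘ₗ m.mkQ) :=
    e.surjective.comp (Submodule.mkQ_surjective m)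
  have hl : i < l := by
    by_contra hil
    have h0 := h.hom_relations_simple_eq_zero hil (e.toLinearMap ∘ₗ m.mkQ)
    have := h.simple l
    have := IsSimpleModule.nontrivial A (L l)
    rw [h0] at hq
    obtain ⟨y, hy⟩ := exists_ne (0 : L l)
    obtain ⟨x, rfl⟩ := hq y
    exact hy rfl
  have := (h.cover l).projective
  obtain ⟨t, ht⟩ := Module.projective_lifting_property m.mkQ (e.symm.toLinearMap ∘ₗ f l)
    (Submodule.mkQ_surjective m)
  refine hm.1 (eq_top_iff.2 fun x _ => ?_)
  obtain ⟨p, hp⟩ := (h.cover l).surjective (e (m.mkQ x))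
  have h1 : m.mkQ (t p) = m.mkQ x := by
    rw [← LinearMap.comp_apply, ht, LinearMap.comp_apply, hp]
    exact e.symm_apply_apply _
  have h2 : t p ∈ m := hRm (hR l hl t ⟨p, rfl⟩)
  rw [← Submodule.Quotient.mk_eq_zero, ← Submodule.mkQ_apply, ← h1, Submodule.mkQ_apply,
    Submodule.Quotient.mk_eq_zero]
  exact h2

/-- The quotient `I(j) / ∇(j)` is cogenerated by the `I(l)` with `l > j`. -/
theorem eq_zero_of_hull_quotient [IsArtinianRing A] (h : HighestWeightSystem f ι K C) {j : Λ}
    (x : I j ⧸ C j) (hx : ∀ l, j < l → ∀ t : (I j ⧸ C j) →ₗ[A] I l, t x = 0) : x = 0 := by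
  by_contra hx0
  have := h.finite j
  have : Nontrivial (Submodule.span A {x}) := by
    rw [Submodule.nontrivial_iff_ne_bot, Ne, Submodule.span_singleton_eq_bot]
    exact hx0
  obtain ⟨l, φ, hφ⟩ := h.exists_injective (X := Submodule.span A {x})
  have := h.simple l
  have := IsSimpleModule.nontrivial A (L l)
  obtain ⟨y, hy⟩ := exists_ne (0 : L l)
  let φ' := (Submodule.span A {x}).subtype ∘ₗ φ
  have hφ' : Function.Injective φ' := (Submodule.subtype_injective _).comp hφ
  have hl : j < l := by
    by_contra hjl
    have h0 := h.hom_hull_quotient_eq_zero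
      ((belongsTo_simple h.simple h.non_isomorphic l).mono fun m hm => by
        rw [Set.mem_singleton_iff.1 hm]; exact hjl) φ'
    exact hy (hφ' (by rw [h0]; rfl))
  obtain ⟨t, ht⟩ := (h.hull l).exists_extend φ' hφ' (ι l)
  obtain ⟨a, ha⟩ := Submodule.mem_span_singleton.1 (φ y).2
  refine hy ((h.hull l).injective ?_)
  rw [map_zero, ← ht, show φ' y = a • x from ha.symm, map_smul, hx l hl, smul_zero]

end OneSided

variable {k S : Type u} [Field k] [Ring S] [Algebra k S] [FiniteDimensional k S]
  {Λ : Type*} [PartialOrder Λ] {L : Λ → Type*} {P I : Λ → Type u}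
  [∀ i, AddCommGroup (L i)] [∀ i, Module k (L i)] [∀ i, Module S (L i)]
  [∀ i, IsScalarTower k S (L i)]
  [∀ i, AddCommGroup (P i)] [∀ i, Module k (P i)] [∀ i, Module S (P i)]
  [∀ i, IsScalarTower k S (P i)]
  [∀ i, AddCommGroup (I i)] [∀ i, Module k (I i)] [∀ i, Module S (I i)]
  [∀ i, IsScalarTower k S (I i)]
  [∀ i, FiniteDimensional k (L i)] [∀ i, FiniteDimensional k (P i)]
  [∀ i, FiniteDimensional k (I i)]
  {f : ∀ i, P i →ₗ[S] L i} {ι : ∀ i, L i →ₗ[S] I i} {K : ∀ i, Submodule S (P i)}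
  {C : ∀ i, Submodule S (I i)}

theorem isSimpleModule_outerTensorDual (h : HighestWeightSystem f ι K C)
    (hsplit : ∀ (i : Λ) (g : L i →ₗ[S] L i), ∃ c : k, ∀ x, g x = c • x) (i j : Λ) :
    IsSimpleModule (S ⊗[k] Sᵐᵒᵖ) (OuterTensorDual k S (L i) (L j)) := by
  have := h.simple i
  have := h.simple j
  obtain ⟨e⟩ := nonempty_outerTensorDual_equiv (k := k) (S := S) (L := L i) (L' := L j)
  have := HomBimodule.isSimpleModule (hsplit j) (hsplit i)
  exact IsSimpleModule.congr e

theorem exists_isProjectiveCover (h : HighestWeightSystem f ι K C) (i j : Λ) :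
    ∃ F : HomBimodule k S (I j) (P i) →ₗ[S ⊗[k] Sᵐᵒᵖ] OuterTensorDual k S (L i) (L j),
      IsProjectiveCover F ∧
        LinearMap.ker F = LinearMap.ker (HomBimodule.map (k := k) (ι j) (f i)) := by
  have := h.simple i
  have := h.simple j
  obtain ⟨e⟩ := nonempty_outerTensorDual_equiv (k := k) (S := S) (L := L i) (L' := L j)
  exact ⟨_, HomBimodule.isProjectiveCover (h.cover i) (h.hull j) e.symm, LinearEquiv.ker_comp _ _⟩

/-- The weights of the kernel of `Hom_k(∇(j), Δ(i)) → Hom_k(L(j), L(i))` are less than `(i, j)`. -/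
theorem lt_of_hom_cover [IsArtinianRing S] (h : HighestWeightSystem f ι K C) {i j a b : Λ}
    {d : (P i ⧸ K i) →ₗ[S] L i} (hdb : BelongsTo S L (Set.Iio i) (LinearMap.ker d))
    {s : L j →ₗ[S] C j} (hsb : BelongsTo S L (Set.Iio j) (C j ⧸ LinearMap.range s))
    (θ : HomBimodule k S (I b) (P a) →ₗ[S ⊗[k] Sᵐᵒᵖ] HomBimodule k S (C j) (P i ⧸ K i))
    (hθ : θ ≠ 0) (hθd : ∀ φ x, d (θ φ (s x)) = 0) : (a, b) < (i, j) := by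
  have := h.simple a
  have := h.simple b
  have hai : a ≤ i := by
    by_contra hai
    refine hθ (LinearMap.ext fun φ => HomBimodule.ext fun x => ?_)
    refine HomBimodule.eq_zero_of_left θ x (fun t _ => ?_) φ
    by_contra ht
    exact hai ((h.isStandard i).belongsTo h.simple h.non_isomorphic a
      ((h.cover a).isCompositionFactor ht))
  have hbj : b ≤ j := by
    by_contra hbj
    refine hθ (HomBimodule.eq_zero_of_right θ fun t _ => ?_)
    by_contra ht
    exact hbj ((h.isCostandard j).belongsTo h.simple h.non_isomorphic b
      ((h.hull b).isCompositionFactor ht))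
  refine lt_of_le_of_ne ⟨hai, hbj⟩ fun heq => ?_
  obtain ⟨rfl, rfl⟩ := Prod.mk.inj heq
  -- The values of `θ` vanish on the socle, as `L(i)` is not a composition factor of `ker d`.
  have h1 : ∀ φ x, θ φ (s x) = 0 := fun φ x => by
    refine HomBimodule.eq_zero_of_left θ (s x) (fun t ht => ?_) φ
    have htd : ∀ y, t y ∈ LinearMap.ker d := fun y => by
      obtain ⟨φ, hφ⟩ := ht y
      rw [LinearMap.mem_ker, hφ]
      exact hθd φ x
    by_contra ht0
    have : t.codRestrict _ htd ≠ 0 := fun h0 => ht0 (LinearMap.ext fun y =>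
      congrArg Subtype.val (LinearMap.congr_fun h0 y))
    exact lt_irrefl _ (hdb _ ((h.cover a).isCompositionFactor this))
  refine hθ (HomBimodule.eq_zero_of_right θ fun t ht => ?_)
  obtain ⟨g, hg⟩ := LinearMap.exists_comp_eq_of_ker_le (LinearMap.range s).mkQ
    (Submodule.mkQ_surjective _) t (fun x hx => by
      rw [Submodule.mkQ_apply, Submodule.Quotient.mk_eq_zero] at hx
      obtain ⟨y, rfl⟩ := hx
      exact ht _ fun φ => h1 φ y)
  by_contra ht0
  have hg0 : g ≠ 0 := fun h0 => ht0 (LinearMap.ext fun x => by rw [← hg, h0]; rfl)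
  exact lt_irrefl _ (hsb _ ((h.hull b).isCompositionFactor hg0))

/-- The bimodule `Hom_k(∇(j), Δ(i))` is the standard bimodule with label `(i, j)`. -/
theorem isStandard_homBimodule [IsArtinianRing S] (h : HighestWeightSystem f ι K C)
    (hsplit : ∀ (i : Λ) (g : L i →ₗ[S] L i), ∃ c : k, ∀ x, g x = c • x) (i j : Λ) :
    IsStandard (S ⊗[k] Sᵐᵒᵖ) (fun p : Λ × Λ => OuterTensorDual k S (L p.1) (L p.2)) (i, j)
      (HomBimodule k S (C j) (P i ⧸ K i)) := by
  obtain ⟨F, hF, hFk⟩ := h.exists_isProjectiveCover (k := k) i j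
  obtain ⟨d, hdf, hd, hdb, -⟩ := h.exists_head i
  obtain ⟨s, hsι, hs, hsb, -⟩ := h.exists_socle j
  let G : HomBimodule k S (I j) (P i) →ₗ[S ⊗[k] Sᵐᵒᵖ] HomBimodule k S (C j) (P i ⧸ K i) :=
    HomBimodule.map (C j).subtype (K i).mkQ
  have hmemF : ∀ {φ}, φ ∈ LinearMap.ker F ↔ ∀ x, f i (φ (ι j x)) = 0 := fun {φ} => by
    rw [hFk, LinearMap.mem_ker]
    exact ⟨fun h0 x => congrArg (fun ψ : HomBimodule k S (L j) (L i) => ψ x) h0,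
      fun h0 => HomBimodule.ext h0⟩
  have hG : Function.Surjective G :=
    HomBimodule.map_surjective (Submodule.subtype_injective _) (Submodule.mkQ_surjective _)
  have hGd : ∀ φ x, d (G φ (s x)) = f i (φ (ι j x)) := fun φ x => by
    change d ((K i).mkQ (φ (s x).1)) = _
    rw [hdf, hsι]
  have hle : LinearMap.ker G ≤ LinearMap.ker F := fun φ hφ => hmemF.2 fun x => by
    rw [← hGd, LinearMap.mem_ker.1 hφ, HomBimodule.zero_apply, map_zero]
  refine ⟨HomBimodule k S (I j) (P i), _, _, F, G, hF, hG, ⟨hle, ?_⟩, ?_⟩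
  · -- The quotient `ker F / ker G` embeds in `Hom_k(∇(j), Δ(i))`.
    rintro ⟨a, b⟩ hab
    obtain ⟨F', hF', -⟩ := h.exists_isProjectiveCover (k := k) a b
    have := h.isSimpleModule_outerTensorDual hsplit a b
    obtain ⟨θ, hθ, hθG⟩ := hF'.exists_hom_of_section F G hab
    refine h.lt_of_hom_cover hdb hsb θ hθ fun w x => ?_
    obtain ⟨φ, hφ, hw⟩ := hθG w
    rw [hw, hGd]
    exact hmemF.1 hφ x
  · rintro K' ⟨hK'F, hK'⟩ w hw
    -- A map to `ker F` from a projective cover whose label is not below `(i, j)` lands in `K'`.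
    have hzero : ∀ {a b : Λ}, ¬ (a, b) < (i, j) → ∀ θ : HomBimodule k S (I b) (P a)
        →ₗ[S ⊗[k] Sᵐᵒᵖ] HomBimodule k S (I j) (P i), (∀ p, θ p ∈ LinearMap.ker F) →
        ∀ p, θ p ∈ K' := by
      intro a b hab θ hθ
      obtain ⟨F', hF', -⟩ := h.exists_isProjectiveCover (k := k) a b
      have := h.isSimpleModule_outerTensorDual hsplit a b
      exact hF'.apply_mem (fun hc => hab (hK' (a, b) hc)) θ hθ
    -- Maps with values in the kernel of `P(i) → Δ(i)` lie in `K'`.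
    have hleft : ∀ φ : HomBimodule k S (I j) (K i),
        HomBimodule.map (k := k) LinearMap.id (K i).subtype φ ∈ K' := by
      let Θ := HomBimodule.map (k := k) (S := S) (LinearMap.id : I j →ₗ[S] I j) (K i).subtype
      have hmem : ∀ φ, Θ φ ∈ LinearMap.ker F :=
        fun φ => hmemF.2 fun x => (h.least i).1.1 (φ (ι j x)).2
      refine HomBimodule.induction_rankOne (p := fun φ => Θ φ ∈ K') ?_ (fun φ ψ hφ hψ => ?_)
        fun α y => ?_
      · rw [map_zero]
        exact K'.zero_mem
      · rw [map_add]
        exact K'.add_mem hφ hψ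
      let R : Submodule S (K i) :=
        { carrier := {y | Θ (HomBimodule.rankOne α y) ∈ K'}
          zero_mem' := by
            change Θ _ ∈ K'
            rw [HomBimodule.rankOne_zero, map_zero]
            exact K'.zero_mem
          add_mem' := fun {y y'} hy hy' => by
            change Θ _ ∈ K'
            rw [HomBimodule.rankOne_add, map_add]
            exact K'.add_mem hy hy'
          smul_mem' := fun r y hy => by
            change Θ _ ∈ K'
            rw [HomBimodule.rankOne_smul, smul_eq_tmul_one_smul (k := k), map_smul]
            exact K'.smul_mem _ hy }
      have hR : R = ⊤ := by
        refine h.relations_eq_top R fun l hl t => ?_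
        rintro _ ⟨p, rfl⟩
        have h0 := hzero (a := l) (b := j) (fun hlt => not_lt_of_ge hlt.le.1 hl)
          (Θ ∘ₗ HomBimodule.map LinearMap.id t) (fun p => hmem _) (HomBimodule.rankOne α p)
        have h1 : HomBimodule.map (k := k) LinearMap.id t (HomBimodule.rankOne α p) =
            HomBimodule.rankOne α (t p) :=
          HomBimodule.ext fun x => map_smul (t.restrictScalars k) _ _
        rwa [LinearMap.comp_apply, h1] at h0
      have : y ∈ R := by rw [hR]; trivial
      exact this
    -- Maps vanishing on `∇(j)` lie in `K'`.
    have hright : ∀ φ : HomBimodule k S (I j ⧸ C j) (P i),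
        HomBimodule.map (k := k) (C j).mkQ LinearMap.id φ ∈ K' := by
      have hιC : ∀ x, (C j).mkQ (ι j x) = 0 := fun x => by
        rw [Submodule.mkQ_apply, Submodule.Quotient.mk_eq_zero, ← hsι]
        exact (s x).2
      let Θ := HomBimodule.map (k := k) (S := S) (C j).mkQ (LinearMap.id : P i →ₗ[S] P i)
      have hmem : ∀ φ, Θ φ ∈ LinearMap.ker F := fun φ => hmemF.2 fun x => by
        change f i (φ ((C j).mkQ (ι j x))) = 0
        rw [hιC, map_zero, map_zero]
      refine HomBimodule.induction_rankOne (p := fun φ => Θ φ ∈ K') ?_ (fun φ ψ hφ hψ => ?_)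
        fun α y => ?_
      · rw [map_zero]
        exact K'.zero_mem
      · rw [map_add]
        exact K'.add_mem hφ hψ
      let R : Submodule k (Module.Dual k (I j ⧸ C j)) :=
        { carrier := {α | Θ (HomBimodule.rankOne α y) ∈ K'}
          zero_mem' := by
            change Θ _ ∈ K'
            rw [show (HomBimodule.rankOne 0 y : HomBimodule k S (I j ⧸ C j) (P i)) = 0 from
              HomBimodule.ext fun x => zero_smul k y, map_zero]
            exact K'.zero_mem
          add_mem' := fun {α α'} hα hα' => by
            change Θ _ ∈ K'
            rw [HomBimodule.add_rankOne, map_add]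
            exact K'.add_mem hα hα'
          smul_mem' := fun c α hα => by
            change Θ _ ∈ K'
            rw [HomBimodule.smul_rankOne,
              ← one_smul (S ⊗[k] Sᵐᵒᵖ) (HomBimodule.rankOne α y), ← smul_assoc, map_smul]
            exact K'.smul_mem _ hα }
      have hRt : ∀ l, j < l → ∀ (t : (I j ⧸ C j) →ₗ[S] I l) (α : Module.Dual k (I l)),
          α ∘ₗ t.restrictScalars k ∈ R := fun l hl t α =>
        hzero (a := i) (b := l) (fun hlt => not_lt_of_ge hlt.le.2 hl)
          (Θ ∘ₗ HomBimodule.map t LinearMap.id) (fun p => hmem _) (HomBimodule.rankOne α y)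
      have hR : R = ⊤ := by
        by_contra hne
        obtain ⟨ev, hev, hRev⟩ := Submodule.exists_le_ker_of_lt_top R (lt_top_iff_ne_top.2 hne)
        let x := (Module.evalEquiv k (I j ⧸ C j)).symm ev
        have hx : ∀ α : Module.Dual k (I j ⧸ C j), α x = ev α := fun α =>
          Module.apply_evalEquiv_symm_apply k _ α ev
        have hx0 : x = 0 := h.eq_zero_of_hull_quotient x fun l hl t => by
          rw [← Module.forall_dual_apply_eq_zero_iff k]
          exact fun α => (hx _).trans (hRev (hRt l hl t α))
        refine hev (LinearMap.ext fun α => ?_)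
        rw [← hx, hx0, map_zero, LinearMap.zero_apply]
      have : α ∈ R := by rw [hR]; trivial
      exact this
    -- Every element of `ker G` is a sum of two such maps.
    obtain ⟨w₁, w₂, hsum⟩ := HomBimodule.exists_eq_add (C j) (K i) w fun x hx => by
      rw [← Submodule.Quotient.mk_eq_zero]
      exact congrArg (fun ψ : HomBimodule k S (C j) (P i ⧸ K i) => ψ ⟨x, hx⟩) hw
    rw [hsum]
    exact K'.add_mem (hleft w₁) (hright w₂)

end HighestWeightSystem

universe w

/-! ### Homomorphisms of left modules out of a bimodule -/

/-- For an `S`-bimodule `B` and a left `S`-module `X`, the left `S`-module `Hom_S(B, X)` of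
homomorphisms of left modules, with `(s h) b = h (b s)`. -/
def LeftHom (_k S B X : Type*) [Ring S] [AddCommGroup B] [Module S B] [AddCommGroup X]
    [Module S X] : Type _ :=
  B →ₗ[S] X

namespace LeftHom

section Instances

variable (k S B X : Type*) [Ring S] [AddCommGroup B] [Module S B] [AddCommGroup X] [Module S X]

instance : AddCommGroup (LeftHom k S B X) :=
  inferInstanceAs (AddCommGroup (B →ₗ[S] X))

instance : FunLike (LeftHom k S B X) B X := inferInstanceAs (FunLike (B →ₗ[S] X) B X)

instance : LinearMapClass (LeftHom k S B X) S B X :=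
  inferInstanceAs (LinearMapClass (B →ₗ[S] X) S B X)

end Instances

variable {k S B X : Type*} [Ring S] [AddCommGroup B] [Module S B] [AddCommGroup X] [Module S X]

theorem ext {h h' : LeftHom k S B X} (H : ∀ b, h b = h' b) : h = h' :=
  LinearMap.ext H

/-- A homomorphism regarded as an element of the module `Hom_S(B, X)`. -/
def of (h : B →ₗ[S] X) : LeftHom k S B X :=
  h

@[simp]
theorem of_apply (h : B →ₗ[S] X) (b : B) : (of h : LeftHom k S B X) b = h b :=
  rfl

/-- The homomorphism underlying an element of `Hom_S(B, X)`. -/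
def toLinearMap (h : LeftHom k S B X) : B →ₗ[S] X :=
  h

@[simp]
theorem toLinearMap_apply (h : LeftHom k S B X) (b : B) : h.toLinearMap b = h b :=
  rfl

@[simp]
theorem add_apply (h h' : LeftHom k S B X) (b : B) : (h + h') b = h b + h' b :=
  rfl

@[simp]
theorem zero_apply (b : B) : (0 : LeftHom k S B X) b = 0 :=
  rfl

variable [Field k] [Algebra k S] [Module (S ⊗[k] Sᵐᵒᵖ) B] [IsScalarTower S (S ⊗[k] Sᵐᵒᵖ) B]

theorem _root_.one_tmul_smul_comm (s t : S) (b : B) :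
    ((1 : S) ⊗ₜ[k] MulOpposite.op t : S ⊗[k] Sᵐᵒᵖ) • s • b =
      s • ((1 : S) ⊗ₜ[k] MulOpposite.op t : S ⊗[k] Sᵐᵒᵖ) • b := by
  rw [smul_eq_tmul_one_smul (k := k) s b, smul_eq_tmul_one_smul (k := k) s, ← mul_smul,
    ← mul_smul, Algebra.TensorProduct.tmul_mul_tmul, Algebra.TensorProduct.tmul_mul_tmul]
  simp

theorem _root_.tmul_smul_eq (s t : S) (b : B) :
    (s ⊗ₜ[k] MulOpposite.op t : S ⊗[k] Sᵐᵒᵖ) • b =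
      s • ((1 : S) ⊗ₜ[k] MulOpposite.op t : S ⊗[k] Sᵐᵒᵖ) • b := by
  rw [smul_eq_tmul_one_smul (k := k) s, ← mul_smul, Algebra.TensorProduct.tmul_mul_tmul]
  simp

instance : SMul S (LeftHom k S B X) where
  smul t h :=
    { toFun := fun b => h (((1 : S) ⊗ₜ[k] MulOpposite.op t : S ⊗[k] Sᵐᵒᵖ) • b)
      map_add' := fun b b' => by rw [smul_add, map_add]
      map_smul' := fun s b => by rw [one_tmul_smul_comm, map_smul, RingHom.id_apply] }

theorem smul_apply (t : S) (h : LeftHom k S B X) (b : B) :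
    (t • h) b = h (((1 : S) ⊗ₜ[k] MulOpposite.op t : S ⊗[k] Sᵐᵒᵖ) • b) :=
  rfl

instance : Module S (LeftHom k S B X) where
  one_smul h := ext fun b => by
    rw [smul_apply, MulOpposite.op_one, ← Algebra.TensorProduct.one_def, one_smul]
  mul_smul s t h := ext fun b => by
    rw [smul_apply, smul_apply, smul_apply, ← mul_smul, Algebra.TensorProduct.tmul_mul_tmul,
      MulOpposite.op_mul, one_mul]
  smul_zero s := ext fun _ => rfl
  smul_add s h h' := ext fun _ => rfl
  add_smul s t h := ext fun b => by
    rw [smul_apply, MulOpposite.op_add, TensorProduct.tmul_add, add_smul, map_add]; rfl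
  zero_smul h := ext fun b => by
    rw [smul_apply, MulOpposite.op_zero, TensorProduct.tmul_zero,
      show (0 : S ⊗[k] Sᵐᵒᵖ) • b = 0 from zero_smul (S ⊗[k] Sᵐᵒᵖ) b, map_zero]; rfl

instance : Module k (LeftHom k S B X) :=
  Module.compHom _ (algebraMap k S)

instance : IsScalarTower k S (LeftHom k S B X) :=
  IsScalarTower.of_algebraMap_smul fun _ _ => rfl

section Functoriality

variable {X' B' : Type*} [AddCommGroup X'] [Module S X'] [AddCommGroup B'] [Module S B']
  [Module (S ⊗[k] Sᵐᵒᵖ) B'] [IsScalarTower S (S ⊗[k] Sᵐᵒᵖ) B']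

/-- The homomorphism `h ↦ c ∘ h ∘ a` from `Hom_S(B, X)` to `Hom_S(B', X')`. -/
def map (a : B' →ₗ[S ⊗[k] Sᵐᵒᵖ] B) (c : X →ₗ[S] X') :
    LeftHom k S B X →ₗ[S] LeftHom k S B' X' where
  toFun h := of
    { toFun := fun b => c (h (a b))
      map_add' := fun b b' => by rw [map_add, map_add, map_add]
      map_smul' := fun s b => by
        rw [smul_eq_tmul_one_smul (k := k), map_smul, ← smul_eq_tmul_one_smul, map_smul, map_smul,
          RingHom.id_apply] }
  map_add' h h' := ext fun b => map_add c _ _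
  map_smul' t h := ext fun b => by
    change c ((t • h) (a b)) = c (h (a (_ • b)))
    rw [map_smul, smul_apply, RingHom.id_apply]

end Functoriality

variable [Module k X] [IsScalarTower k S X]

theorem smul_apply' (c : k) (h : LeftHom k S B X) (b : B) : (c • h) b = c • h b := by
  change (algebraMap k S c • h) b = _
  have h1 : ((1 : S) ⊗ₜ[k] MulOpposite.op (algebraMap k S c) : S ⊗[k] Sᵐᵒᵖ) =
      (algebraMap k S c) ⊗ₜ[k] 1 := by
    rw [Algebra.algebraMap_eq_smul_one, MulOpposite.op_smul, MulOpposite.op_one,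
      TensorProduct.tmul_smul, TensorProduct.smul_tmul']
  rw [smul_apply, h1, ← smul_eq_tmul_one_smul, map_smul, algebraMap_smul]

instance [Module k B] [IsScalarTower k S B] [FiniteDimensional k B] [FiniteDimensional k X] :
    FiniteDimensional k (LeftHom k S B X) :=
  FiniteDimensional.of_injective (V₂ := B →ₗ[k] X)
    { toFun := fun h => h.toLinearMap.restrictScalars k
      map_add' := fun _ _ => rfl
      map_smul' := fun c h => LinearMap.ext fun b => smul_apply' c h b }
    fun _ _ H => ext fun b => LinearMap.congr_fun H b

/-- The bimodule homomorphism `b ↦ (h ↦ h b)` from `B` to `Hom_k(Hom_S(B, X), X)`. -/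
noncomputable def coev (k S B X : Type*) [Field k] [Ring S] [Algebra k S]
    [AddCommGroup B] [Module S B] [AddCommGroup X] [Module S X]
    [Module (S ⊗[k] Sᵐᵒᵖ) B] [IsScalarTower S (S ⊗[k] Sᵐᵒᵖ) B]
    [Module k X] [IsScalarTower k S X] :
    B →ₗ[S ⊗[k] Sᵐᵒᵖ] HomBimodule k S (LeftHom k S B X) X :=
  bimoduleHomOfTmul
    { toFun := fun b => HomBimodule.of
        { toFun := fun h => h b
          map_add' := fun _ _ => rfl
          map_smul' := fun c h => smul_apply' c h b }
      map_zero' := HomBimodule.ext fun h => map_zero h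
      map_add' := fun b b' => HomBimodule.ext fun h => map_add h b b' }
    (fun s t b => HomBimodule.ext fun h => by
      rw [HomBimodule.tmul_smul_apply]
      change h (_ • b) = s • (t • h) b
      rw [tmul_smul_eq, map_smul, smul_apply])

end LeftHom

/-! ### Exact sequences of bimodules -/

/-- The kernel of a module homomorphism, with the restricted scalar actions. -/
theorem LinearMap.exists_kernel {R S A : Type*} [Semiring R] [Semiring S] [Ring A] [SMul R S]
    [SMul R A] [SMul S A] {X : Type w} {Z : Type*} [AddCommGroup X] [Module R X] [Module S X]
    [Module A X] [IsScalarTower R S X] [IsScalarTower R A X] [IsScalarTower S A X]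
    [AddCommGroup Z] [Module A Z] (q : X →ₗ[A] Z) :
    ∃ (X' : Type w) (_ : AddCommGroup X') (_ : Module R X') (_ : Module S X') (_ : Module A X')
      (_ : IsScalarTower R S X') (_ : IsScalarTower R A X') (_ : IsScalarTower S A X')
      (j : X' →ₗ[A] X), Function.Injective j ∧ ∀ x, q x = 0 ↔ ∃ x', j x' = x :=
  ⟨LinearMap.ker q, inferInstance, inferInstance, inferInstance, inferInstance,
    ⟨fun r s x => Subtype.ext (smul_assoc r s x.1)⟩, inferInstance, inferInstance,
    (LinearMap.ker q).subtype, Submodule.subtype_injective _,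
    fun x => ⟨fun hx => ⟨⟨x, hx⟩, rfl⟩, by rintro ⟨x', rfl⟩; exact x'.2⟩⟩

section ShortExact

variable {A : Type*} [Ring A] {X' X Z : Type*} [AddCommGroup X'] [Module A X'] [AddCommGroup X]
  [Module A X] [AddCommGroup Z] [Module A Z]

theorem exists_equiv_ker {j : X' →ₗ[A] X} (hj : Function.Injective j) {q : X →ₗ[A] Z}
    (hjq : ∀ x, q x = 0 ↔ ∃ x', j x' = x) :
    ∃ e : X' ≃ₗ[A] LinearMap.ker q, ∀ x, (e x).1 = j x := by
  have hr : LinearMap.range j = LinearMap.ker q := Submodule.ext fun x => (hjq x).symm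
  exact ⟨(LinearEquiv.ofInjective j hj).trans (LinearEquiv.ofEq _ _ hr), fun _ => rfl⟩

end ShortExact

theorem HasStandardFiltration.of_short_exact {A : Type u} [Ring A] {Λ : Type*} [PartialOrder Λ]
    {L : Λ → Type*} [∀ i, AddCommGroup (L i)] [∀ i, Module A (L i)] {X' X Z : Type*}
    [AddCommGroup X'] [Module A X'] [AddCommGroup X] [Module A X] [AddCommGroup Z] [Module A Z]
    {j : X' →ₗ[A] X} (hj : Function.Injective j) {q : X →ₗ[A] Z} (hq : Function.Surjective q)
    (hjq : ∀ x, q x = 0 ↔ ∃ x', j x' = x) (h₁ : HasStandardFiltration A L X')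
    (h₂ : HasStandardFiltration A L Z) : HasStandardFiltration A L X := by
  obtain ⟨e, -⟩ := exists_equiv_ker hj hjq
  exact .of_exact q hq (h₁.of_equiv e) h₂

/-- As a left module `Hom_k(V, X)` is a direct sum of copies of `X`. -/
theorem HomBimodule.nonempty_equiv_pi {k S V X : Type*} [Field k] [Ring S] [Algebra k S]
    [AddCommGroup V] [Module k V] [FiniteDimensional k V] [AddCommGroup X] [Module k X]
    [Module S X] [IsScalarTower k S X] :
    ∃ n, Nonempty (HomBimodule k S V X ≃ₗ[S] (Fin n → X)) := by
  let b := Module.finBasis k V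
  refine ⟨_, ⟨LinearEquiv.ofBijective
    { toFun := fun φ i => φ (b i), map_add' := fun _ _ => rfl, map_smul' := fun _ _ => rfl }
    ⟨fun φ ψ h => ?_, fun v => ?_⟩⟩⟩
  · exact b.ext fun i => congrFun h i
  · exact ⟨HomBimodule.of (b.constr k v), funext fun i => b.constr_basis k v i⟩

/-! ### Standard filtrations of bimodules -/

theorem LinearMap.finrank_lt_of_surjective {k V W : Type*} [Field k] [AddCommGroup V] [Module k V]
    [FiniteDimensional k V] [AddCommGroup W] [Module k W] (q : V →ₗ[k] W)
    (hq : Function.Surjective q) {x : V} (hx : x ≠ 0) (hqx : q x = 0) :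
    Module.finrank k W < Module.finrank k V := by
  have := Module.Finite.of_surjective q hq
  refine lt_of_le_of_ne (q.finrank_le_finrank_of_surjective hq) fun he => hx ?_
  exact (LinearMap.injective_iff_surjective_of_finrank_eq_finrank he.symm).2 hq
    (hqx.trans (map_zero q).symm)

theorem LinearMap.finrank_lt_of_injective {k V W : Type*} [Field k] [AddCommGroup V] [Module k V]
    [AddCommGroup W] [Module k W] [FiniteDimensional k W] (j : V →ₗ[k] W)
    (hj : Function.Injective j) {y : W} (hy : ∀ x, j x ≠ y) :
    Module.finrank k V < Module.finrank k W := by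
  have := Module.Finite.of_injective j hj
  refine lt_of_le_of_ne (LinearMap.finrank_le_finrank_of_injective hj) fun he => ?_
  obtain ⟨x, hx⟩ := (LinearMap.injective_iff_surjective_of_finrank_eq_finrank he).1 hj y
  exact hy x hx

namespace HighestWeightSystem

variable {k S : Type u} [Field k] [Ring S] [Algebra k S] [FiniteDimensional k S]
  {Λ : Type*} [Finite Λ] [PartialOrder Λ] {L : Λ → Type*} {P I : Λ → Type u}
  [∀ i, AddCommGroup (L i)] [∀ i, Module k (L i)] [∀ i, Module S (L i)]
  [∀ i, IsScalarTower k S (L i)]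
  [∀ i, AddCommGroup (P i)] [∀ i, Module k (P i)] [∀ i, Module S (P i)]
  [∀ i, IsScalarTower k S (P i)]
  [∀ i, AddCommGroup (I i)] [∀ i, Module k (I i)] [∀ i, Module S (I i)]
  [∀ i, IsScalarTower k S (I i)]
  [∀ i, FiniteDimensional k (L i)] [∀ i, FiniteDimensional k (P i)]
  [∀ i, FiniteDimensional k (I i)] [IsArtinianRing S]
  {f : ∀ i, P i →ₗ[S] L i} {ι : ∀ i, L i →ₗ[S] I i} {K : ∀ i, Submodule S (P i)}
  {C : ∀ i, Submodule S (I i)}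

/-- If `Ext¹(Δ(j), Y) = 0` for all `j`, then `Hom_k(Y, Δ(i))` has a standard filtration. -/
theorem hasStandardFiltration_homBimodule (h : HighestWeightSystem f ι K C)
    (hsplit : ∀ (i : Λ) (g : L i →ₗ[S] L i), ∃ c : k, ∀ x, g x = c • x) (i : Λ)
    {Y : Type w} [AddCommGroup Y] [Module k Y] [Module S Y] [IsScalarTower k S Y]
    [FiniteDimensional k Y] (hY : ∀ j, ExtOneVanishes S (P j ⧸ K j) Y) :
    HasStandardFiltration (S ⊗[k] Sᵐᵒᵖ) (fun p : Λ × Λ => OuterTensorDual k S (L p.1) (L p.2))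
      (HomBimodule k S Y (P i ⧸ K i)) := by
  rcases subsingleton_or_nontrivial Y with _ | _
  · have : Subsingleton (HomBimodule k S Y (P i ⧸ K i)) :=
      ⟨fun φ ψ => HomBimodule.ext fun x => by
        rw [Subsingleton.elim x 0, map_zero, map_zero]⟩
    exact .of_subsingleton
  have : Module.Finite S Y := Module.Finite.of_restrictScalars_finite k S Y
  obtain ⟨l, t, ht, hY'⟩ := h.exists_costandard_submodule hY
  obtain ⟨p, hp⟩ : ∃ p : Y →ₗ[k] Y ⧸ LinearMap.range t, ∀ y, p y = (LinearMap.range t).mkQ y :=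
    ⟨(LinearMap.range t).mkQ.restrictScalars k, fun _ => rfl⟩
  have hps : Function.Surjective p := fun y => by
    obtain ⟨x, hx⟩ := Submodule.mkQ_surjective _ y
    exact ⟨x, (hp x).trans hx⟩
  have hlt : Module.finrank k (Y ⧸ LinearMap.range t) < Module.finrank k Y := by
    obtain ⟨s, -, hs, -⟩ := h.exists_socle l
    have := h.simple l
    have := IsSimpleModule.nontrivial S (L l)
    obtain ⟨y, hy⟩ := exists_ne (0 : L l)
    refine LinearMap.finrank_lt_of_surjective p hps (x := t (s y))
      (fun h0 => hy (hs (ht ((h0.trans (map_zero t).symm).trans (congrArg t (map_zero s).symm)))))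
      ?_
    rw [hp, Submodule.mkQ_apply, Submodule.Quotient.mk_eq_zero]
    exact ⟨_, rfl⟩
  refine .of_short_exact
    (j := HomBimodule.map (k := k) (LinearMap.range t).mkQ (LinearMap.id : (P i ⧸ K i) →ₗ[S] _))
    (q := HomBimodule.map t LinearMap.id) ?_
    (HomBimodule.map_surjective ht fun x => ⟨x, rfl⟩) ?_
    (h.hasStandardFiltration_homBimodule hsplit i hY')
    (h.isStandard_homBimodule hsplit i l).hasStandardFiltration
  · refine fun φ ψ H => HomBimodule.ext fun y => ?_
    obtain ⟨y, rfl⟩ := Submodule.mkQ_surjective _ y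
    exact congrArg (fun χ : HomBimodule k S Y (P i ⧸ K i) => χ y) H
  · refine fun φ => ⟨fun hφ => ?_, ?_⟩
    · obtain ⟨g, hg⟩ := LinearMap.exists_comp_eq_of_ker_le p hps
        (show Y →ₗ[k] P i ⧸ K i from φ) (fun y hy => by
        rw [hp, Submodule.mkQ_apply, Submodule.Quotient.mk_eq_zero] at hy
        obtain ⟨c, rfl⟩ := hy
        exact congrArg (fun χ : HomBimodule k S (C l) (P i ⧸ K i) => χ c) hφ)
      refine ⟨HomBimodule.of g, HomBimodule.ext fun y => ?_⟩
      exact (congrArg g (hp y).symm).trans (hg y)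
    · rintro ⟨g, rfl⟩
      refine HomBimodule.ext fun c => ?_
      change g ((LinearMap.range t).mkQ (t c)) = 0
      rw [show (LinearMap.range t).mkQ (t c) = 0 by
        rw [Submodule.mkQ_apply, Submodule.Quotient.mk_eq_zero]; exact ⟨c, rfl⟩, map_zero]
termination_by Module.finrank k Y

/-- An `S`-bimodule `B` has a standard filtration if `Ext¹(B, ∇(ν)) = 0` and
`Ext¹(Δ(μ), Hom_S(B, ∇(ν))) = 0` for all `μ` and `ν`. -/
theorem hasStandardFiltration_of_ext (h : HighestWeightSystem f ι K C)
    (hsplit : ∀ (i : Λ) (g : L i →ₗ[S] L i), ∃ c : k, ∀ x, g x = c • x)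
    {B : Type w} [AddCommGroup B] [Module k B] [Module S B] [Module (S ⊗[k] Sᵐᵒᵖ) B]
    [IsScalarTower k S B] [IsScalarTower k (S ⊗[k] Sᵐᵒᵖ) B] [IsScalarTower S (S ⊗[k] Sᵐᵒᵖ) B]
    [FiniteDimensional k B] (hB : ∀ ν, ExtOneVanishes S B (C ν))
    (hH : ∀ μ ν, ExtOneVanishes S (P μ ⧸ K μ) (LeftHom k S B (C ν))) :
    HasStandardFiltration (S ⊗[k] Sᵐᵒᵖ) (fun p : Λ × Λ => OuterTensorDual k S (L p.1) (L p.2))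
      B := by
  rcases subsingleton_or_nontrivial B with _ | _
  · exact .of_subsingleton
  have : Module.Finite S B := Module.Finite.of_restrictScalars_finite k S B
  obtain ⟨i, d, s, hd, hs, hmax, ⟨φ₀, hφ₀⟩, hinj, hlift⟩ := h.exists_lift_standard hB
  have := h.simple i
  let H := LeftHom k S B (P i ⧸ K i)
  let q : B →ₗ[S ⊗[k] Sᵐᵒᵖ] HomBimodule k S H (P i ⧸ K i) := LeftHom.coev k S B (P i ⧸ K i)
  -- The short exact sequence of left modules.
  obtain ⟨qS, hqS⟩ : ∃ qS : B →ₗ[S] HomBimodule k S H (P i ⧸ K i), ∀ b, qS b = q b :=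
    ⟨q.restrictScalars S, fun _ => rfl⟩
  have hq : Function.Surjective q := by
    -- By density the composition with `Δ(i) → L(i)` is surjective.
    obtain ⟨T, hT⟩ : ∃ T : B →ₗ[S] HomBimodule k S H (L i), ∀ b v, T b v = d (v b) :=
      ⟨{ toFun := fun b => HomBimodule.of (d.restrictScalars k ∘ₗ
            (show H →ₗ[k] P i ⧸ K i from q b))
         map_add' := fun b b' => HomBimodule.ext fun v => by
          change d (v (b + b')) = d (v b) + d (v b')
          rw [map_add, map_add]
         map_smul' := fun c b => HomBimodule.ext fun v => by
          change d (v (c • b)) = c • d (v b)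
          rw [map_smul, map_smul] }, fun _ _ => rfl⟩
    have hTs := HomBimodule.surjective_of_split (hsplit i) T fun v hv =>
      LeftHom.ext fun b => LinearMap.congr_fun (hinj v.toLinearMap fun x => by
        rw [← hv x, hT]; rfl) b
    have htop := HomBimodule.eq_top_of_superfluous (LinearMap.ker d)
      (fun h0 => by
        have := IsSimpleModule.nontrivial S (L i)
        obtain ⟨y, hy⟩ := exists_ne (0 : L i)
        obtain ⟨x, rfl⟩ := hd y
        exact hy (LinearMap.mem_ker.1 (by rw [h0]; trivial)))
      hmax (LinearMap.range qS) fun φ => by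
        obtain ⟨b, hb⟩ := hTs (HomBimodule.of (d.restrictScalars k ∘ₗ
          (show H →ₗ[k] P i ⧸ K i from φ)))
        refine ⟨_, ⟨b, rfl⟩, fun v => ?_⟩
        rw [LinearMap.mem_ker, map_sub, sub_eq_zero, hqS]
        exact (congrArg (fun χ : HomBimodule k S H (L i) => χ v) hb).symm.trans (hT b v)
    intro φ
    obtain ⟨b, hb⟩ : φ ∈ LinearMap.range qS := by rw [htop]; trivial
    exact ⟨b, (hqS b).symm.trans hb⟩
  -- `H` is isomorphic to `Hom_S(B, ∇(i))`.
  have hHE : ∀ j, ExtOneVanishes S (P j ⧸ K j) H := fun j => by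
    refine (hH j i).of_equiv_right (LinearEquiv.ofBijective
      (LeftHom.map (LinearMap.id : B →ₗ[S ⊗[k] Sᵐᵒᵖ] B) (s ∘ₗ d)) ⟨?_, fun φ => ?_⟩).symm
    · refine (injective_iff_map_eq_zero _).2 fun v hv => LeftHom.ext fun b =>
        LinearMap.congr_fun (hinj v.toLinearMap fun x => hs ?_) b
      rw [map_zero]
      exact congrArg (fun χ : LeftHom k S B (C i) => χ x) hv
    · obtain ⟨ψ, hψ⟩ := hlift φ.toLinearMap
      exact ⟨LeftHom.of ψ, LeftHom.ext hψ⟩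
  obtain ⟨B', _, _, _, _, _, _, _, j, hj, hjq⟩ := LinearMap.exists_kernel (R := k) (S := S) q
  obtain ⟨jS, hjS⟩ : ∃ jS : B' →ₗ[S] B, ∀ b, jS b = j b :=
    ⟨j.restrictScalars S, fun _ => rfl⟩
  obtain ⟨jk, hjk⟩ : ∃ jk : B' →ₗ[k] B, ∀ b, jk b = j b :=
    ⟨j.restrictScalars k, fun _ => rfl⟩
  have hjki : Function.Injective jk := fun x y hxy => hj (by rw [← hjk, hxy, hjk])
  have hjSi : Function.Injective jS := fun x y hxy => hj (by rw [← hjS, hxy, hjS])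
  have hfin : FiniteDimensional k B' := Module.Finite.of_injective jk hjki
  have hqz : ∀ b (ψ : B →ₗ[S] P i ⧸ K i), ψ (j b) = 0 := fun b ψ =>
    congrArg (fun χ : HomBimodule k S H (P i ⧸ K i) => χ (LeftHom.of ψ)) ((hjq (j b)).2 ⟨b, rfl⟩)
  have hlt : Module.finrank k B' < Module.finrank k B := by
    obtain ⟨ψ, hψ⟩ := hlift φ₀
    obtain ⟨b, hb⟩ : ∃ b, ψ b ≠ 0 := by
      by_contra! hc
      refine hφ₀ (LinearMap.ext fun b => ?_)
      rw [← hψ, hc, map_zero, map_zero, LinearMap.zero_apply]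
    exact LinearMap.finrank_lt_of_injective jk hjki (y := b) fun x hx =>
      hb (by rw [← hx, hjk, hqz])
  obtain ⟨e, he⟩ := exists_equiv_ker hjSi (q := qS) (fun b => by
    rw [hqS, hjq]
    exact exists_congr fun b' => by rw [hjS])
  obtain ⟨n, ⟨eπ⟩⟩ := HomBimodule.nonempty_equiv_pi (k := k) (S := S) (V := H) (X := P i ⧸ K i)
  have hqSs : Function.Surjective qS := fun φ => by
    obtain ⟨b, hb⟩ := hq φ
    exact ⟨b, (hqS b).trans hb⟩
  have hπ : ∀ ν, ExtOneVanishes S (HomBimodule k S H (P i ⧸ K i)) (C ν) := fun ν =>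
    (h.ext_standard_costandard (h.isStandard i) ν).pi_left.of_equiv_left eπ.symm
  -- Maps to costandard modules extend from `B'` to `B`.
  have hext : ∀ ν (φ : B' →ₗ[S] C ν), ∃ ψ : B →ₗ[S] C ν, ∀ b, ψ (j b) = φ b := fun ν φ => by
    obtain ⟨ψ, hψ⟩ := (hπ ν).extend qS hqSs (φ ∘ₗ e.symm.toLinearMap)
    refine ⟨ψ, fun b => ?_⟩
    rw [← hjS, ← he, hψ, LinearMap.comp_apply, LinearEquiv.coe_coe, e.symm_apply_apply]
  refine .of_short_exact hj hq hjq (h.hasStandardFiltration_of_ext hsplit (fun ν => ?_)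
    fun μ ν => ?_) (h.hasStandardFiltration_homBimodule hsplit i hHE)
  · exact (h.ext_ker qS hqSs (hB ν)
      ((h.ext_standard_hull_quotient i ν).pi_left.of_equiv_left eπ.symm)).of_equiv_left e.symm
  · by_cases hiν : i = ν
    · -- A map `B' → ∇(i)` extends to `B`, where it lifts to an element of `H`, and these vanish
      -- on `B' = ker q`.
      subst hiν
      have : Subsingleton (LeftHom k S B' (C i)) := by
        refine subsingleton_of_forall_eq 0 fun φ => LeftHom.ext fun b => ?_
        obtain ⟨φ', hφ'⟩ := hext i φ.toLinearMap
        obtain ⟨ψ, hψ⟩ := hlift φ'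
        rw [← LeftHom.toLinearMap_apply, ← hφ', ← hψ, hqz, map_zero, map_zero]
        rfl
      exact .of_subsingleton_right
    · -- Restriction is an isomorphism `Hom_S(B, ∇(ν)) ≅ Hom_S(B', ∇(ν))`.
      refine (hH μ ν).of_equiv_right (LinearEquiv.ofBijective
        (LeftHom.map j (LinearMap.id : C ν →ₗ[S] C ν)) ⟨?_, fun φ => ?_⟩)
      · refine (injective_iff_map_eq_zero _).2 fun φ hφ => LeftHom.ext fun b => ?_
        -- A map vanishing on `B'` factors through `Hom_k(H, Δ(i))`.
        obtain ⟨g, hg⟩ := LinearMap.exists_comp_eq_of_ker_le qS hqSs φ.toLinearMap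
          fun b hb => by
            rw [hqS, hjq] at hb
            obtain ⟨b', rfl⟩ := hb
            exact congrArg (fun χ : LeftHom k S B' (C ν) => χ b') hφ
        have hg0 : g ∘ₗ eπ.symm.toLinearMap = 0 := LinearMap.pi_ext' fun m =>
          h.hom_standard_costandard_eq_zero hiν _
        rw [← LeftHom.toLinearMap_apply, ← hg, ← eπ.symm_apply_apply (qS b)]
        exact LinearMap.congr_fun hg0 _
      · obtain ⟨ψ, hψ⟩ := hext ν φ.toLinearMap
        exact ⟨LeftHom.of ψ, LeftHom.ext hψ⟩
termination_by Module.finrank k B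

end HighestWeightSystem

/-! ### The cokernel of the representation -/

/-- The left module `Hom_S(Hom_k(V, Y), X) ≅ V ⊗ Hom_S(Y, X)` is a direct sum of copies of `V`. -/
theorem LeftHom.nonempty_equiv_pi {k S : Type*} [Field k] [Ring S] [Algebra k S] {V Y X : Type*}
    [AddCommGroup V] [Module k V] [Module S V] [IsScalarTower k S V] [FiniteDimensional k V]
    [AddCommGroup Y] [Module k Y] [Module S Y] [IsScalarTower k S Y] [FiniteDimensional k Y]
    [AddCommGroup X] [Module k X] [Module S X] [IsScalarTower k S X] [FiniteDimensional k X] :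
    ∃ n, Nonempty ((Fin n → V) ≃ₗ[S] LeftHom k S (HomBimodule k S V Y) X) := by
  have : SMulCommClass S k X := IsScalarTower.to_smulCommClass'
  have : FiniteDimensional k (Y →ₗ[S] X) :=
    FiniteDimensional.of_injective (V₂ := Y →ₗ[k] X)
      { toFun := fun g => g.restrictScalars k
        map_add' := fun _ _ => rfl
        map_smul' := fun _ _ => rfl }
      fun _ _ hgg => LinearMap.ext fun y => LinearMap.congr_fun hgg y
  let b := Module.finBasis k (Y →ₗ[S] X)
  let Φ : (Fin (Module.finrank k (Y →ₗ[S] X)) → V) →ₗ[S]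
      LeftHom k S (HomBimodule k S V Y) X :=
    { toFun := fun v => LeftHom.of
        { toFun := fun φ => ∑ i, b i (φ (v i))
          map_add' := fun φ ψ => by
            simp only [HomBimodule.add_apply, map_add, Finset.sum_add_distrib]
          map_smul' := fun s φ => by
            simp only [HomBimodule.left_smul_apply, map_smul, Finset.smul_sum,
              RingHom.id_apply] }
      map_add' := fun v v' => LeftHom.ext fun φ => by
        simp only [LeftHom.of_apply, LinearMap.coe_mk, AddHom.coe_mk, Pi.add_apply, map_add,
          Finset.sum_add_distrib, LeftHom.add_apply]
      map_smul' := fun t v => LeftHom.ext fun φ => by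
        rw [RingHom.id_apply, LeftHom.smul_apply]
        simp only [LeftHom.of_apply, LinearMap.coe_mk, AddHom.coe_mk, Pi.smul_apply,
          HomBimodule.tmul_smul_apply, one_smul] }
  have hΦ : ∀ v φ, Φ v φ = ∑ i, b i (φ (v i)) := fun _ _ => rfl
  refine ⟨_, ⟨LinearEquiv.ofBijective Φ ⟨(injective_iff_map_eq_zero Φ).2 fun v hv => ?_,
    fun g => ?_⟩⟩⟩
  · refine funext fun i => (Module.forall_dual_apply_eq_zero_iff k _).1 fun α => ?_
    refine Fintype.linearIndependent_iff.1 b.linearIndependent (fun i => α (v i))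
      (LinearMap.ext fun y => ?_) i
    have h1 := hΦ v (HomBimodule.rankOne α y)
    rw [hv, LeftHom.zero_apply] at h1
    rw [LinearMap.sum_apply, LinearMap.zero_apply, h1]
    exact Finset.sum_congr rfl fun i _ => (map_smul ((b i).restrictScalars k) _ _).symm
  · -- For `α` in the dual of `V`, the map `y ↦ g (α y)` is a combination of the `b i`, with
    -- coefficients depending linearly on `α`.
    let γ : Module.Dual k V →ₗ[k] (Y →ₗ[S] X) :=
      { toFun := fun α => g.toLinearMap ∘ₗ HomBimodule.rankOneHom α
        map_add' := fun α β => LinearMap.ext fun y =>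
          (congrArg g (HomBimodule.add_rankOne α β y)).trans (map_add g _ _)
        map_smul' := fun c α => LinearMap.ext fun y =>
          (congrArg g (HomBimodule.smul_rankOne c α y)).trans
            (map_smul (g.toLinearMap.restrictScalars k) c _) }
    let v : Fin (Module.finrank k (Y →ₗ[S] X)) → V :=
      fun i => (Module.evalEquiv k V).symm (b.coord i ∘ₗ γ)
    have hv : ∀ i α, α (v i) = b.coord i (γ α) := fun i α =>
      Module.apply_evalEquiv_symm_apply k V α (b.coord i ∘ₗ γ)
    refine ⟨v, LeftHom.ext fun φ => ?_⟩
    refine HomBimodule.induction_rankOne (p := fun φ => Φ v φ = g φ)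
      ((map_zero (Φ v)).trans (map_zero g).symm) (fun φ ψ hφ hψ => by
        rw [map_add, map_add, hφ, hψ]) (fun α y => ?_) φ
    rw [hΦ]
    have h1 : γ α = ∑ i, α (v i) • b i := by
      simp only [hv]
      exact (b.sum_repr (γ α)).symm
    refine Eq.trans ?_ (LinearMap.congr_fun h1 y).symm
    rw [LinearMap.sum_apply]
    exact Finset.sum_congr rfl fun i _ => map_smul ((b i).restrictScalars k) _ _

/-- The quotient of a module by a submodule, with the restricted scalar actions. -/
theorem Submodule.exists_quotient {R S A : Type*} [Semiring R] [Semiring S] [Ring A]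
    [SMul R S] [SMul R A] [SMul S A] {X : Type w} [AddCommGroup X] [Module R X] [Module S X]
    [Module A X] [IsScalarTower R S X] [IsScalarTower R A X] [IsScalarTower S A X]
    [Module.Finite R X] (N : Submodule A X) :
    ∃ (B : Type w) (_ : AddCommGroup B) (_ : Module R B) (_ : Module S B) (_ : Module A B)
      (_ : IsScalarTower R S B) (_ : IsScalarTower R A B) (_ : IsScalarTower S A B)
      (_ : Module.Finite R B) (p : X →ₗ[A] B), Function.Surjective p ∧
        (∀ x, p x = 0 ↔ x ∈ N) ∧ Nonempty (B ≃ₗ[A] X ⧸ N) :=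
  ⟨X ⧸ N, inferInstance, inferInstance, inferInstance, inferInstance, ⟨fun r s x => by
    obtain ⟨x, rfl⟩ := N.mkQ_surjective x
    exact congrArg N.mkQ (smul_assoc r s x)⟩, inferInstance, inferInstance,
    Module.Finite.of_surjective (N.mkQ.restrictScalars R) N.mkQ_surjective, N.mkQ,
    N.mkQ_surjective, fun _ => Submodule.Quotient.mk_eq_zero N, ⟨LinearEquiv.refl _ _⟩⟩

namespace HighestWeightSystem

section Filtrations

variable {A : Type u} [Ring A] [IsArtinianRing A] {Λ : Type*} [PartialOrder Λ] {L : Λ → Type*}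
  {P I : Λ → Type u} [∀ i, AddCommGroup (L i)] [∀ i, Module A (L i)] [∀ i, AddCommGroup (P i)]
  [∀ i, Module A (P i)] [∀ i, AddCommGroup (I i)] [∀ i, Module A (I i)]
  {f : ∀ i, P i →ₗ[A] L i} {ι : ∀ i, L i →ₗ[A] I i} {K : ∀ i, Submodule A (P i)}
  {C : ∀ i, Submodule A (I i)} {X : Type*} [AddCommGroup X] [Module A X]

theorem ext_of_hasStandardFiltration (h : HighestWeightSystem f ι K C)
    (hX : HasStandardFiltration A L X) (j : Λ) : ExtOneVanishes A X (C j) := by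
  refine .of_filtration_left hX fun N N' hN => ?_
  rcases hN with hN | ⟨i, hi⟩
  · exact .of_subsingleton_left
  · exact h.ext_standard_costandard hi j

theorem ext_of_hasCostandardFiltration (h : HighestWeightSystem f ι K C)
    (hX : HasCostandardFiltration A L X) (i : Λ) : ExtOneVanishes A (P i ⧸ K i) X := by
  refine .of_filtration_right hX fun N N' hN => ?_
  rcases hN with hN | ⟨j, hj⟩
  · exact .of_subsingleton_right
  · obtain ⟨e⟩ := h.equiv_of_isCostandard hj
    exact (h.ext_standard_costandard (h.isStandard i) j).of_equiv_right e.symm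

end Filtrations

variable {k S : Type u} [Field k] [Ring S] [Algebra k S] [FiniteDimensional k S]
  {Λ : Type*} [Finite Λ] [PartialOrder Λ] {L : Λ → Type*} {P I : Λ → Type u}
  [∀ i, AddCommGroup (L i)] [∀ i, Module k (L i)] [∀ i, Module S (L i)]
  [∀ i, IsScalarTower k S (L i)]
  [∀ i, AddCommGroup (P i)] [∀ i, Module k (P i)] [∀ i, Module S (P i)]
  [∀ i, IsScalarTower k S (P i)]
  [∀ i, AddCommGroup (I i)] [∀ i, Module k (I i)] [∀ i, Module S (I i)]
  [∀ i, IsScalarTower k S (I i)]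
  [∀ i, FiniteDimensional k (L i)] [∀ i, FiniteDimensional k (P i)]
  [∀ i, FiniteDimensional k (I i)] [IsArtinianRing S]
  {f : ∀ i, P i →ₗ[S] L i} {ι : ∀ i, L i →ₗ[S] I i} {K : ∀ i, Submodule S (P i)}
  {C : ∀ i, Submodule S (I i)}

/-- Let `M` be a module with standard and costandard filtrations that maps onto each `∇(ν)`
such that maps from standard modules to `∇(ν)` lift to `M`. Then any quotient `B` of `End_k(M)` by
the image of `S` has a standard filtration. -/
theorem hasStandardFiltration_cokernel (h : HighestWeightSystem f ι K C)
    (hsplit : ∀ (i : Λ) (g : L i →ₗ[S] L i), ∃ c : k, ∀ x, g x = c • x)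
    {M : Type*} [AddCommGroup M] [Module k M] [Module S M] [IsScalarTower k S M]
    [FiniteDimensional k M] (hM : HasStandardFiltration S L M) (hM' : HasCostandardFiltration S L M)
    (hπ : ∀ ν, ∃ π : M →ₗ[S] C ν, Function.Surjective π ∧
      ∀ (μ : Λ) (φ : (P μ ⧸ K μ) →ₗ[S] C ν), ∃ ψ : (P μ ⧸ K μ) →ₗ[S] M, ∀ x, π (ψ x) = φ x)
    {B : Type*} [AddCommGroup B] [Module k B] [Module S B] [Module (S ⊗[k] Sᵐᵒᵖ) B]
    [IsScalarTower k S B] [IsScalarTower k (S ⊗[k] Sᵐᵒᵖ) B] [IsScalarTower S (S ⊗[k] Sᵐᵒᵖ) B]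
    [FiniteDimensional k B] (p : HomBimodule k S M M →ₗ[S ⊗[k] Sᵐᵒᵖ] B)
    (hp : Function.Surjective p) (hpρ : ∀ φ, p φ = 0 ↔ ∃ s : S, ∀ m, φ m = s • m) :
    HasStandardFiltration (S ⊗[k] Sᵐᵒᵖ) (fun p : Λ × Λ => OuterTensorDual k S (L p.1) (L p.2))
      B := by
  obtain ⟨pS, hpS⟩ : ∃ pS : HomBimodule k S M M →ₗ[S] B, ∀ φ, pS φ = p φ :=
    ⟨p.restrictScalars S, fun _ => rfl⟩
  have hpSs : Function.Surjective pS := fun b => by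
    obtain ⟨φ, hφ⟩ := hp b
    exact ⟨φ, (hpS φ).trans hφ⟩
  let ρ : HomBimodule k S M M := HomBimodule.of LinearMap.id
  have hρ : ∀ {φ}, pS φ = 0 ↔ ∃ s : S, φ = s • ρ := fun {φ} => by
    rw [hpS, hpρ]
    exact exists_congr fun s => ⟨fun hφ => HomBimodule.ext hφ, fun hφ m => by rw [hφ]; rfl⟩
  have hρ' : ∀ t : S, ((1 : S) ⊗ₜ[k] MulOpposite.op t : S ⊗[k] Sᵐᵒᵖ) • ρ = t • ρ := fun t =>
    HomBimodule.ext fun m => by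
      rw [HomBimodule.tmul_smul_apply, one_smul]
      rfl
  obtain ⟨n, ⟨eM⟩⟩ := HomBimodule.nonempty_equiv_pi (k := k) (S := S) (V := M) (X := M)
  refine h.hasStandardFiltration_of_ext hsplit (fun ν => ?_) fun μ ν => ?_
  · -- Every map `S → ∇(ν)` extends to `End_k(M)` as `φ ↦ π (φ m)`.
    have h1 : ExtOneVanishes S (HomBimodule k S M M) (C ν) :=
      (h.ext_of_hasStandardFiltration hM ν).pi_left.of_equiv_left eM.symm
    refine h1.of_extend pS hpSs fun φ => ?_
    obtain ⟨π, hπs, -⟩ := hπ ν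
    have hρk : pS ρ = 0 := hρ.2 ⟨1, (one_smul S ρ).symm⟩
    obtain ⟨m, hm⟩ := hπs (φ ⟨ρ, hρk⟩)
    refine ⟨
      { toFun := fun x => π (x m)
        map_add' := fun x y => map_add π _ _
        map_smul' := fun s x => map_smul π _ _ }, fun x => ?_⟩
    obtain ⟨s, hs⟩ := hρ.1 x.2
    have hx : x = s • ⟨ρ, hρk⟩ := Subtype.ext hs
    change π (x.1 m) = φ x
    rw [hs, hx, map_smul, ← hm, ← map_smul]
    rfl
  · -- `Hom_S(B, ∇(ν))` is the kernel of the evaluation `Hom_S(End_k(M), ∇(ν)) → ∇(ν)` at `1`.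
    have : FiniteDimensional k (C ν) := Module.Finite.of_injective
      ((C ν).subtype.restrictScalars k) (Submodule.subtype_injective _)
    obtain ⟨n', ⟨e⟩⟩ := LeftHom.nonempty_equiv_pi (k := k) (S := S) (V := M) (Y := M) (X := C ν)
    have h1 : ExtOneVanishes S (P μ ⧸ K μ) (LeftHom k S (HomBimodule k S M M) (C ν)) :=
      (h.ext_of_hasCostandardFiltration hM' μ).pi_right.of_equiv_right e
    let ev : LeftHom k S (HomBimodule k S M M) (C ν) →ₗ[S] C ν :=
      { toFun := fun g => g ρ
        map_add' := fun _ _ => rfl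
        map_smul' := fun t g => by
          rw [LeftHom.smul_apply, hρ', map_smul, RingHom.id_apply] }
    refine h1.of_lift (LeftHom.map p LinearMap.id) ?_ ev (fun g => ⟨fun hg => ?_, ?_⟩) fun φ => ?_
    · refine fun g g' hgg => LeftHom.ext fun b => ?_
      obtain ⟨φ, rfl⟩ := hp b
      exact congrArg (fun χ : LeftHom k S (HomBimodule k S M M) (C ν) => χ φ) hgg
    · obtain ⟨g', hg'⟩ := LinearMap.exists_comp_eq_of_ker_le pS hpSs g.toLinearMap fun φ hφ => by
        obtain ⟨s, rfl⟩ := hρ.1 hφ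
        rw [map_smul]
        exact (congrArg (s • ·) hg).trans (smul_zero s)
      exact ⟨LeftHom.of g', LeftHom.ext fun φ => (congrArg g' (hpS φ).symm).trans (hg' φ)⟩
    · rintro ⟨g, rfl⟩
      change g (p ρ) = 0
      rw [← hpS, hρ.2 ⟨1, (one_smul S ρ).symm⟩, map_zero]
    · obtain ⟨π, -, hπl⟩ := hπ ν
      obtain ⟨ψ, hψ⟩ := hπl μ φ
      exact ⟨
        { toFun := fun x => LeftHom.of
            { toFun := fun χ => π (χ (ψ x))
              map_add' := fun χ χ' => map_add π _ _
              map_smul' := fun s χ => map_smul π _ _ }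
          map_add' := fun x y => LeftHom.ext fun χ => by
            change π (χ (ψ (x + y))) = π (χ (ψ x)) + π (χ (ψ y))
            rw [map_add, map_add, map_add]
          map_smul' := fun t x => LeftHom.ext fun χ => by
            rw [RingHom.id_apply, LeftHom.smul_apply]
            change π (χ (ψ (t • x))) = π ((_ : HomBimodule k S M M) (ψ x))
            rw [HomBimodule.tmul_smul_apply, one_smul, map_smul] }, hψ⟩

/-- The form of `hasStandardFiltration_cokernel` for a quotient by a sub-bimodule. -/
theorem hasStandardFiltration_quotient (h : HighestWeightSystem f ι K C)
    (hsplit : ∀ (i : Λ) (g : L i →ₗ[S] L i), ∃ c : k, ∀ x, g x = c • x)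
    {M : Type*} [AddCommGroup M] [Module k M] [Module S M] [IsScalarTower k S M]
    [FiniteDimensional k M] (hM : HasStandardFiltration S L M) (hM' : HasCostandardFiltration S L M)
    (hπ : ∀ ν, ∃ π : M →ₗ[S] C ν, Function.Surjective π ∧
      ∀ (μ : Λ) (φ : (P μ ⧸ K μ) →ₗ[S] C ν), ∃ ψ : (P μ ⧸ K μ) →ₗ[S] M, ∀ x, π (ψ x) = φ x)
    (N : Submodule (S ⊗[k] Sᵐᵒᵖ) (HomBimodule k S M M))
    (hN : ∀ φ : HomBimodule k S M M, φ ∈ N ↔ ∃ s : S, ∀ m, φ m = s • m) :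
    HasStandardFiltration (S ⊗[k] Sᵐᵒᵖ) (fun p : Λ × Λ => OuterTensorDual k S (L p.1) (L p.2))
      (HomBimodule k S M M ⧸ N) := by
  obtain ⟨B, _, _, _, _, _, _, _, _, p, hp, hpN, ⟨e⟩⟩ := N.exists_quotient (R := k) (S := S)
  exact (h.hasStandardFiltration_cokernel hsplit hM hM' hπ p hp fun φ =>
    (hpN φ).trans (hN φ)).of_equiv e

end HighestWeightSystem

theorem proposition4p5 {k S : Type u} [Field k] [Ring S] [Algebra k S] [FiniteDimensional k S]
    {Λ : Type*} [Finite Λ] [PartialOrder Λ] (L : Λ → Type*) [∀ i, AddCommGroup (L i)]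
    [∀ i, Module k (L i)] [∀ i, Module S (L i)] [∀ i, IsScalarTower k S (L i)]
    (hsplit : ∀ (i : Λ) (f : L i →ₗ[S] L i), ∃ c : k, ∀ x, f x = c • x)
    (hS : IsQuasiHereditary S L)
    (M : Type*) [AddCommGroup M] [Module k M] [Module S M] [IsScalarTower k S M]
    [FiniteDimensional k M] (hM : IsFullTilting S L M) :
    Function.Injective (Algebra.lsmul k k M : S →ₐ[k] Module.End k M) ∧
      HasStandardFiltration (S ⊗[k] Sᵐᵒᵖ)
        (fun p : Λ × Λ => OuterTensorDual k S (L p.1) (L p.2))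
        (RepresentationCokernel k S M) := by
  have : IsArtinianRing S := IsArtinianRing.of_finite k S
  have hsimple := hS.simple
  have : ∀ i, FiniteDimensional k (L i) := fun i => Module.Finite.trans S (L i)
  choose I iI iI' ι C hι hC hI using hS.highest_weight
  -- The projective covers are part of the standard sections of the indecomposable tilting modules.
  have hP : ∀ i, ∃ (P : Type u) (_ : AddCommGroup P) (_ : Module S P) (f : P →ₗ[S] L i)
      (K : Submodule S P), IsProjectiveCover f ∧ IsLeast {K : Submodule S P |
        K ≤ LinearMap.ker f ∧ BelongsTo S L (Set.Iio i)
          (↥(LinearMap.ker f) ⧸ K.submoduleOf (LinearMap.ker f))} K := fun i => by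
    obtain ⟨T, T', -, hT⟩ := hM.full i
    obtain ⟨N, N', P, _, _, f, g, hf, -, hg⟩ := exists_isStandard hS.simple hS.non_isomorphic
      hT.tilting.1 hT.highest_weight_mem hT.belongs
    exact ⟨P, _, _, f, LinearMap.ker g, hf, hg⟩
  choose P iP iP' f K hf hK using hP
  -- As `P(i)` and `I(i)` are only `S`-modules, the action of `k` is defined through `S`.
  let _ : ∀ i, Module k (I i) := fun i => Module.compHom (I i) (algebraMap k S)
  let _ : ∀ i, Module k (P i) := fun i => Module.compHom (P i) (algebraMap k S)
  have : ∀ i, IsScalarTower k S (I i) := fun i => IsScalarTower.of_algebraMap_smul fun _ _ => rfl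
  have : ∀ i, IsScalarTower k S (P i) := fun i => IsScalarTower.of_algebraMap_smul fun _ _ => rfl
  have : ∀ i, FiniteDimensional k (I i) := fun i => by
    obtain ⟨j, hj⟩ := CoregularModule.exists_injective_of_hull (k := k) (hι i)
    exact Module.Finite.of_injective (j.restrictScalars k) hj
  have hPS : ∀ i, Module.Finite S (P i) := fun i => (hf i).finite
  have : ∀ i, FiniteDimensional k (P i) := fun i => Module.Finite.trans S (P i)
  have h : HighestWeightSystem f ι K C :=
    ⟨hS.simple, hS.non_isomorphic, hS.complete,
      fun i => Module.Finite.of_restrictScalars_finite k S (I i), hf, hK, hι, hC, hI⟩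
  have hπ : ∀ ν, ∃ π : M →ₗ[S] C ν, Function.Surjective π ∧ ∀ (μ : Λ)
      (φ : (P μ ⧸ K μ) →ₗ[S] C ν), ∃ ψ : (P μ ⧸ K μ) →ₗ[S] M, ∀ x, π (ψ x) = φ x := fun ν => by
    obtain ⟨T, T', hTT', hT⟩ := hM.full ν
    obtain ⟨π, hπ, hπl⟩ := h.exists_surjective_costandard hT.tilting.2 hT.highest_weight_mem
      hT.belongs
    let r := T.projectionOnto T' hTT'
    have hr : ∀ x : T, r x = x := fun x => Submodule.projectionOnto_apply_left hTT' x
    refine ⟨π ∘ₗ r, fun y => ?_, fun μ φ => ?_⟩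
    · obtain ⟨x, rfl⟩ := hπ y
      exact ⟨x.1, by rw [LinearMap.comp_apply, hr]⟩
    · obtain ⟨ψ, hψ⟩ := hπl μ φ
      exact ⟨T.subtype ∘ₗ ψ, fun x => (congrArg π (hr (ψ x))).trans (hψ x)⟩
  refine ⟨(injective_iff_map_eq_zero _).2 fun s hs => ?_, ?_⟩
  · exact h.eq_zero_of_smul_eq_zero (h.ext_of_hasStandardFiltration hM.tilting.1)
      (fun ν => (hπ ν).imp fun _ hπ => hπ.1) fun m => LinearMap.congr_fun hs m
  · refine h.hasStandardFiltration_quotient hsplit hM.tilting.1 hM.tilting.2 hπ _ fun φ => ?_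
    constructor
    · rintro ⟨s, rfl⟩
      exact ⟨s, fun _ => rfl⟩
    · rintro ⟨s, hs⟩
      exact ⟨s, HomBimodule.ext fun m => (hs m).symm⟩
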